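/- **Setting.** Let $(\Sigma,\theta)$ be a one-sided topological Markov chain over a countable alphabet $\mathcal W$ (no row or column of the transition matrix vanishes) which is topologically mixing and has big images and preimages, i.e. there is a finite $I\subset\mathcal W$ such that for every $v\in\mathcal W$ there are $\beta_1,\beta_2\in I$ with $v\beta_1$ and $\beta_2v$ admissible. For $0<r<1$ let $d_r(x,y)=r^{k}$, where $k$ is the number of initial letters on which $x$ and $y$ agree. Let $\varphi:\Sigma\to(0,\infty)$ be such that $\log\varphi$ is locally Hölder continuous, i.e. $\sup\{|\log\varphi(x)-\log\varphi(y)| : x_i=y_i \text{ for } i\le n\}\le C r^n$ for all $n\ge1$, and such that $\sup_{x}\sum_{\theta y=x}\varphi(y)<\infty$; put $\Phi_n=\prod_{k<n}\varphi\circ\theta^k$. For a word $v$ of length $n$, $\tau_v$ is the inverse branch $\theta^n([v])\to[v]$ of $\theta^n$. Let $G$ be a countable group, let $\psi:\Sigma\to G$ depend only on the first letter, and let $X=\Sigma\times G$, $T(x,g)=(\theta x,g\psi(x))$, $X_g=\Sigma\times\{g\}$; assume that the Markov chain $(X,T)$ is topologically transitive. Extend $d_r$ to $X$ by $d_r((x,g),(y,g))=d_r(x,y)$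 and $d_r((x,g),(y,h))=1$ for $g\ne h$, write $\varphi(x,g)=\varphi(x)$, and put $\mathcal L_\varphi f(z)=\sum_{Ty=z}\varphi(y)f(y)$. **Conformal measures.** Fix $\xi\in\Sigma$, and let $\mathcal Z^n=\mathcal L_\varphi^n(\mathbf 1_{X_{id}})(\xi,id)$ and $\rho=\limsup_n(\mathcal Z^n)^{1/n}$. A *weight* is a nondecreasing sequence $b_n\ge1$ with $b_n/b_{n+1}\to1$ such that $\mathcal P(s)=\sum_{n\ge1}s^{-n}b_n\mathcal Z^n$ is infinite for $0<s\le\rho$ and finite for $s>\rho$. For $s>\rho$ and $\zeta\in X$ let $m^s_\zeta$ be the measure with $\int f\,dm^s_\zeta=\mathcal P(s)^{-1}\sum_{n\ge1}b_ns^{-n}\mathcal L_\varphi^nf(\zeta)$. Assume property (C): for some weight and some $s_k\searrow\rho$, the measures $m^{s_k}_{(\xi,id)}|_{X_{id}}$ converge weakly to a probability measure. **Function spaces.** Let $C_n(f)$ be the infimum of all $C\ge0$ with $|f(z_1)-f(z_2)|\le C|f(z_1)|$ whenever $z_1,z_2$ lie in the same $X_g$ and agree in their first $n$ letters. For a measure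 $\nu_{\mathbf o}$ on $X$ let $$\mathcal C=\{f:X\to\mathbb R:\ \nu_{\mathbf o}(|f|)<\infty,\ \lim_nC_n(f)=0\}.$$ With the convention $0/0=1$ and $|a/0|=\infty$ for $a\ne0$, all suprema being over distinct points, let $$D_x(f)=\sup_{d_r(x,z)<1}\frac{|f(x)-f(z)|}{d_r(x,z)},\qquad LD(f)=\sup_{d_r(z_1,z_2)<1}\frac{|f(z_1)/f(z_2)-1|}{d_r(z_1,z_2)},$$ $$C_\varphi=\sup\Big\{\Big|\frac{\Phi_n(\tau_vx_1)}{\Phi_n(\tau_vx_2)}-1\Big|\Big/d_r(x_1,x_2):\ n\ge1,\ v\text{ a word of length }n,\ x_1,x_2\in\theta^n([v]),\ d_r(x_1,x_2)<1\Big\}.$$ Finally let $$\mathcal H^+=\{f:X\to[0,\infty):\ \mathcal L_\varphi f=\rho f,\ LD(f)<\infty\},$$ $$\mathcal H=\{f:X\to\mathbb R:\ \mathcal L_\varphi f=\rho f,\ \exists h\in\mathcal H^+\ \forall x\in X:\ D_x(f)\le h(x)\},$$ where $\mathcal L_\varphi f=\rho f$ includes that the series converges unconditionally at every point. **Theorem.**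 1. There are a weight $(b_n)$, a sequence $s_k\searrow\rho$ and measures $(\nu_z)_{z\in X}$ on $X$ such that, for all $z\in X$ and $g\in G$, $m^{s_k}_z|_{X_g}\to\nu_z|_{X_g}$ weakly. 2. Let $(b_n)$, $(s_k)$, $(\nu_z)$ be any such choice, let $\mathbf o\in X_{id}$ be any reference point, and define $\mathcal C$ by means of $\nu_{\mathbf o}$. Then every $\nu_z$ is finite on each $X_g$ and absolutely continuous with respect to $\nu_{\mathbf o}$. With $\mathbb K(\delta_z,y)=\frac{d\nu_z}{d\nu_{\mathbf o}}(y)$, for every $f\in\mathcal C$ and $z\in X$ the function $f$ is $\nu_z$-integrable, $\mathbb K(\delta_z,\cdot)f$ is $\nu_{\mathbf o}$-integrable, and $$\Theta(f)(z):=\int\mathbb K(\delta_z,y)f(y)\,d\nu_{\mathbf o}(y)=\nu_z(f).$$ Moreover $\Theta(f)\in\mathcal H$; that is, $\Theta:\mathcal C\to\mathcal H$ is well defined. 3. $C_\varphi<\infty$, and every $f\in\mathcal H$ with $f\ge0$ satisfies $LD(f)\le C_\varphi$; in particular $f\in\mathcal H^+$. -/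

import Mathlib

open MeasureTheory Filter Topology
open scoped ENNReal NNReal BoundedContinuousFunction

noncomputable section

namespace GroupExt

variable {W G : Type*}

/-! ### Topological Markov chains -/

/-- The one-sided topological Markov chain over the alphabet `W` whose transition matrix has
entry `1` at `(i, j)` exactly when `A i j`. Sequences are indexed from `0`. With `W` discrete,
the topology and the Borel structure are those generated by cylinders. -/
abbrev Chain (A : W → W → Prop) : Type _ := {x : ℕ → W // ∀ i, A (x i) (x (i + 1))}

/-- The shift map. -/
def shift {A : W → W → Prop} (x : Chain A) : Chain A :=
  ⟨fun i => x.1 (i + 1), fun i => x.2 (i + 1)⟩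

/-- No row and no column of the transition matrix vanishes. -/
def NoZeroLines (A : W → W → Prop) : Prop :=
  (∀ i, ∃ j, A i j) ∧ (∀ j, ∃ i, A i j)

/-- Topological mixing: for all letters `a, b`, the set `θⁿ [a] ∩ [b]` is nonempty for all
large `n`. -/
def TopMixing (A : W → W → Prop) : Prop :=
  ∀ a b : W, ∃ N : ℕ, ∀ n ≥ N,
    ((shift^[n]) '' {x : Chain A | x.1 0 = a} ∩ {x : Chain A | x.1 0 = b}).Nonempty

/-- Big images and big preimages. -/
def BigImagesPreimages (A : W → W → Prop) : Prop :=
  ∃ I : Finset W, ∀ v : W, ∃ β₁ ∈ I, ∃ β₂ ∈ I, A v β₁ ∧ A β₂ v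

/-- The metric `d_r (x, y) = r ^ k`, where `k` is the number of initial letters on which `x` and
`y` agree. -/
def dShift {A : W → W → Prop} (r : ℝ) (x y : Chain A) : ℝ :=
  open Classical in if x = y then 0 else r ^ PiNat.firstDiff x.1 y.1

/-! ### Potentials -/

/-- `V_n (log φ) ≪ rⁿ` for `n ≥ 1`. -/
def LogLocallyHolder {A : W → W → Prop} (r : ℝ) (φ : Chain A → ℝ) : Prop :=
  ∃ C : ℝ, ∀ n ≥ 1, ∀ x y : Chain A, (∀ i < n, x.1 i = y.1 i) →
    |Real.log (φ x) - Real.log (φ y)| ≤ C * r ^ n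

/-- `‖L_φ 1‖_∞ < ∞` for the Ruelle operator `L_φ f (x) = ∑_{θ y = x} φ y * f y` of the base. -/
def BoundedRuelleOne {A : W → W → Prop} (φ : Chain A → ℝ) : Prop :=
  ∃ M : ℝ≥0, ∀ x : Chain A,
    ∑' y : {y : Chain A // shift y = x}, ENNReal.ofReal (φ y.1) ≤ (M : ℝ≥0∞)

/-- `Φ_n = ∏_{k < n} φ ∘ θᵏ`. -/
def birkhoffProd {A : W → W → Prop} (φ : Chain A → ℝ) (n : ℕ) (x : Chain A) : ℝ :=
  ∏ k ∈ Finset.range n, φ (shift^[k] x)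

/-- `|a / b - 1|` as an extended nonnegative number, with `0 / 0 = 1` and `a / 0 = ∞` for
`a ≠ 0`. -/
def relDiff (a b : ℝ) : ℝ≥0∞ := ENNReal.ofReal |a - b| / ENNReal.ofReal |b|

/-- `C_φ = sup |Φ_n (τ_v x₁) / Φ_n (τ_v x₂) - 1| / d_r (x₁, x₂)`, the supremum being over all
words `v` of length `n ≥ 1` and all `x₁, x₂` in the domain of `τ_v` with `d_r (x₁, x₂) < 1`.
Here `y₁ = τ_v x₁` and `y₂ = τ_v x₂`: these are the pairs of points with the same first `n`
letters (namely `v`), and `x₁ = θⁿ y₁`, `x₂ = θⁿ y₂`. -/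
def distortionConst {A : W → W → Prop} (r : ℝ) (φ : Chain A → ℝ) : ℝ≥0∞ :=
  ⨆ (n : ℕ) (y₁ : Chain A) (y₂ : Chain A) (_ : 1 ≤ n) (_ : ∀ i < n, y₁.1 i = y₂.1 i)
    (_ : dShift r (shift^[n] y₁) (shift^[n] y₂) < 1),
    relDiff (birkhoffProd φ n y₁) (birkhoffProd φ n y₂) /
      ENNReal.ofReal (dShift r (shift^[n] y₁) (shift^[n] y₂))

/-! ### Group extensions -/

/-- The phase space `X = Σ × G` of the group extension. -/
abbrev Ext (A : W → W → Prop) (G : Type*) : Type _ := Chain A × G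

/-- The fibre `X_g`. -/
def fibre (A : W → W → Prop) (g : G) : Set (Ext A G) := {z | z.2 = g}

/-- The metric on `X`: `d_r` inside a fibre, `1` between different fibres. -/
def dExt {A : W → W → Prop} (r : ℝ) (z₁ z₂ : Ext A G) : ℝ :=
  open Classical in if z₁.2 = z₂.2 then dShift r z₁.1 z₂.1 else 1

/-- `C_n (f)`: the infimum of all `C ≥ 0` such that `|f z₁ - f z₂| ≤ C |f z₁|` whenever
`z₁, z₂` lie in the same fibre and in the same cylinder of length `n` (`∞` if there is none). -/
def oscConst {A : W → W → Prop} (n : ℕ) (f : Ext A G → ℝ) : ℝ≥0∞ :=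
  sInf {C : ℝ≥0∞ | ∀ z₁ z₂ : Ext A G, z₁.2 = z₂.2 → (∀ i < n, z₁.1.1 i = z₂.1.1 i) →
    ENNReal.ofReal |f z₁ - f z₂| ≤ C * ENNReal.ofReal |f z₁|}

/-- `D_x (f) = sup {|f x - f z| / d_r (x, z) : d_r (x, z) < 1}`. -/
def locLip {A : W → W → Prop} (r : ℝ) (f : Ext A G → ℝ) (x : Ext A G) : ℝ≥0∞ :=
  ⨆ (z : Ext A G) (_ : dExt r x z < 1),
    ENNReal.ofReal |f x - f z| / ENNReal.ofReal (dExt r x z)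

/-- `LD (f) = sup {|f z₁ / f z₂ - 1| / d_r (z₁, z₂) : d_r (z₁, z₂) < 1}`. -/
def logLip {A : W → W → Prop} (r : ℝ) (f : Ext A G → ℝ) : ℝ≥0∞ :=
  ⨆ (z₁ : Ext A G) (z₂ : Ext A G) (_ : dExt r z₁ z₂ < 1),
    relDiff (f z₁) (f z₂) / ENNReal.ofReal (dExt r z₁ z₂)

variable [Group G]

/-- The group extension `T (x, g) = (θ x, g ψ(x))`, where `ψ` depends on the first letter. -/
def extMap {A : W → W → Prop} (ψ : W → G) (z : Ext A G) : Ext A G :=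
  (shift z.1, z.2 * ψ (z.1.1 0))

/-- Topological transitivity of the Markov chain `(X, T)`. -/
def TopTransitiveExt (A : W → W → Prop) (ψ : W → G) : Prop :=
  ∀ (a b : W) (g h : G), ∃ n ≥ 1,
    (((extMap ψ)^[n]) '' {z : Ext A G | z.1.1 0 = a ∧ z.2 = g} ∩
      {z : Ext A G | z.1.1 0 = b ∧ z.2 = h}).Nonempty

/-- `f` satisfies `𝓛_φ f = t f`, where `𝓛_φ f (z) = ∑_{T y = z} φ y * f y` and the series
converges (unconditionally) at every point `z`. -/
def IsHarmonic {A : W → W → Prop} (ψ : W → G) (φ : Chain A → ℝ) (t : ℝ)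
    (f : Ext A G → ℝ) : Prop :=
  ∀ z : Ext A G, HasSum (fun y : {y : Ext A G // extMap ψ y = z} => φ y.1.1 * f y.1) (t * f z)

/-- `𝓩ⁿ(ξ) = ∑ Φ_n (x)` over all `x` with `θⁿ x = ξ` and `ψ_n (x) = id`, that is, with
`Tⁿ (x, id) = (ξ, id)`. -/
def returnSum {A : W → W → Prop} (ψ : W → G) (φ : Chain A → ℝ) (ξ : Chain A) (n : ℕ) : ℝ≥0∞ :=
  ∑' x : {x : Chain A // (extMap ψ)^[n] (x, 1) = (ξ, 1)}, ENNReal.ofReal (birkhoffProd φ n x.1)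

/-- `ρ = limsup_n (𝓩ⁿ(ξ))^{1/n}`. -/
def specRad {A : W → W → Prop} (ψ : W → G) (φ : Chain A → ℝ) (ξ : Chain A) : ℝ :=
  (limsup (fun n : ℕ => returnSum ψ φ ξ n ^ (1 / (n : ℝ))) atTop).toReal

/-- The space `𝓗⁺` of nonnegative `ρ`-harmonic functions `f` with `LD (f) < ∞`. -/
def harmonicPos {A : W → W → Prop} (ψ : W → G) (φ : Chain A → ℝ) (r : ℝ) (ξ : Chain A) :
    Set (Ext A G → ℝ) :=
  {f | (∀ z, 0 ≤ f z) ∧ IsHarmonic ψ φ (specRad ψ φ ξ) f ∧ logLip r f < ⊤}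

/-- The space `𝓗` of `ρ`-harmonic functions `f` such that `D_x (f) ≤ h x` for all `x`, for some
`h ∈ 𝓗⁺`. -/
def harmonicLip {A : W → W → Prop} (ψ : W → G) (φ : Chain A → ℝ) (r : ℝ) (ξ : Chain A) :
    Set (Ext A G → ℝ) :=
  {f | IsHarmonic ψ φ (specRad ψ φ ξ) f ∧
    ∃ h ∈ harmonicPos ψ φ r ξ, ∀ x, locLip r f x ≤ ENNReal.ofReal (h x)}

/-! ### The conformal measures -/

/-- `𝓟(t) = ∑_{n ≥ 1} t⁻ⁿ b_n 𝓩ⁿ(ξ)`. -/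
def poincareSeries {A : W → W → Prop} (ψ : W → G) (φ : Chain A → ℝ) (ξ : Chain A)
    (b : ℕ → ℝ) (t : ℝ) : ℝ≥0∞ :=
  ∑' n : ℕ, ENNReal.ofReal (b (n + 1) * t⁻¹ ^ (n + 1)) * returnSum ψ φ ξ (n + 1)

/-- A nondecreasing sequence `b_n ≥ 1` with `b_n / b_{n+1} → 1` for which `𝓟(t)` diverges for
`t ≤ ρ` and converges for `t > ρ`. -/
structure IsWeight {A : W → W → Prop} (ψ : W → G) (φ : Chain A → ℝ) (ξ : Chain A)
    (b : ℕ → ℝ) : Prop where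
  mono : Monotone b
  one_le : ∀ n, 1 ≤ b n
  ratio : Tendsto (fun n => b n / b (n + 1)) atTop (𝓝 1)
  diverges : ∀ t : ℝ, 0 < t → t ≤ specRad ψ φ ξ → poincareSeries ψ φ ξ b t = ⊤
  converges : ∀ t : ℝ, specRad ψ φ ξ < t → poincareSeries ψ φ ξ b t < ⊤

/-- `s_k ↘ ρ`. -/
structure DecreasesTo (s : ℕ → ℝ) (t : ℝ) : Prop where
  anti : Antitone s
  gt : ∀ k, t < s k
  lim : Tendsto s atTop (𝓝 t)

variable [MeasurableSpace W] [MeasurableSpace G]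

/-- The measure `m^t_ζ = 𝓟(t)⁻¹ ∑_{n ≥ 1} t⁻ⁿ b_n ∑_{Tⁿ y = ζ} Φ_n (y) δ_y`, that is,
`∫ f dm^t_ζ = 𝓟(t)⁻¹ ∑_{n ≥ 1} t⁻ⁿ b_n 𝓛ⁿ_φ f (ζ)`. -/
def approxMeasure {A : W → W → Prop} (ψ : W → G) (φ : Chain A → ℝ) (ξ : Chain A)
    (b : ℕ → ℝ) (t : ℝ) (ζ : Ext A G) : Measure (Ext A G) :=
  (poincareSeries ψ φ ξ b t)⁻¹ • Measure.sum fun n : ℕ =>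
    ENNReal.ofReal (b (n + 1) * t⁻¹ ^ (n + 1)) •
      Measure.sum fun y : {y : Ext A G // (extMap ψ)^[n + 1] y = ζ} =>
        ENNReal.ofReal (birkhoffProd φ (n + 1) y.1.1) • Measure.dirac y.1

variable [TopologicalSpace W] [TopologicalSpace G]

/-- Property (C): for some weight `b` and some `s_k ↘ ρ`, the restrictions to `X_id` of the
measures `m^{s_k}_{(ξ, id)}` converge weakly to a probability measure. -/
def PropertyC {A : W → W → Prop} (ψ : W → G) (φ : Chain A → ℝ) (ξ : Chain A) : Prop :=
  ∃ (b : ℕ → ℝ) (s : ℕ → ℝ) (m : Measure (Ext A G)),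
    IsWeight ψ φ ξ b ∧ DecreasesTo s (specRad ψ φ ξ) ∧ IsProbabilityMeasure m ∧
    ∀ f : Ext A G →ᵇ ℝ≥0,
      Tendsto (fun k => ∫⁻ y in fibre A (1 : G), f y ∂(approxMeasure ψ φ ξ b (s k) (ξ, 1)))
        atTop (𝓝 (∫⁻ y, f y ∂m))

/-- `ν = (ν_ζ)` is the family of the limits `ν_ζ = lim_k m^{s_k}_ζ` for `ζ ∈ X`, where `b` is a
weight and `s_k ↘ ρ`; convergence means weak convergence on each fibre `X_g`. -/
structure IsLimitFamily {A : W → W → Prop} (ψ : W → G) (φ : Chain A → ℝ) (ξ : Chain A)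
    (b s : ℕ → ℝ) (ν : Ext A G → Measure (Ext A G)) : Prop where
  weight : IsWeight ψ φ ξ b
  decreases : DecreasesTo s (specRad ψ φ ξ)
  conv : ∀ (ζ : Ext A G) (g : G) (f : Ext A G →ᵇ ℝ≥0),
    Tendsto (fun k => ∫⁻ y in fibre A g, f y ∂(approxMeasure ψ φ ξ b (s k) ζ))
      atTop (𝓝 (∫⁻ y in fibre A g, f y ∂(ν ζ)))

/-- The space `𝓒`: functions `f` with `ν_o (|f|) < ∞` and `C_n (f) → 0`. -/
def logUnifCont {A : W → W → Prop} (νo : Measure (Ext A G)) : Set (Ext A G → ℝ) :=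
  {f | ∫⁻ y, ENNReal.ofReal |f y| ∂νo < ⊤ ∧ Tendsto (fun n => oscConst n f) atTop (𝓝 0)}

/-- The kernel `K(δ_z, y) = (dν_z / dν_o) (y)`. -/
def martinKernel {A : W → W → Prop} (ν : Ext A G → Measure (Ext A G)) (o z y : Ext A G) : ℝ :=
  ((ν z).rnDeriv (ν o) y).toReal

/-- `Θ(f)(z) = ∫ K(δ_z, y) f(y) dν_o(y)`. -/
def Theta {A : W → W → Prop} (ν : Ext A G → Measure (Ext A G)) (o : Ext A G)
    (f : Ext A G → ℝ) (z : Ext A G) : ℝ :=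
  ∫ y, martinKernel ν o z y * f y ∂(ν o)

end GroupExt

end

/-!
Bounded distortion makes `Φ_n` on corresponding preimages of two points comparable, with factor
`exp (C rᵏ)` if the points share `k ≥ 1` letters. Big images and preimages together with
transitivity connect arbitrary points of `X`, so `m^t_z ≤ K m^t_{z'}` for `t` near `ρ`, up to
finitely many terms of the defining series. These are negligible in the limit because
`𝓟 (s_k) → ∞`. Hence the limits satisfy the Harnack inequality `ν_z ≤ K ν_{z'}`, with `K` close to
`1` for close points, which gives absolute continuity, integrability and the Lipschitz estimates.

For the existence, a diagonal subsequence makes the masses of the countably many cylinders converge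
at a dense set of base points, and by the sharp form of the comparison at every base point. Being
dominated by a translate of the limit in property (C), the limiting contents extend to measures.

Shifting the index in the defining series, which is harmless since `b_n / b_{n+1} → 1`, shows
`∑_{T y = z} φ (y) ν_y = ρ ν_z`. Only finitely many preimages can be treated by passing to the limit
term by term. By big images and preimages, the contribution of the preimages with first letter in
`S` is bounded by the `ν_{(ξ, id)}`-mass of the points of `X_id` with first letter in `S`, which is
small when the complement of `S` is large. So `z ↦ ν_z (f)` is harmonic.

Finally, for nonnegative harmonic `f` write `f = ρ⁻ⁿ 𝓛ⁿ f` at two close points. The variation of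
`f` on the preimages is `O(rⁿ)` relative to the majorant `h ∈ 𝓗⁺`, so it disappears as
`n → ∞` and only the variation of `Φ_n`, bounded by `C_φ`, remains.
-/

noncomputable section

namespace GroupExt

/-! ### Splicing orbits -/

section Splice

variable {W G : Type*} {A : W → W → Prop}

lemma shift_iterate_apply (n : ℕ) (x : Chain A) (i : ℕ) : (shift^[n] x).1 i = x.1 (i + n) := by
  induction n generalizing x with
  | zero => rfl
  | succ n ih => rw [Function.iterate_succ_apply, ih, ← add_assoc]; rfl

lemma agree_add_of_agree_shift_iterate {n k : ℕ} {x y : Chain A} (hn : ∀ i < n, x.1 i = y.1 i)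
    (hk : ∀ i < k, (shift^[n] x).1 i = (shift^[n] y).1 i) : ∀ i < n + k, x.1 i = y.1 i := by
  intro i hi
  rcases lt_or_ge i n with hin | hni
  · exact hn i hin
  · have := hk (i - n) (by omega)
    rwa [shift_iterate_apply, shift_iterate_apply, Nat.sub_add_cancel hni] at this

lemma eq_of_shift_iterate_eq {n : ℕ} {x y : Chain A} (h : ∀ i < n, x.1 i = y.1 i)
    (hs : shift^[n] x = shift^[n] y) : x = y :=
  Subtype.ext <| funext fun i =>
    agree_add_of_agree_shift_iterate (k := i + 1) h (fun j _ => by rw [hs]) i (by omega)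

/-- The point whose first `n + 1` letters are those of `y`, followed by `x`. It realises the
inverse branch `τ_v` at `x`, where `v` is the word formed by the first `n + 1` letters of `y`. -/
def splice (n : ℕ) (y x : Chain A) (h : A (y.1 n) (x.1 0)) : Chain A :=
  ⟨fun i => if i ≤ n then y.1 i else x.1 (i - (n + 1)), by
    intro i
    rcases lt_trichotomy i n with hi | rfl | hi
    · simpa [hi.le, Nat.succ_le_of_lt hi] using y.2 i
    · simpa using h
    · obtain ⟨j, rfl⟩ := Nat.exists_eq_add_of_lt hi
      have h₁ : ¬ n + j + 1 ≤ n := by omega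
      have h₂ : ¬ n + j + 1 + 1 ≤ n := by omega
      simp only [h₁, h₂, if_false]
      convert x.2 j using 2 <;> omega⟩

lemma splice_apply_of_le {n i : ℕ} {y x : Chain A} (h : A (y.1 n) (x.1 0)) (hi : i ≤ n) :
    (splice n y x h).1 i = y.1 i := by
  simp [splice, hi]

lemma shift_iterate_splice {n : ℕ} {y x : Chain A} (h : A (y.1 n) (x.1 0)) :
    shift^[n + 1] (splice n y x h) = x := by
  refine Subtype.ext (funext fun i => ?_)
  have hi : ¬ i + (n + 1) ≤ n := by omega
  rw [shift_iterate_apply]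
  simp [splice, hi]

variable [Group G] {ψ : W → G}

lemma extMap_iterate_fst (n : ℕ) (z : Ext A G) : ((extMap ψ)^[n] z).1 = shift^[n] z.1 := by
  induction n generalizing z with
  | zero => rfl
  | succ n ih => rw [Function.iterate_succ_apply, ih]; rfl

lemma extMap_iterate_snd_congr (n : ℕ) {z z' : Ext A G} (h₂ : z.2 = z'.2)
    (h : ∀ i < n, z.1.1 i = z'.1.1 i) : ((extMap ψ)^[n] z).2 = ((extMap ψ)^[n] z').2 := by
  induction n generalizing z z' with
  | zero => exact h₂
  | succ n ih =>
    rw [Function.iterate_succ_apply, Function.iterate_succ_apply]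
    refine ih ?_ fun i hi => h (i + 1) (by omega)
    change z.2 * ψ (z.1.1 0) = z'.2 * ψ (z'.1.1 0)
    rw [h₂, h 0 (by omega)]

lemma extMap_iterate_splice {n : ℕ} {y : Ext A G} {x : Chain A} (h : A (y.1.1 n) (x.1 0)) :
    (extMap ψ)^[n + 1] (splice n y.1 x h, y.2) = (x, ((extMap ψ)^[n + 1] y).2) := by
  refine Prod.ext ?_ ?_
  · rw [extMap_iterate_fst]
    exact shift_iterate_splice h
  · exact extMap_iterate_snd_congr _ rfl fun i hi => splice_apply_of_le h (by omega)

lemma adm_of_extMap_iterate_eq {n : ℕ} {y : Ext A G} {x x' : Chain A} {e : G}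
    (h : (extMap ψ)^[n + 1] y = (x, e)) (h₀ : x.1 0 = x'.1 0) : A (y.1.1 n) (x'.1 0) := by
  have hx : shift^[n + 1] y.1 = x := by rw [← extMap_iterate_fst (ψ := ψ), h]
  rw [← h₀, ← hx, shift_iterate_apply, zero_add]
  exact y.1.2 n

lemma agree_add_of_extMap_iterate_eq {n k : ℕ} {y y' : Ext A G} {x x' : Chain A} {e e' : G}
    (hy : (extMap ψ)^[n] y = (x, e)) (hy' : (extMap ψ)^[n] y' = (x', e'))
    (hn : ∀ i < n, y.1.1 i = y'.1.1 i) (hk : ∀ i < k, x.1 i = x'.1 i) :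
    ∀ i < n + k, y.1.1 i = y'.1.1 i := by
  refine agree_add_of_agree_shift_iterate hn ?_
  rwa [← extMap_iterate_fst (ψ := ψ), ← extMap_iterate_fst (ψ := ψ), hy, hy']

/-- Left translation by `g` on the group coordinate; it commutes with `extMap`. -/
def translate (g : G) : Ext A G ≃ Ext A G :=
  (Equiv.refl _).prodCongr (Equiv.mulLeft g)

@[simp] lemma translate_apply (g : G) (z : Ext A G) : translate g z = (z.1, g * z.2) := rfl

lemma extMap_iterate_translate (g : G) (n : ℕ) (z : Ext A G) :
    (extMap ψ)^[n] (translate g z) = translate g ((extMap ψ)^[n] z) :=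
  Function.Commute.iterate_left (f := extMap ψ) (fun z => by simp [extMap, mul_assoc]) n z

lemma TopTransitiveExt.exists_word (htrans : TopTransitiveExt A ψ) (a b : W) (g h : G) :
    ∃ (n : ℕ) (q : Chain A), q.1 0 = a ∧ q.1 n = b ∧ ((extMap ψ)^[n + 1] (q, g)).2 = h := by
  obtain ⟨n, -, _, ⟨⟨q, g⟩, ⟨ha, rfl⟩, rfl⟩, hb, hh⟩ := htrans a b g (h * (ψ b)⁻¹)
  refine ⟨n, q, ha, ?_, ?_⟩
  · rwa [extMap_iterate_fst, shift_iterate_apply, zero_add] at hb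
  · rw [Function.iterate_succ_apply']
    change ((extMap ψ)^[n] (q, g)).2 * ψ (((extMap ψ)^[n] (q, g)).1.1 0) = h
    rw [hh, hb, inv_mul_cancel_right]

lemma TopTransitiveExt.exists_iterate_eq (htrans : TopTransitiveExt A ψ) (a : W) (g h : G)
    (x : Chain A) :
    ∃ (n : ℕ) (q : Chain A), q.1 0 = a ∧ (extMap ψ)^[n + 1] (q, g) = (x, h) := by
  obtain ⟨n, hn, _, ⟨⟨q, g⟩, ⟨ha, rfl⟩, rfl⟩, hb, hh⟩ := htrans a (x.1 0) g h
  obtain ⟨m, rfl⟩ := Nat.exists_eq_add_of_le' hn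
  have hadm : A (q.1 m) (x.1 0) :=
    adm_of_extMap_iterate_eq (ψ := ψ) (y := (q, g)) rfl hb
  refine ⟨m, splice m q x hadm, ?_, ?_⟩
  · rw [splice_apply_of_le hadm (Nat.zero_le _), ha]
  · rw [extMap_iterate_splice (y := (q, g)) hadm]
    exact Prod.ext rfl hh

/- The comparison is along the injection `y ↦ splice n y x'`, which replaces the tail `x` of a
preimage by `x'`. -/
lemma tsum_iterate_preimage_le (n : ℕ) {x x' : Chain A} {e : G} (w w' : Ext A G → ℝ≥0∞)
    (hA : ∀ y, (extMap ψ)^[n + 1] y = (x, e) → w y ≠ 0 → A (y.1.1 n) (x'.1 0))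
    (H : ∀ y y', (extMap ψ)^[n + 1] y = (x, e) → (extMap ψ)^[n + 1] y' = (x', e) →
      y.2 = y'.2 → (∀ i < n + 1, y.1.1 i = y'.1.1 i) → w y ≤ w' y') :
    ∑' y : {y : Ext A G // (extMap ψ)^[n + 1] y = (x, e)}, w y.1 ≤
      ∑' y : {y : Ext A G // (extMap ψ)^[n + 1] y = (x', e)}, w' y.1 := by
  let S : Set {y : Ext A G // (extMap ψ)^[n + 1] y = (x, e)} := {y | w y.1 ≠ 0}
  have hadm (y : S) : A (y.1.1.1.1 n) (x'.1 0) := hA y.1.1 y.1.2 y.2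
  let ι : S → {y : Ext A G // (extMap ψ)^[n + 1] y = (x', e)} := fun y =>
    ⟨(splice n y.1.1.1 x' (hadm y), y.1.1.2), by rw [extMap_iterate_splice (hadm y), y.1.2]⟩
  have hι (y : S) : ∀ i < n + 1, y.1.1.1.1 i = (ι y).1.1.1 i := fun i hi =>
    (splice_apply_of_le (hadm y) (by omega)).symm
  have hinj : Function.Injective ι := by
    intro y y' hyy
    refine Subtype.ext (Subtype.ext (Prod.ext (eq_of_shift_iterate_eq (n := n + 1) ?_ ?_) ?_))
    · exact fun i hi => by rw [hι y i hi, hι y' i hi, hyy]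
    · rw [← extMap_iterate_fst (ψ := ψ), ← extMap_iterate_fst (ψ := ψ), y.1.2, y'.1.2]
    · exact congrArg (fun u => u.1.2) hyy
  rw [← tsum_subtype_eq_of_support_subset (s := S) fun _ hy => hy]
  calc ∑' y : S, w y.1.1 ≤ ∑' y : S, w' (ι y).1 :=
        ENNReal.tsum_le_tsum fun y => H _ _ y.1.2 (ι y).2 rfl (hι y)
    _ ≤ _ := ENNReal.tsum_comp_le_tsum_of_injective hinj
        (fun y : {y : Ext A G // (extMap ψ)^[n + 1] y = (x', e)} => w' y.1)

end Splice

/-! ### Iterates of the Ruelle operator on extended nonnegative functions -/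

section Ruelle

variable {W G : Type*} {A : W → W → Prop} {ψ : W → G} {φ : Chain A → ℝ}

lemma birkhoffProd_add (m n : ℕ) (x : Chain A) :
    birkhoffProd φ (m + n) x = birkhoffProd φ n x * birkhoffProd φ m (shift^[n] x) := by
  rw [add_comm m n, birkhoffProd, Finset.prod_range_add]
  congr 1
  refine Finset.prod_congr rfl fun i _ => ?_
  rw [add_comm n i, Function.iterate_add_apply]

lemma birkhoffProd_one (x : Chain A) : birkhoffProd φ 1 x = φ x := by
  simp [birkhoffProd]

lemma birkhoffProd_pos (hφ : ∀ x, 0 < φ x) (n : ℕ) (x : Chain A) : 0 < birkhoffProd φ n x :=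
  Finset.prod_pos fun _ _ => hφ _

variable [Group G]

variable (ψ φ) in
/-- `𝓛ⁿ F (ζ) = ∑_{Tⁿ y = ζ} Φ_n (y) F (y)`, the iterated Ruelle operator of the extension. It
takes values in `ℝ≥0∞`, so that no summability has to be carried along. -/
def ruelle (n : ℕ) (F : Ext A G → ℝ≥0∞) (ζ : Ext A G) : ℝ≥0∞ :=
  ∑' y : {y : Ext A G // (extMap ψ)^[n] y = ζ}, ENNReal.ofReal (birkhoffProd φ n y.1.1) * F y.1

lemma ruelle_zero (F : Ext A G → ℝ≥0∞) (ζ : Ext A G) : ruelle ψ φ 0 F ζ = F ζ := by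
  change ∑' y : {y : Ext A G // y = ζ}, ENNReal.ofReal (birkhoffProd φ 0 y.1.1) * F y.1 = F ζ
  simp [tsum_fintype, birkhoffProd]
  rfl

lemma ruelle_mono (n : ℕ) {F F' : Ext A G → ℝ≥0∞} (h : ∀ y, F y ≤ F' y) (ζ : Ext A G) :
    ruelle ψ φ n F ζ ≤ ruelle ψ φ n F' ζ :=
  ENNReal.tsum_le_tsum fun y => by gcongr; exact h _

lemma ruelle_const_mul (n : ℕ) (c : ℝ≥0∞) (F : Ext A G → ℝ≥0∞) (ζ : Ext A G) :
    ruelle ψ φ n (fun y => c * F y) ζ = c * ruelle ψ φ n F ζ := by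
  rw [ruelle, ruelle, ← ENNReal.tsum_mul_left]
  exact tsum_congr fun y => mul_left_comm _ _ _

lemma ruelle_tsum {ι : Type*} (n : ℕ) (F : ι → Ext A G → ℝ≥0∞) (ζ : Ext A G) :
    ruelle ψ φ n (fun y => ∑' i, F i y) ζ = ∑' i, ruelle ψ φ n (F i) ζ := by
  simp only [ruelle, ← ENNReal.tsum_mul_left]
  exact ENNReal.tsum_comm

lemma ruelle_finset_sum {ι : Type*} (I : Finset ι) (n : ℕ) (F : ι → Ext A G → ℝ≥0∞)
    (ζ : Ext A G) :
    ruelle ψ φ n (fun y => ∑ i ∈ I, F i y) ζ = ∑ i ∈ I, ruelle ψ φ n (F i) ζ := by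
  simp only [ruelle, Finset.mul_sum]
  exact Summable.tsum_finsetSum fun _ _ => ENNReal.summable

lemma ruelle_fun_add (n : ℕ) (F F' : Ext A G → ℝ≥0∞) (ζ : Ext A G) :
    ruelle ψ φ n (fun y => F y + F' y) ζ = ruelle ψ φ n F ζ + ruelle ψ φ n F' ζ := by
  simp only [ruelle, mul_add]
  exact ENNReal.tsum_add

lemma ruelle_add (hφ : ∀ x, 0 < φ x) (m n : ℕ) (F : Ext A G → ℝ≥0∞) (ζ : Ext A G) :
    ruelle ψ φ (m + n) F ζ = ruelle ψ φ m (ruelle ψ φ n F) ζ := by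
  let E : (Σ u : {u : Ext A G // (extMap ψ)^[m] u = ζ}, {y : Ext A G // (extMap ψ)^[n] y = u.1}) ≃
      {y : Ext A G // (extMap ψ)^[m + n] y = ζ} :=
    { toFun := fun p => ⟨p.2.1, by rw [Function.iterate_add_apply, p.2.2, p.1.2]⟩
      invFun := fun y => ⟨⟨(extMap ψ)^[n] y.1, by
        rw [← Function.iterate_add_apply]; exact y.2⟩, ⟨y.1, rfl⟩⟩
      left_inv := by
        rintro ⟨⟨u, hu⟩, ⟨y, hy⟩⟩
        obtain rfl : (extMap ψ)^[n] y = u := hy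
        rfl
      right_inv := fun y => rfl }
  rw [ruelle, ← E.tsum_eq, ENNReal.tsum_sigma', ruelle]
  refine tsum_congr fun u => ?_
  rw [ruelle, ← ENNReal.tsum_mul_left]
  refine tsum_congr fun y => ?_
  change ENNReal.ofReal (birkhoffProd φ (m + n) y.1.1) * F y.1 = _
  rw [birkhoffProd_add, ← extMap_iterate_fst (ψ := ψ), y.2,
    ENNReal.ofReal_mul (birkhoffProd_pos hφ _ _).le]
  ring

lemma mul_le_ruelle (n : ℕ) (F : Ext A G → ℝ≥0∞) {q ζ : Ext A G} (h : (extMap ψ)^[n] q = ζ) :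
    ENNReal.ofReal (birkhoffProd φ n q.1) * F q ≤ ruelle ψ φ n F ζ :=
  ENNReal.le_tsum (f := fun y : {y : Ext A G // (extMap ψ)^[n] y = ζ} =>
    ENNReal.ofReal (birkhoffProd φ n y.1.1) * F y.1) ⟨q, h⟩

lemma mul_ruelle_le_ruelle (hφ : ∀ x, 0 < φ x) (n p : ℕ) (F : Ext A G → ℝ≥0∞) {q ζ : Ext A G}
    (h : (extMap ψ)^[p] q = ζ) :
    ENNReal.ofReal (birkhoffProd φ p q.1) * ruelle ψ φ n F q ≤ ruelle ψ φ (n + p) F ζ := by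
  rw [add_comm, ruelle_add hφ]
  exact mul_le_ruelle p _ h

lemma ruelle_translate (g : G) (n : ℕ) (F : Ext A G → ℝ≥0∞) (ζ : Ext A G) :
    ruelle ψ φ n F (translate g ζ) = ruelle ψ φ n (fun y => F (translate g y)) ζ := by
  let E : {y : Ext A G // (extMap ψ)^[n] y = ζ} ≃
      {y : Ext A G // (extMap ψ)^[n] y = translate g ζ} :=
    (translate g).subtypeEquiv fun y => by
      rw [extMap_iterate_translate, EmbeddingLike.apply_eq_iff_eq]
  rw [ruelle, ← E.tsum_eq]
  rfl

lemma ruelle_one_one_le {M : ℝ≥0}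
    (hM : ∀ x : Chain A, ∑' y : {y : Chain A // shift y = x}, ENNReal.ofReal (φ y.1) ≤ M)
    (ζ : Ext A G) : ruelle ψ φ 1 (fun _ => 1) ζ ≤ M := by
  let ι : {y : Ext A G // extMap ψ y = ζ} → {y : Chain A // shift y = ζ.1} :=
    fun y => ⟨y.1.1, congrArg Prod.fst y.2⟩
  have hι : Function.Injective ι := by
    rintro ⟨⟨x, h⟩, rfl⟩ ⟨⟨x', h'⟩, hy'⟩ hxx
    obtain rfl : x = x' := congrArg Subtype.val hxx
    exact Subtype.ext (Prod.ext rfl (mul_right_cancel (congrArg Prod.snd hy').symm))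
  calc ruelle ψ φ 1 (fun _ => 1) ζ
      = ∑' y : {y : Ext A G // extMap ψ y = ζ}, ENNReal.ofReal (φ (ι y).1) := by
        simp only [ruelle, birkhoffProd_one, mul_one]
        rfl
    _ ≤ ∑' y : {y : Chain A // shift y = ζ.1}, ENNReal.ofReal (φ y.1) :=
        ENNReal.tsum_comp_le_tsum_of_injective hι fun y => ENNReal.ofReal (φ y.1)
    _ ≤ M := hM ζ.1

lemma ruelle_one_le {M : ℝ≥0} (hφ : ∀ x, 0 < φ x)
    (hM : ∀ x : Chain A, ∑' y : {y : Chain A // shift y = x}, ENNReal.ofReal (φ y.1) ≤ M)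
    (n : ℕ) (ζ : Ext A G) : ruelle ψ φ n (fun _ => 1) ζ ≤ (M : ℝ≥0∞) ^ n := by
  induction n generalizing ζ with
  | zero => simp [ruelle_zero]
  | succ n ih =>
    rw [ruelle_add hφ, pow_succ']
    calc ruelle ψ φ n (ruelle ψ φ 1 fun _ => 1) ζ
        ≤ ruelle ψ φ n (fun _ => (M : ℝ≥0∞) * 1) ζ :=
          ruelle_mono n (fun y => by simpa using ruelle_one_one_le hM y) ζ
      _ = M * ruelle ψ φ n (fun _ => 1) ζ := ruelle_const_mul _ _ _ _
      _ ≤ M * (M : ℝ≥0∞) ^ n := by gcongr; exact ih ζ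

open Classical in
lemma returnSum_eq_ruelle (ξ : Chain A) (n : ℕ) :
    returnSum ψ φ ξ n = ruelle ψ φ n ((fibre A (1 : G)).indicator 1) (ξ, 1) := by
  let S : Set {y : Ext A G // (extMap ψ)^[n] y = (ξ, 1)} := {y | y.1 ∈ fibre A (1 : G)}
  have hsupp : Function.support (fun y : {y : Ext A G // (extMap ψ)^[n] y = (ξ, 1)} =>
      ENNReal.ofReal (birkhoffProd φ n y.1.1) * (fibre A (1 : G)).indicator 1 y.1) ⊆ S := by
    intro y hy
    by_contra h
    have h' : y.1 ∉ fibre A (1 : G) := h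
    exact hy (mul_eq_zero_of_right _ (Set.indicator_of_notMem h' _))
  let E : {x : Chain A // (extMap ψ)^[n] (x, 1) = (ξ, 1)} ≃ S :=
    { toFun := fun x => ⟨⟨(x.1, 1), x.2⟩, rfl⟩
      invFun := fun y => ⟨y.1.1.1, by
        have h : (y.1.1.1, (1 : G)) = y.1.1 := Prod.ext rfl y.2.symm
        rw [h]; exact y.1.2⟩
      left_inv := fun x => rfl
      right_inv := fun y => Subtype.ext (Subtype.ext (Prod.ext rfl y.2.symm)) }
  rw [ruelle, ← tsum_subtype_eq_of_support_subset hsupp, ← E.tsum_eq, returnSum]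
  refine tsum_congr fun x => ?_
  have hx : (x.1, (1 : G)) ∈ fibre A (1 : G) := rfl
  change _ = ENNReal.ofReal (birkhoffProd φ n x.1) * (fibre A (1 : G)).indicator 1 (x.1, (1 : G))
  simp [hx]

end Ruelle

/-! ### Bounded distortion -/

section Distortion

variable {W : Type*} {A : W → W → Prop} {φ : Chain A → ℝ} {r C : ℝ}

/-- Bounded distortion: `Φ_n (y) ≤ exp (C rᵏ) Φ_n (y')` if `y` and `y'` share `n + k` letters. All
estimates of the potential are derived from this property, in which `n` and `k` may vanish. -/
structure HasDistortion (φ : Chain A → ℝ) (r C : ℝ) : Prop where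
  nonneg : 0 ≤ C
  le : ∀ (n k : ℕ) (y y' : Chain A), (∀ i < n + k, y.1 i = y'.1 i) →
    birkhoffProd φ n y ≤ Real.exp (C * r ^ k) * birkhoffProd φ n y'

lemma le_exp_mul_of_abs_log_sub_log_le {a b t : ℝ} (ha : 0 < a) (hb : 0 < b)
    (h : |Real.log a - Real.log b| ≤ t) : a ≤ Real.exp t * b := by
  rw [← Real.log_le_log_iff ha (by positivity), Real.log_mul (Real.exp_pos t).ne' hb.ne',
    Real.log_exp]
  linarith [(abs_le.1 h).2]

lemma sum_range_pow_sub_add_le (hr₀ : 0 ≤ r) (hr₁ : r < 1) (n k : ℕ) :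
    ∑ j ∈ Finset.range n, r ^ (n - j + k) ≤ (1 - r)⁻¹ * r ^ k := by
  calc ∑ j ∈ Finset.range n, r ^ (n - j + k)
      = (∑ j ∈ Finset.range n, r ^ (n - j)) * r ^ k := by simp only [pow_add, Finset.sum_mul]
    _ ≤ (∑ j ∈ Finset.range n, r ^ (n - 1 - j)) * r ^ k := by
        refine mul_le_mul_of_nonneg_right (Finset.sum_le_sum fun j _ => ?_) (by positivity)
        exact pow_le_pow_of_le_one hr₀ hr₁.le (by omega)
    _ = (∑ j ∈ Finset.range n, r ^ j) * r ^ k := by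
        rw [Finset.sum_range_reflect (fun j => r ^ j)]
    _ ≤ (1 - r)⁻¹ * r ^ k := by
        gcongr
        exact sum_le_hasSum _ (fun _ _ => by positivity) (hasSum_geometric_of_lt_one hr₀ hr₁)

lemma LogLocallyHolder.exists_hasDistortion (hφ : ∀ x, 0 < φ x) (hr₀ : 0 ≤ r) (hr₁ : r < 1)
    (hHol : LogLocallyHolder r φ) : ∃ C, HasDistortion φ r C := by
  obtain ⟨C₀, hC₀⟩ := hHol
  have : 0 < 1 - r := by linarith
  refine ⟨|C₀| * (1 - r)⁻¹, by positivity, fun n k y y' hy => ?_⟩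
  have hfactor (j : ℕ) (hj : j < n) :
      φ (shift^[j] y) ≤ Real.exp (|C₀| * r ^ (n - j + k)) * φ (shift^[j] y') := by
    refine le_exp_mul_of_abs_log_sub_log_le (hφ _) (hφ _)
      ((hC₀ (n - j + k) (by omega) _ _ fun i hi => ?_).trans ?_)
    · rw [shift_iterate_apply, shift_iterate_apply, hy _ (by omega)]
    · gcongr
      exact le_abs_self _
  calc birkhoffProd φ n y
      ≤ ∏ j ∈ Finset.range n, (Real.exp (|C₀| * r ^ (n - j + k)) * φ (shift^[j] y')) :=
        Finset.prod_le_prod (fun _ _ => (hφ _).le)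
          fun j hj => hfactor j (Finset.mem_range.1 hj)
    _ = Real.exp (|C₀| * ∑ j ∈ Finset.range n, r ^ (n - j + k)) * birkhoffProd φ n y' := by
        rw [Finset.prod_mul_distrib, ← Real.exp_sum, Finset.mul_sum, birkhoffProd]
    _ ≤ Real.exp (|C₀| * (1 - r)⁻¹ * r ^ k) * birkhoffProd φ n y' := by
        have := (birkhoffProd_pos hφ n y').le
        rw [mul_assoc]
        gcongr
        exact sum_range_pow_sub_add_le hr₀ hr₁ n k

lemma HasDistortion.ofReal_le (hD : HasDistortion φ r C) {n k : ℕ} {y y' : Chain A}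
    (h : ∀ i < n + k, y.1 i = y'.1 i) :
    ENNReal.ofReal (birkhoffProd φ n y) ≤
      ENNReal.ofReal (Real.exp (C * r ^ k)) * ENNReal.ofReal (birkhoffProd φ n y') := by
  rw [← ENNReal.ofReal_mul (Real.exp_pos _).le]
  exact ENNReal.ofReal_le_ofReal (hD.le n k y y' h)

lemma dShift_self (x : Chain A) : dShift r x x = 0 := by simp [dShift]

lemma dShift_comm (x y : Chain A) : dShift r x y = dShift r y x := by
  by_cases h : x = y
  · rw [h]
  · simp only [dShift, h, Ne.symm h, if_false, PiNat.firstDiff_comm x.1 y.1]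

lemma exists_agree_of_dShift_lt_one {x y : Chain A} (hne : x ≠ y) (h : dShift r x y < 1) :
    ∃ k, 1 ≤ k ∧ (∀ i < k, x.1 i = y.1 i) ∧ dShift r x y = r ^ k := by
  have hd : dShift r x y = r ^ PiNat.firstDiff x.1 y.1 := by simp [dShift, hne]
  refine ⟨PiNat.firstDiff x.1 y.1, ?_, fun i hi => PiNat.apply_eq_of_lt_firstDiff hi, hd⟩
  by_contra! h₀
  rw [hd, Nat.lt_one_iff.1 h₀, pow_zero] at h
  exact lt_irrefl _ h

lemma dShift_le_of_agree (hr₀ : 0 ≤ r) (hr₁ : r ≤ 1) {x y : Chain A} {k : ℕ}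
    (h : ∀ i < k, x.1 i = y.1 i) : dShift r x y ≤ r ^ k := by
  by_cases hxy : x = y
  · subst hxy
    rw [dShift_self]
    positivity
  · have hk : k ≤ PiNat.firstDiff x.1 y.1 := by
      by_contra! hlt
      exact PiNat.apply_firstDiff_ne (fun he => hxy (Subtype.ext he)) (h _ hlt)
    simp only [dShift, hxy, if_false]
    exact pow_le_pow_of_le_one hr₀ hr₁ hk

lemma dShift_pos (hr₀ : 0 < r) {x y : Chain A} (h : x ≠ y) : 0 < dShift r x y := by
  simp only [dShift, h, if_false]
  positivity

lemma abs_sub_le_mul_of_le {a b κ : ℝ} (hκ : 0 ≤ κ) (h₁ : a ≤ (1 + κ) * b)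
    (h₂ : b ≤ (1 + κ) * a) : |a - b| ≤ κ * b := by
  rw [abs_le]
  refine ⟨?_, by linarith⟩
  rcases le_total a b with hab | hab
  · linarith [mul_le_mul_of_nonneg_left hab hκ]
  · linarith

lemma exp_le_one_add_mul_exp (u : ℝ) : Real.exp u ≤ 1 + u * Real.exp u := by
  have h : (1 - u) * Real.exp u ≤ Real.exp (-u) * Real.exp u := by
    gcongr
    linarith [Real.add_one_le_exp (-u)]
  rw [← Real.exp_add, neg_add_cancel, Real.exp_zero] at h
  linarith

lemma exp_mul_le_one_add_mul {t C : ℝ} (h₀ : 0 ≤ t) (h₁ : t ≤ 1) (hC : 0 ≤ C) :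
    Real.exp (C * t) ≤ 1 + C * Real.exp C * t :=
  calc Real.exp (C * t) ≤ 1 + C * t * Real.exp (C * t) := exp_le_one_add_mul_exp _
    _ ≤ 1 + C * t * Real.exp C := by gcongr; exact mul_le_of_le_one_right hC h₁
    _ = 1 + C * Real.exp C * t := by ring

lemma HasDistortion.abs_birkhoffProd_sub_le (hφ : ∀ x, 0 < φ x) (hr₀ : 0 ≤ r) (hr₁ : r ≤ 1)
    (hD : HasDistortion φ r C) {n k : ℕ} {y y' : Chain A} (h : ∀ i < n + k, y.1 i = y'.1 i) :
    |birkhoffProd φ n y - birkhoffProd φ n y'| ≤ C * Real.exp C * r ^ k * birkhoffProd φ n y' := by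
  have hC := hD.nonneg
  have hpos := fun z => (birkhoffProd_pos hφ n z).le
  have hexp := exp_mul_le_one_add_mul (pow_nonneg hr₀ k) (pow_le_one₀ hr₀ hr₁) hC
  exact abs_sub_le_mul_of_le (by positivity)
    ((hD.le n k y y' h).trans (mul_le_mul_of_nonneg_right hexp (hpos y')))
    ((hD.le n k y' y fun i hi => (h i hi).symm).trans (mul_le_mul_of_nonneg_right hexp (hpos y)))

lemma HasDistortion.distortionConst_lt_top (hφ : ∀ x, 0 < φ x) (hr₀ : 0 ≤ r) (hr₁ : r ≤ 1)
    (hD : HasDistortion φ r C) : distortionConst r φ < ⊤ := by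
  refine lt_of_le_of_lt ?_ (ENNReal.ofReal_lt_top (r := C * Real.exp C))
  simp only [distortionConst, iSup_le_iff]
  intro n y₁ y₂ _ hag hd
  by_cases hne : shift^[n] y₁ = shift^[n] y₂
  · obtain rfl := eq_of_shift_iterate_eq hag hne
    simp [relDiff]
  obtain ⟨k, -, hagk, hdk⟩ := exists_agree_of_dShift_lt_one hne hd
  have hC : 0 ≤ C * Real.exp C := mul_nonneg hD.nonneg (Real.exp_pos C).le
  have hpos := birkhoffProd_pos hφ n y₂
  rw [hdk, relDiff, abs_of_pos hpos]
  refine ENNReal.div_le_of_le_mul (ENNReal.div_le_of_le_mul ?_)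
  rw [← ENNReal.ofReal_mul hC, ← ENNReal.ofReal_mul (by positivity)]
  exact ENNReal.ofReal_le_ofReal
    (hD.abs_birkhoffProd_sub_le hφ hr₀ hr₁ (agree_add_of_agree_shift_iterate hag hagk))

lemma relDiff_div_dShift_le_distortionConst {n : ℕ} (hn : 1 ≤ n) {y₁ y₂ : Chain A}
    (hag : ∀ i < n, y₁.1 i = y₂.1 i) (hd : dShift r (shift^[n] y₁) (shift^[n] y₂) < 1) :
    relDiff (birkhoffProd φ n y₁) (birkhoffProd φ n y₂) /
      ENNReal.ofReal (dShift r (shift^[n] y₁) (shift^[n] y₂)) ≤ distortionConst r φ :=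
  le_iSup_of_le n <| le_iSup_of_le y₁ <| le_iSup_of_le y₂ <| le_iSup_of_le hn <|
    le_iSup_of_le hag <| le_iSup_of_le hd le_rfl

lemma ofReal_birkhoffProd_le_distortionConst (hφ : ∀ x, 0 < φ x) {n : ℕ}
    (hn : 1 ≤ n) {y₁ y₂ : Chain A} (hag : ∀ i < n, y₁.1 i = y₂.1 i)
    (hd : dShift r (shift^[n] y₁) (shift^[n] y₂) < 1)
    (hd₀ : 0 < dShift r (shift^[n] y₁) (shift^[n] y₂)) :
    ENNReal.ofReal (birkhoffProd φ n y₁) ≤ (1 + distortionConst r φ *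
      ENNReal.ofReal (dShift r (shift^[n] y₁) (shift^[n] y₂))) *
        ENNReal.ofReal (birkhoffProd φ n y₂) := by
  have hpos := birkhoffProd_pos hφ n y₂
  have hdiff := relDiff_div_dShift_le_distortionConst (φ := φ) hn hag hd
  rw [ENNReal.div_le_iff (by simpa using hd₀) ENNReal.ofReal_ne_top, relDiff,
    abs_of_pos hpos, ENNReal.div_le_iff (by simpa using hpos) ENNReal.ofReal_ne_top] at hdiff
  calc ENNReal.ofReal (birkhoffProd φ n y₁)
      ≤ ENNReal.ofReal (birkhoffProd φ n y₂ + |birkhoffProd φ n y₁ - birkhoffProd φ n y₂|) :=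
        ENNReal.ofReal_le_ofReal (by
          linarith [le_abs_self (birkhoffProd φ n y₁ - birkhoffProd φ n y₂)])
    _ = ENNReal.ofReal (birkhoffProd φ n y₂) +
          ENNReal.ofReal |birkhoffProd φ n y₁ - birkhoffProd φ n y₂| :=
        ENNReal.ofReal_add hpos.le (abs_nonneg _)
    _ ≤ _ := by rw [add_mul, one_mul]; gcongr

end Distortion

/-! ### Comparison of sums over preimages of different points -/

section Comparison

variable {W G : Type*} [Group G] {A : W → W → Prop} {ψ : W → G} {φ : Chain A → ℝ} {r C : ℝ}

lemma HasDistortion.ruelle_le (hD : HasDistortion φ r C) (n : ℕ) {k : ℕ} (hk : 1 ≤ k)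
    {x x' : Chain A} (hag : ∀ i < k, x.1 i = x'.1 i) (e : G) {F F' : Ext A G → ℝ≥0∞}
    (hF : ∀ y y' : Ext A G, y.2 = y'.2 → (∀ i < n + 1, y.1.1 i = y'.1.1 i) → F y ≤ F' y') :
    ruelle ψ φ (n + 1) F (x, e) ≤
      ENNReal.ofReal (Real.exp (C * r ^ k)) * ruelle ψ φ (n + 1) F' (x', e) := by
  rw [← ruelle_const_mul]
  refine tsum_iterate_preimage_le n
    (fun y => ENNReal.ofReal (birkhoffProd φ (n + 1) y.1) * F y)
    (fun y => ENNReal.ofReal (birkhoffProd φ (n + 1) y.1) *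
      (ENNReal.ofReal (Real.exp (C * r ^ k)) * F' y))
    (fun y hy _ => adm_of_extMap_iterate_eq hy (hag 0 hk)) fun y y' hy hy' h₂ hn => ?_
  calc _ ≤ (ENNReal.ofReal (Real.exp (C * r ^ k)) *
        ENNReal.ofReal (birkhoffProd φ (n + 1) y'.1)) * F' y' := by
        gcongr
        · exact hD.ofReal_le (agree_add_of_extMap_iterate_eq hy hy' hn hag)
        · exact hF y y' h₂ hn
    _ = _ := by ring

open Classical in
lemma HasDistortion.ruelle_ite_adm_le (hD : HasDistortion φ r C) (n : ℕ) (x x' : Chain A) (e : G)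
    {F : Ext A G → ℝ≥0∞} (hF : ∀ y y' : Ext A G, y.2 = y'.2 → F y = F y') :
    ruelle ψ φ (n + 1) (fun y => if A (y.1.1 n) (x'.1 0) then F y else 0) (x, e) ≤
      ENNReal.ofReal (Real.exp C) * ruelle ψ φ (n + 1) F (x', e) := by
  rw [← ruelle_const_mul]
  refine tsum_iterate_preimage_le n
    (fun y => ENNReal.ofReal (birkhoffProd φ (n + 1) y.1) *
      (if A (y.1.1 n) (x'.1 0) then F y else 0))
    (fun y => ENNReal.ofReal (birkhoffProd φ (n + 1) y.1) *
      (ENNReal.ofReal (Real.exp C) * F y)) (fun y _ hy₀ => ?_) fun y y' _ _ h₂ hn => ?_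
  · by_contra h
    simp [h] at hy₀
  · have hdist := hD.ofReal_le (n := n + 1) (k := 0) hn
    rw [pow_zero, mul_one] at hdist
    calc _ ≤ (ENNReal.ofReal (Real.exp C) *
          ENNReal.ofReal (birkhoffProd φ (n + 1) y'.1)) * F y' := by
          gcongr
          split_ifs
          · exact (hF y y' h₂).le
          · exact zero_le
      _ = _ := by ring

open Classical in
lemma HasDistortion.ruelle_le_sum (hD : HasDistortion φ r C) {I : Finset W}
    (hI : ∀ v, ∃ β ∈ I, A v β) (q : W → Chain A) (hq : ∀ β, (q β).1 0 = β) (n : ℕ)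
    (x : Chain A) (e : G) {F : Ext A G → ℝ≥0∞} (hF : ∀ y y' : Ext A G, y.2 = y'.2 → F y = F y') :
    ruelle ψ φ (n + 1) F (x, e) ≤
      ∑ β ∈ I, ENNReal.ofReal (Real.exp C) * ruelle ψ φ (n + 1) F (q β, e) := by
  calc ruelle ψ φ (n + 1) F (x, e)
      ≤ ruelle ψ φ (n + 1) (fun y => ∑ β ∈ I, if A (y.1.1 n) ((q β).1 0) then F y else 0)
          (x, e) := by
        refine ruelle_mono _ (fun y => ?_) _
        obtain ⟨β, hβ, hA⟩ := hI (y.1.1 n)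
        refine le_trans ?_ (Finset.single_le_sum
          (f := fun β => if A (y.1.1 n) ((q β).1 0) then F y else 0) (fun _ _ => zero_le) hβ)
        simp [hq, hA]
    _ = ∑ β ∈ I, ruelle ψ φ (n + 1) (fun y => if A (y.1.1 n) ((q β).1 0) then F y else 0)
          (x, e) := ruelle_finset_sum _ _ _ _
    _ ≤ _ := Finset.sum_le_sum fun β _ => hD.ruelle_ite_adm_le n x (q β) e hF

lemma HasDistortion.exists_ruelle_le_sum_base (hφ : ∀ x, 0 < φ x) (hD : HasDistortion φ r C)
    (hbip : BigImagesPreimages A) (htrans : TopTransitiveExt A ψ) (ξ : Chain A) :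
    ∃ (I : Finset W) (p : W → ℕ) (K : W → ℝ≥0∞), (∀ β, K β ≠ ⊤) ∧
      ∀ (n : ℕ) (x : Chain A) (e : G) (F : Ext A G → ℝ≥0∞),
        (∀ y y' : Ext A G, y.2 = y'.2 → F y = F y') →
        ruelle ψ φ (n + 1) F (x, e) ≤
          ∑ β ∈ I, K β * ruelle ψ φ (n + 1 + p β) F (ξ, e) := by
  obtain ⟨I, hI⟩ := hbip
  choose p q hq₀ hq using fun β : W => htrans.exists_iterate_eq β 1 1 ξ
  have hpos (β : W) : ENNReal.ofReal (birkhoffProd φ (p β + 1) (q β)) ≠ 0 := by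
    simpa using birkhoffProd_pos hφ _ _
  refine ⟨I, fun β => p β + 1, fun β => ENNReal.ofReal (Real.exp C) *
    (ENNReal.ofReal (birkhoffProd φ (p β + 1) (q β)))⁻¹, fun β => ?_, fun n x e F hF => ?_⟩
  · exact ENNReal.mul_ne_top ENNReal.ofReal_ne_top (ENNReal.inv_ne_top.2 (hpos β))
  refine (hD.ruelle_le_sum (fun v => ?_) q hq₀ n x e hF).trans (Finset.sum_le_sum fun β _ => ?_)
  · obtain ⟨β₁, h₁, _, _, h, _⟩ := hI v
    exact ⟨β₁, h₁, h⟩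
  · have hqe : (extMap ψ)^[p β + 1] (q β, e) = (ξ, e) := by
      simpa [hq] using extMap_iterate_translate (ψ := ψ) e (p β + 1) (q β, 1)
    rw [mul_assoc]
    gcongr
    rw [← ENNReal.mul_le_iff_le_inv (hpos β) ENNReal.ofReal_ne_top]
    exact mul_ruelle_le_ruelle hφ (n + 1) (p β + 1) F hqe

open Classical in
lemma HasDistortion.ruelle_one_indicator_le (hD : HasDistortion φ r C) {x x' : Chain A}
    (h₀ : x.1 0 = x'.1 0) (h : G) (S : Set W) (e g : G) :
    ruelle ψ φ 1 ({u : Ext A G | u.1.1 0 ∈ S ∧ u.2 * e = g}.indicator 1) (x, h) ≤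
      ENNReal.ofReal (Real.exp (C * r)) *
        ruelle ψ φ 1 ({u : Ext A G | u.1.1 0 ∈ S ∧ u.2 = 1}.indicator 1)
          (translate (e * g⁻¹) (x', h)) := by
  have htr (u : Ext A G) : ({u : Ext A G | u.1.1 0 ∈ S ∧ u.2 = 1}.indicator 1
      (translate (e * g⁻¹) u) : ℝ≥0∞) =
      {u : Ext A G | u.1.1 0 ∈ S ∧ u.2 * e = g}.indicator 1 u := by
    have hconj : e * g⁻¹ * u.2 = 1 ↔ u.2 * e = g := by
      rw [mul_eq_one_iff_inv_eq, eq_comm, ← eq_mul_inv_iff_mul_eq, mul_inv_rev, inv_inv]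
    simp [Set.indicator_apply, hconj]
  rw [ruelle_translate, ← pow_one r]
  simp only [htr]
  refine hD.ruelle_le 0 le_rfl (fun i hi => ?_) h fun u u' h₂ hu => ?_
  · rwa [Nat.lt_one_iff.1 hi]
  · simp [Set.indicator_apply, h₂, hu 0 (by omega)]

/- Left translations commute with `T`, so a loop from the fibre of `ζ` to the fibre `g` can be
moved so as to end at `y`, whatever the fibre of `y`. -/
lemma HasDistortion.exists_last_le_first (hφ : ∀ x, 0 < φ x) (hD : HasDistortion φ r C)
    (hbip : BigImagesPreimages A) (htrans : TopTransitiveExt A ψ) (ζ : Ext A G) (g : G) :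
    ∃ (I : Finset W) (p : W → ℕ) (K : W → ℝ≥0∞), (∀ β, K β ≠ ⊤) ∧
      ∀ (S : Set W) (y : Ext A G),
        ruelle ψ φ 1 ({u : Ext A G | u.1.1 0 ∈ S ∧ u.2 * y.2 = g}.indicator 1) ζ ≤
          ∑ β ∈ I, K β *
            ruelle ψ φ (p β) ({u : Ext A G | u.1.1 0 ∈ S ∧ u.2 = 1}.indicator 1) y := by
  obtain ⟨I, hI⟩ := hbip
  obtain ⟨x, h⟩ := ζ
  choose m q hq₀ hqβ hqg using fun β : W => htrans.exists_word (x.1 0) β h g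
  have hpos (β : W) : ENNReal.ofReal (birkhoffProd φ (m β + 1) (q β)) ≠ 0 := by
    simpa using birkhoffProd_pos hφ _ _
  refine ⟨I, fun β => 1 + (m β + 1), fun β => ENNReal.ofReal (Real.exp (C * r)) *
    ((ENNReal.ofReal (birkhoffProd φ (m β + 1) (q β)))⁻¹ * ENNReal.ofReal (Real.exp (C * r ^ 0))),
    fun β => ?_, fun S y => ?_⟩
  · exact ENNReal.mul_ne_top ENNReal.ofReal_ne_top
      (ENNReal.mul_ne_top (ENNReal.inv_ne_top.2 (hpos β)) ENNReal.ofReal_ne_top)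
  obtain ⟨_, _, β, hβ, _, hAβ⟩ := hI (y.1.1 0)
  have hadm : A ((q β).1 (m β)) (y.1.1 0) := by rwa [hqβ]
  let v := splice (m β) (q β) y.1 hadm
  have hqv : ∀ i < m β + 1, (q β).1 i = v.1 i := fun i hi =>
    (splice_apply_of_le hadm (by omega)).symm
  have hvT : (extMap ψ)^[m β + 1] (translate (y.2 * g⁻¹) (v, h)) = y := by
    rw [extMap_iterate_translate, extMap_iterate_splice (y := (q β, h)) hadm, hqg]
    simp
  refine le_trans ?_ (Finset.single_le_sum (fun _ _ => zero_le) hβ)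
  refine (hD.ruelle_one_indicator_le ((hq₀ β).symm.trans (hqv 0 (by omega))) h S y.2 g).trans ?_
  simp only [mul_assoc]
  gcongr
  rw [← ENNReal.mul_le_iff_le_inv (hpos β) ENNReal.ofReal_ne_top]
  refine (mul_le_mul_left (hD.ofReal_le (k := 0) hqv) _).trans ?_
  rw [mul_assoc]
  gcongr
  exact mul_ruelle_le_ruelle hφ 1 (m β + 1) _ hvT

end Comparison

/-! ### Positivity of the spectral radius -/

section SpecRad

variable {W G : Type*} [Group G] {A : W → W → Prop} {ψ : W → G} {φ : Chain A → ℝ} {r C : ℝ}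

lemma pow_le_ruelle_indicator (hφ : ∀ x, 0 < φ x) {p : ℕ} {c : ℝ≥0∞} {B : Set (Ext A G)}
    (h : ∀ z ∈ B, c ≤ ruelle ψ φ p (B.indicator 1) z) (k : ℕ) :
    ∀ z ∈ B, c ^ k ≤ ruelle ψ φ (k * p) (B.indicator 1) z := by
  classical
  induction k with
  | zero => intro z hz; simp [ruelle_zero, hz]
  | succ k ih =>
    intro z hz
    rw [pow_succ, add_mul, one_mul, add_comm (k * p), ruelle_add hφ]
    calc c ^ k * c ≤ c ^ k * ruelle ψ φ p (B.indicator 1) z := by gcongr; exact h z hz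
      _ = ruelle ψ φ p (fun y => c ^ k * B.indicator 1 y) z := (ruelle_const_mul _ _ _ _).symm
      _ ≤ _ := by
        refine ruelle_mono _ (fun y => ?_) _
        by_cases hy : y ∈ B
        · simpa [hy] using ih y hy
        · simp [hy]

lemma returnSum_le {M : ℝ≥0} (hφ : ∀ x, 0 < φ x)
    (hM : ∀ x : Chain A, ∑' y : {y : Chain A // shift y = x}, ENNReal.ofReal (φ y.1) ≤ M)
    (ξ : Chain A) (n : ℕ) : returnSum ψ φ ξ n ≤ (M : ℝ≥0∞) ^ n := by
  rw [returnSum_eq_ruelle]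
  exact (ruelle_mono n (fun y => Set.indicator_le_self' (fun _ _ => zero_le) y) _).trans
    (ruelle_one_le hφ hM n _)

lemma limsup_rpow_inv_le {u : ℕ → ℝ≥0∞} {M : ℝ≥0∞} (h : ∀ n, u n ≤ M ^ n) :
    limsup (fun n : ℕ => u n ^ (1 / (n : ℝ))) atTop ≤ M := by
  refine limsup_le_of_le (h := ?_)
  filter_upwards [eventually_ne_atTop 0] with n hn
  calc u n ^ (1 / (n : ℝ)) ≤ (M ^ n) ^ (1 / (n : ℝ)) := ENNReal.rpow_le_rpow (h n) (by positivity)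
    _ = M := by rw [one_div, ENNReal.pow_rpow_inv_natCast hn]

lemma rpow_inv_le_limsup {u : ℕ → ℝ≥0∞} {c : ℝ≥0∞} {p : ℕ} (hp : p ≠ 0)
    (h : ∀ k, c ^ k ≤ u (k * p)) :
    c ^ (1 / (p : ℝ)) ≤ limsup (fun n : ℕ => u n ^ (1 / (n : ℝ))) atTop := by
  refine le_limsup_of_frequently_le (frequently_atTop.2 fun n => ⟨(n + 1) * p, ?_, ?_⟩)
  · exact (Nat.le_succ n).trans (Nat.le_mul_of_pos_right _ (Nat.pos_of_ne_zero hp))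
  · refine le_trans (le_of_eq ?_) (ENNReal.rpow_le_rpow (h (n + 1)) (by positivity))
    rw [← ENNReal.rpow_natCast, ← ENNReal.rpow_mul]
    congr 1
    push_cast
    field_simp

lemma HasDistortion.exists_le_ruelle_indicator (hφ : ∀ x, 0 < φ x) (hD : HasDistortion φ r C)
    (htrans : TopTransitiveExt A ψ) (ξ : Chain A) :
    ∃ (p : ℕ) (c : ℝ≥0∞), c ≠ 0 ∧ c ≠ ⊤ ∧
      ∀ z ∈ {u : Ext A G | u.1.1 0 = ξ.1 0 ∧ u.2 = 1},
        c ≤ ruelle ψ φ (p + 1) ({u : Ext A G | u.1.1 0 = ξ.1 0 ∧ u.2 = 1}.indicator 1) z := by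
  classical
  obtain ⟨p, q, hq₀, hq⟩ := htrans.exists_iterate_eq (ξ.1 0) 1 1 ξ
  let B : Set (Ext A G) := {u | u.1.1 0 = ξ.1 0 ∧ u.2 = 1}
  have hexp : ENNReal.ofReal (Real.exp (C * r ^ 1)) ≠ 0 := by simpa using Real.exp_pos _
  have hΦ : ENNReal.ofReal (birkhoffProd φ (p + 1) q) ≠ 0 := by simpa using birkhoffProd_pos hφ _ _
  refine ⟨p, ENNReal.ofReal (birkhoffProd φ (p + 1) q) / ENNReal.ofReal (Real.exp (C * r ^ 1)),
    ENNReal.div_ne_zero.2 ⟨hΦ, ENNReal.ofReal_ne_top⟩,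
    ENNReal.div_ne_top ENNReal.ofReal_ne_top hexp, ?_⟩
  rintro ⟨x, e⟩ ⟨hx, rfl : e = 1⟩
  have hqB : (q, (1 : G)) ∈ B := ⟨hq₀, rfl⟩
  have hle := mul_le_ruelle (φ := φ) (p + 1) (B.indicator 1) hq
  rw [Set.indicator_of_mem hqB, Pi.one_apply, mul_one] at hle
  refine ENNReal.div_le_of_le_mul' (hle.trans
    (hD.ruelle_le p le_rfl (fun i hi => ?_) 1 fun y y' h₂ h₀ => ?_))
  · rw [Nat.lt_one_iff.1 hi, hx]
  · simp [Set.indicator_apply, B, h₂, h₀ 0 (by omega)]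

lemma HasDistortion.specRad_pos {M : ℝ≥0} (hφ : ∀ x, 0 < φ x) (hD : HasDistortion φ r C)
    (hM : ∀ x : Chain A, ∑' y : {y : Chain A // shift y = x}, ENNReal.ofReal (φ y.1) ≤ M)
    (htrans : TopTransitiveExt A ψ) (ξ : Chain A) : 0 < specRad ψ φ ξ := by
  obtain ⟨p, c, hc₀, hc, hstep⟩ := hD.exists_le_ruelle_indicator hφ htrans ξ
  have hret (k : ℕ) : c ^ k ≤ returnSum ψ φ ξ (k * (p + 1)) := by
    rw [returnSum_eq_ruelle]
    exact (pow_le_ruelle_indicator hφ hstep k (ξ, 1) ⟨rfl, rfl⟩).trans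
      (ruelle_mono _ (Set.indicator_le_indicator_of_subset (fun y hy => hy.2) fun _ => zero_le) _)
  exact ENNReal.toReal_pos
    ((ENNReal.rpow_pos (pos_iff_ne_zero.2 hc₀) hc).trans_le
      (rpow_inv_le_limsup p.succ_ne_zero hret)).ne'
    (ne_top_of_le_ne_top ENNReal.coe_ne_top (limsup_rpow_inv_le (returnSum_le hφ hM ξ)))

end SpecRad

/-! ### Nonnegative harmonic functions -/

section Harmonic

variable {W G : Type*} {A : W → W → Prop} {φ : Chain A → ℝ} {r : ℝ}

lemma dExt_of_snd_eq {z₁ z₂ : Ext A G} (h : z₁.2 = z₂.2) :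
    dExt r z₁ z₂ = dShift r z₁.1 z₂.1 := by
  simp [dExt, h]

lemma snd_eq_of_dExt_lt_one {z₁ z₂ : Ext A G} (h : dExt r z₁ z₂ < 1) : z₁.2 = z₂.2 := by
  by_contra hne
  simp [dExt, hne] at h

lemma logLip_le_of_le_mul (hr₀ : 0 < r) {f : Ext A G → ℝ} (hf : ∀ z, 0 ≤ f z) {C : ℝ}
    (hC : 0 ≤ C)
    (h : ∀ (x x' : Chain A) (e : G), x ≠ x' → dShift r x x' < 1 →
      f (x, e) ≤ (1 + C * dShift r x x') * f (x', e)) :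
    logLip r f ≤ ENNReal.ofReal C := by
  simp only [logLip, iSup_le_iff]
  rintro ⟨x, e⟩ ⟨x', e'⟩ hd
  obtain rfl : e = e' := snd_eq_of_dExt_lt_one hd
  rw [dExt_of_snd_eq (z₁ := (x, e)) (z₂ := (x', e)) rfl] at hd ⊢
  by_cases hne : x = x'
  · subst hne
    simp [relDiff]
  have hd₀ := dShift_pos hr₀ hne
  have habs : |f (x, e) - f (x', e)| ≤ C * dShift r x x' * f (x', e) :=
    abs_sub_le_mul_of_le (by positivity) (h x x' e hne hd)
      (by rw [dShift_comm]; exact h x' x e (Ne.symm hne) (by rwa [dShift_comm]))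
  rw [relDiff, abs_of_nonneg (hf _)]
  refine ENNReal.div_le_of_le_mul (ENNReal.div_le_of_le_mul ?_)
  rw [← ENNReal.ofReal_mul hC, ← ENNReal.ofReal_mul (by positivity)]
  exact ENNReal.ofReal_le_ofReal habs

lemma ofReal_abs_sub_le_of_locLip_le (hr₀ : 0 < r) {f : Ext A G → ℝ} {y y' : Ext A G} {H : ℝ≥0∞}
    (h : locLip r f y ≤ H) (h₂ : y.2 = y'.2) (hd : dShift r y.1 y'.1 < 1) :
    ENNReal.ofReal |f y - f y'| ≤ H * ENNReal.ofReal (dShift r y.1 y'.1) := by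
  by_cases hne : y.1 = y'.1
  · obtain rfl : y = y' := Prod.ext hne h₂
    simp
  have hdE := dExt_of_snd_eq (r := r) h₂
  have hquot : ENNReal.ofReal |f y - f y'| / ENNReal.ofReal (dExt r y y') ≤ H :=
    (le_iSup₂_of_le y' (by rwa [hdE]) le_rfl).trans h
  rwa [hdE, ENNReal.div_le_iff (by simpa using dShift_pos hr₀ hne) ENNReal.ofReal_ne_top] at hquot

lemma ofReal_sub_le_of_locLip_le (hr₀ : 0 < r) (hr₁ : r < 1) {f : Ext A G → ℝ}
    (hf : ∀ z, 0 ≤ f z) {y y' : Ext A G} {H : ℝ≥0∞} (h : locLip r f y ≤ H) (h₂ : y.2 = y'.2)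
    {k : ℕ} (hk : 1 ≤ k) (hag : ∀ i < k, y.1.1 i = y'.1.1 i) :
    ENNReal.ofReal (f y) - ENNReal.ofReal (r ^ k) * H ≤ ENNReal.ofReal (f y') := by
  have hd := dShift_le_of_agree hr₀.le hr₁.le hag
  have hd₁ : dShift r y.1 y'.1 < 1 := hd.trans_lt (pow_lt_one₀ hr₀.le hr₁ (by omega))
  rw [tsub_le_iff_right]
  calc ENNReal.ofReal (f y) ≤ ENNReal.ofReal (f y' + |f y - f y'|) :=
        ENNReal.ofReal_le_ofReal (by linarith [le_abs_self (f y - f y')])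
    _ = ENNReal.ofReal (f y') + ENNReal.ofReal |f y - f y'| :=
        ENNReal.ofReal_add (hf _) (abs_nonneg _)
    _ ≤ ENNReal.ofReal (f y') + H * ENNReal.ofReal (dShift r y.1 y'.1) := by
        gcongr
        exact ofReal_abs_sub_le_of_locLip_le hr₀ h h₂ hd₁
    _ ≤ ENNReal.ofReal (f y') + ENNReal.ofReal (r ^ k) * H := by
        rw [mul_comm H]
        gcongr

variable [Group G] {ψ : W → G}

lemma IsHarmonic.ruelle_one_ofReal {t : ℝ} {f : Ext A G → ℝ} (hφ : ∀ x, 0 < φ x)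
    (hf : ∀ z, 0 ≤ f z) (hfh : IsHarmonic ψ φ t f) (z : Ext A G) :
    ruelle ψ φ 1 (fun y => ENNReal.ofReal (f y)) z = ENNReal.ofReal (t * f z) := by
  rw [← (hfh z).tsum_eq,
    ENNReal.ofReal_tsum_of_nonneg (fun y => mul_nonneg (hφ _).le (hf _)) (hfh z).summable]
  exact tsum_congr fun y => by rw [birkhoffProd_one, ENNReal.ofReal_mul (hφ _).le]

lemma IsHarmonic.ruelle_ofReal {t : ℝ} {f : Ext A G → ℝ} (hφ : ∀ x, 0 < φ x) (ht : 0 ≤ t)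
    (hf : ∀ z, 0 ≤ f z) (hfh : IsHarmonic ψ φ t f) (n : ℕ) (z : Ext A G) :
    ruelle ψ φ n (fun y => ENNReal.ofReal (f y)) z = ENNReal.ofReal (t ^ n * f z) := by
  induction n generalizing z with
  | zero => simp [ruelle_zero]
  | succ n ih =>
    have hone : ruelle ψ φ 1 (fun y => ENNReal.ofReal (f y)) =
        fun z => ENNReal.ofReal t * ENNReal.ofReal (f z) :=
      funext fun z => by rw [hfh.ruelle_one_ofReal hφ hf, ENNReal.ofReal_mul ht]
    rw [ruelle_add hφ, hone, ruelle_const_mul, ih, ← ENNReal.ofReal_mul ht, ← mul_assoc,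
      pow_succ']

lemma ruelle_le_ruelle_tsub_add (n : ℕ) (F H : Ext A G → ℝ≥0∞) (ε : ℝ≥0∞) (ζ : Ext A G) :
    ruelle ψ φ n F ζ ≤ ruelle ψ φ n (fun y => F y - ε * H y) ζ + ε * ruelle ψ φ n H ζ := by
  rw [← ruelle_const_mul, ruelle, ruelle, ruelle, ← ENNReal.tsum_add]
  refine ENNReal.tsum_le_tsum fun y => ?_
  rw [← mul_add]
  gcongr
  exact le_tsub_add

lemma ruelle_tsub_le_of_locLip_le (hφ : ∀ x, 0 < φ x) (hr₀ : 0 < r) (hr₁ : r < 1)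
    {f : Ext A G → ℝ} {H : Ext A G → ℝ≥0∞} (hf : ∀ z, 0 ≤ f z) (hlip : ∀ z, locLip r f z ≤ H z)
    {x x' : Chain A} {k : ℕ} (hk : 1 ≤ k) (hag : ∀ i < k, x.1 i = x'.1 i) (hne : x ≠ x')
    (hd : dShift r x x' < 1) (e : G) (n : ℕ) :
    ruelle ψ φ (n + 1)
        (fun y => ENNReal.ofReal (f y) - ENNReal.ofReal (r ^ (n + 1 + k)) * H y) (x, e) ≤
      (1 + distortionConst r φ * ENNReal.ofReal (dShift r x x')) *
        ruelle ψ φ (n + 1) (fun y => ENNReal.ofReal (f y)) (x', e) := by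
  rw [← ruelle_const_mul]
  refine tsum_iterate_preimage_le n (fun y => ENNReal.ofReal (birkhoffProd φ (n + 1) y.1) *
      (ENNReal.ofReal (f y) - ENNReal.ofReal (r ^ (n + 1 + k)) * H y))
    (fun y => ENNReal.ofReal (birkhoffProd φ (n + 1) y.1) *
      ((1 + distortionConst r φ * ENNReal.ofReal (dShift r x x')) * ENNReal.ofReal (f y)))
    (fun y hy _ => adm_of_extMap_iterate_eq hy (hag 0 hk)) fun y y' hy hy' h₂ hn => ?_
  have hx : shift^[n + 1] y.1 = x := by rw [← extMap_iterate_fst (ψ := ψ), hy]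
  have hx' : shift^[n + 1] y'.1 = x' := by rw [← extMap_iterate_fst (ψ := ψ), hy']
  have hΦ := ofReal_birkhoffProd_le_distortionConst (r := r) hφ (Nat.le_add_left 1 n) hn
    (by rwa [hx, hx']) (by rw [hx, hx']; exact dShift_pos hr₀ hne)
  rw [hx, hx'] at hΦ
  refine (mul_le_mul' hΦ (ofReal_sub_le_of_locLip_le hr₀ hr₁ hf (hlip y) h₂ (by omega)
    (agree_add_of_extMap_iterate_eq hy hy' hn hag))).trans (le_of_eq ?_)
  ring

lemma IsHarmonic.le_mul_add_of_locLip_le {t : ℝ} {f h : Ext A G → ℝ} (hφ : ∀ x, 0 < φ x)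
    (hr₀ : 0 < r) (hr₁ : r < 1) (ht : 0 < t) (hCφ : distortionConst r φ ≠ ⊤)
    (hf : ∀ z, 0 ≤ f z) (hfh : IsHarmonic ψ φ t f) (hh : ∀ z, 0 ≤ h z)
    (hhh : IsHarmonic ψ φ t h) (hlip : ∀ z, locLip r f z ≤ ENNReal.ofReal (h z))
    {x x' : Chain A} (e : G) (hne : x ≠ x') (hd : dShift r x x' < 1) {k : ℕ} (hk : 1 ≤ k)
    (hag : ∀ i < k, x.1 i = x'.1 i) (n : ℕ) :
    f (x, e) ≤ (1 + (distortionConst r φ).toReal * dShift r x x') * f (x', e) +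
      r ^ (n + 1 + k) * h (x, e) := by
  have hd₀ := dShift_pos hr₀ hne
  have hκ : 1 + distortionConst r φ * ENNReal.ofReal (dShift r x x') =
      ENNReal.ofReal (1 + (distortionConst r φ).toReal * dShift r x x') := by
    rw [ENNReal.ofReal_add zero_le_one (by positivity), ENNReal.ofReal_one,
      ENNReal.ofReal_mul (by positivity), ENNReal.ofReal_toReal hCφ]
  have hsum := (ruelle_le_ruelle_tsub_add (ψ := ψ) (φ := φ) (n + 1)
    (fun y => ENNReal.ofReal (f y)) (fun y => ENNReal.ofReal (h y))
    (ENNReal.ofReal (r ^ (n + 1 + k))) (x, e)).trans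
      (add_le_add_left (ruelle_tsub_le_of_locLip_le hφ hr₀ hr₁ hf hlip hk hag hne hd e n) _)
  have hfx' := hf (x', e)
  have hhx := hh (x, e)
  rw [hfh.ruelle_ofReal hφ ht.le hf, hfh.ruelle_ofReal hφ ht.le hf,
    hhh.ruelle_ofReal hφ ht.le hh, hκ, ← ENNReal.ofReal_mul (by positivity),
    ← ENNReal.ofReal_mul (by positivity), ← ENNReal.ofReal_add (by positivity) (by positivity),
    ENNReal.ofReal_le_ofReal_iff (by positivity)] at hsum
  refine le_of_mul_le_mul_left (hsum.trans (le_of_eq ?_)) (pow_pos ht (n + 1))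
  ring

lemma IsHarmonic.le_mul_of_locLip_le {t : ℝ} {f h : Ext A G → ℝ} (hφ : ∀ x, 0 < φ x)
    (hr₀ : 0 < r) (hr₁ : r < 1) (ht : 0 < t) (hCφ : distortionConst r φ ≠ ⊤)
    (hf : ∀ z, 0 ≤ f z) (hfh : IsHarmonic ψ φ t f) (hh : ∀ z, 0 ≤ h z)
    (hhh : IsHarmonic ψ φ t h) (hlip : ∀ z, locLip r f z ≤ ENNReal.ofReal (h z))
    {x x' : Chain A} (e : G) (hne : x ≠ x') (hd : dShift r x x' < 1) :
    f (x, e) ≤ (1 + (distortionConst r φ).toReal * dShift r x x') * f (x', e) := by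
  obtain ⟨k, hk, hag, -⟩ := exists_agree_of_dShift_lt_one hne hd
  have hpow : Tendsto (fun n : ℕ => r ^ (n + 1 + k)) atTop (𝓝 0) :=
    (tendsto_pow_atTop_nhds_zero_of_lt_one hr₀.le hr₁).comp
      (tendsto_atTop_mono (fun n => (by omega : n ≤ n + 1 + k)) tendsto_id)
  have hlim := (hpow.mul_const (h (x, e))).const_add
    ((1 + (distortionConst r φ).toReal * dShift r x x') * f (x', e))
  rw [zero_mul, add_zero] at hlim
  exact ge_of_tendsto' hlim
    (hfh.le_mul_add_of_locLip_le hφ hr₀ hr₁ ht hCφ hf hh hhh hlip e hne hd hk hag)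

lemma logLip_le_distortionConst (hφ : ∀ x, 0 < φ x) (hr₀ : 0 < r) (hr₁ : r < 1) {ξ : Chain A}
    (hρ : 0 < specRad ψ φ ξ) (hCφ : distortionConst r φ ≠ ⊤) {f : Ext A G → ℝ}
    (hf : f ∈ harmonicLip ψ φ r ξ) (hf₀ : ∀ z, 0 ≤ f z) :
    logLip r f ≤ distortionConst r φ := by
  obtain ⟨hfh, h, ⟨hh₀, hhh, -⟩, hlip⟩ := hf
  rw [← ENNReal.ofReal_toReal hCφ]
  exact logLip_le_of_le_mul hr₀ hf₀ ENNReal.toReal_nonneg fun x x' e hne hd =>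
    hfh.le_mul_of_locLip_le hφ hr₀ hr₁ hρ hCφ hf₀ hh₀ hhh hlip e hne hd

end Harmonic

/-! ### Averages with respect to the approximating measures -/

section Cylinders

variable {W G : Type*} {A : W → W → Prop}

/-- Sets depending only on the fibre and on the first `N` letters. -/
def IsCyl (N : ℕ) (E : Set (Ext A G)) : Prop :=
  ∀ z z' : Ext A G, z.2 = z'.2 → (∀ i < N, z.1.1 i = z'.1.1 i) → z ∈ E → z' ∈ E

lemma IsCyl.indicator_le {N : ℕ} {E : Set (Ext A G)} (hE : IsCyl N E) {z z' : Ext A G}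
    (h₂ : z.2 = z'.2) (h : ∀ i < N, z.1.1 i = z'.1.1 i) :
    (E.indicator 1 z : ℝ≥0∞) ≤ E.indicator 1 z' := by
  classical
  by_cases hz : z ∈ E
  · simp [hz, hE z z' h₂ h hz]
  · simp [hz]

lemma indicator_one_le_one {α : Type*} (E : Set α) (y : α) : (E.indicator 1 y : ℝ≥0∞) ≤ 1 :=
  Set.indicator_le_self' (fun _ _ => zero_le) y

lemma tsum_le_sum_range_add_tsum {X Y : ℕ → ℝ≥0∞} (N k : ℕ) (h : ∀ n, N ≤ n → X (n + k) ≤ Y n) :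
    ∑' n, X n ≤ ∑ n ∈ Finset.range (N + k), X n + ∑' n, Y n := by
  rw [← (ENNReal.summable (f := fun n => X (n + (N + k)))).sum_add_tsum_nat_add']
  refine add_le_add le_rfl ?_
  calc ∑' n, X (n + (N + k)) ≤ ∑' n, Y (n + N) :=
        ENNReal.tsum_le_tsum fun n => by
          rw [← add_assoc]
          exact h _ (Nat.le_add_left N n)
    _ ≤ ∑' n, Y n := ENNReal.tsum_comp_le_tsum_of_injective (add_left_injective N) Y

end Cylinders

section Average

variable {W G : Type*} [Group G] {A : W → W → Prop} {ψ : W → G} {φ : Chain A → ℝ} {ξ : Chain A}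
  {b : ℕ → ℝ} {r C t : ℝ} {M : ℝ≥0}

variable (ψ φ ξ b) in
/-- The integral of `F` with respect to `m^t_ζ`, for arbitrary functions with values in `ℝ≥0∞`. -/
def avg (t : ℝ) (F : Ext A G → ℝ≥0∞) (ζ : Ext A G) : ℝ≥0∞ :=
  (poincareSeries ψ φ ξ b t)⁻¹ *
    ∑' n : ℕ, ENNReal.ofReal (b (n + 1) * t⁻¹ ^ (n + 1)) * ruelle ψ φ (n + 1) F ζ

lemma avg_mono {F F' : Ext A G → ℝ≥0∞} (h : ∀ y, F y ≤ F' y) (ζ : Ext A G) :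
    avg ψ φ ξ b t F ζ ≤ avg ψ φ ξ b t F' ζ := by
  unfold avg
  gcongr
  exact ruelle_mono _ h _

lemma avg_const_mul (c : ℝ≥0∞) (F : Ext A G → ℝ≥0∞) (ζ : Ext A G) :
    avg ψ φ ξ b t (fun y => c * F y) ζ = c * avg ψ φ ξ b t F ζ := by
  simp only [avg, ruelle_const_mul, mul_left_comm _ c, ENNReal.tsum_mul_left]

lemma avg_tsum {ι : Type*} (F : ι → Ext A G → ℝ≥0∞) (ζ : Ext A G) :
    avg ψ φ ξ b t (fun y => ∑' i, F i y) ζ = ∑' i, avg ψ φ ξ b t (F i) ζ := by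
  simp only [avg, ruelle_tsum, ← ENNReal.tsum_mul_left]
  exact ENNReal.tsum_comm

lemma avg_finset_sum {ι : Type*} (I : Finset ι) (F : ι → Ext A G → ℝ≥0∞) (ζ : Ext A G) :
    avg ψ φ ξ b t (fun y => ∑ i ∈ I, F i y) ζ = ∑ i ∈ I, avg ψ φ ξ b t (F i) ζ := by
  simp only [avg, ruelle_finset_sum, Finset.mul_sum]
  rw [Summable.tsum_finsetSum fun _ _ => ENNReal.summable, Finset.mul_sum]

lemma avg_translate (g : G) (F : Ext A G → ℝ≥0∞) (ζ : Ext A G) :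
    avg ψ φ ξ b t F (translate g ζ) = avg ψ φ ξ b t (fun y => F (translate g y)) ζ := by
  simp only [avg, ruelle_translate]

lemma ruelle_avg_comm (p : ℕ) (H : Ext A G → Ext A G → ℝ≥0∞) (ζ z : Ext A G) :
    ruelle ψ φ p (fun u => avg ψ φ ξ b t (H u) z) ζ =
      avg ψ φ ξ b t (fun y => ruelle ψ φ p (fun u => H u y) ζ) z := by
  simp only [ruelle.eq_1 (n := p), avg_tsum, avg_const_mul]

lemma coeff_le_mul_coeff (hb : Monotone b) (ht : 0 < t) (n p : ℕ) :
    ENNReal.ofReal (b n * t⁻¹ ^ n) ≤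
      ENNReal.ofReal (t ^ p) * ENNReal.ofReal (b (n + p) * t⁻¹ ^ (n + p)) := by
  rw [← ENNReal.ofReal_mul (by positivity)]
  refine ENNReal.ofReal_le_ofReal ?_
  calc b n * t⁻¹ ^ n ≤ b (n + p) * t⁻¹ ^ n := by
        gcongr
        exact hb (Nat.le_add_right n p)
    _ = t ^ p * (b (n + p) * t⁻¹ ^ (n + p)) := by
        rw [pow_add, inv_pow, inv_pow]
        field_simp

lemma mul_coeff_succ_le {c : ℝ} (hc : 0 < c) (ht : 0 < t) {n : ℕ} (hb : 0 < b (n + 1))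
    (h : c⁻¹ ≤ b n / b (n + 1)) :
    ENNReal.ofReal t * ENNReal.ofReal (b (n + 1) * t⁻¹ ^ (n + 1)) ≤
      ENNReal.ofReal c * ENNReal.ofReal (b n * t⁻¹ ^ n) := by
  rw [← ENNReal.ofReal_mul ht.le, ← ENNReal.ofReal_mul hc.le]
  refine ENNReal.ofReal_le_ofReal ?_
  rw [le_div_iff₀ hb, inv_mul_le_iff₀ hc] at h
  calc t * (b (n + 1) * t⁻¹ ^ (n + 1)) = b (n + 1) * t⁻¹ ^ n := by
        rw [pow_succ t⁻¹ n]
        field_simp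
    _ ≤ c * b n * t⁻¹ ^ n := by gcongr
    _ = c * (b n * t⁻¹ ^ n) := mul_assoc _ _ _

lemma tsum_coeff_mul_ruelle_add_le (hb : Monotone b) (ht : 0 < t) (p : ℕ)
    (F : Ext A G → ℝ≥0∞) (ζ : Ext A G) :
    (poincareSeries ψ φ ξ b t)⁻¹ * ∑' n : ℕ,
      ENNReal.ofReal (b (n + 1) * t⁻¹ ^ (n + 1)) * ruelle ψ φ (n + 1 + p) F ζ ≤
      ENNReal.ofReal (t ^ p) * avg ψ φ ξ b t F ζ := by
  rw [avg, mul_left_comm]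
  gcongr
  rw [← ENNReal.tsum_mul_left]
  calc _ ≤ ∑' n : ℕ, ENNReal.ofReal (t ^ p) *
        (ENNReal.ofReal (b (n + p + 1) * t⁻¹ ^ (n + p + 1)) * ruelle ψ φ (n + p + 1) F ζ) := by
        refine ENNReal.tsum_le_tsum fun n => ?_
        have := coeff_le_mul_coeff hb ht (n + 1) p
        rw [← mul_assoc, add_right_comm n p 1]
        gcongr
    _ ≤ _ := ENNReal.tsum_comp_le_tsum_of_injective (add_left_injective p) (fun n : ℕ =>
        ENNReal.ofReal (t ^ p) *
          (ENNReal.ofReal (b (n + 1) * t⁻¹ ^ (n + 1)) * ruelle ψ φ (n + 1) F ζ))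

lemma avg_ruelle_le (hφ : ∀ x, 0 < φ x) (hb : Monotone b) (ht : 0 < t) (p : ℕ)
    (F : Ext A G → ℝ≥0∞) (ζ : Ext A G) :
    avg ψ φ ξ b t (ruelle ψ φ p F) ζ ≤ ENNReal.ofReal (t ^ p) * avg ψ φ ξ b t F ζ := by
  refine le_trans (le_of_eq ?_) (tsum_coeff_mul_ruelle_add_le hb ht p F ζ)
  simp only [avg, ruelle_add hφ]

lemma ruelle_avg (hφ : ∀ x, 0 < φ x) (p : ℕ) (F : Ext A G → ℝ≥0∞) (ζ : Ext A G) :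
    ruelle ψ φ p (avg ψ φ ξ b t F) ζ = (poincareSeries ψ φ ξ b t)⁻¹ * ∑' n : ℕ,
      ENNReal.ofReal (b (n + 1) * t⁻¹ ^ (n + 1)) * ruelle ψ φ (n + 1 + p) F ζ := by
  unfold avg
  simp only [ruelle_const_mul, ruelle_tsum]
  congr! 4 with n
  rw [add_comm (n + 1) p, ruelle_add hφ]

lemma ruelle_avg_le (hφ : ∀ x, 0 < φ x) (hb : Monotone b) (ht : 0 < t) (p : ℕ)
    (F : Ext A G → ℝ≥0∞) (ζ : Ext A G) :
    ruelle ψ φ p (avg ψ φ ξ b t F) ζ ≤ ENNReal.ofReal (t ^ p) * avg ψ φ ξ b t F ζ :=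
  (ruelle_avg hφ p F ζ).le.trans (tsum_coeff_mul_ruelle_add_le hb ht p F ζ)

lemma mul_avg_le_avg (hφ : ∀ x, 0 < φ x) (hb : Monotone b) (ht : 0 < t) (p : ℕ)
    (F : Ext A G → ℝ≥0∞) {q ζ : Ext A G} (h : (extMap ψ)^[p] q = ζ) :
    ENNReal.ofReal (birkhoffProd φ p q.1) * avg ψ φ ξ b t F q ≤
      ENNReal.ofReal (t ^ p) * avg ψ φ ξ b t F ζ :=
  (mul_le_ruelle p _ h).trans (ruelle_avg_le hφ hb ht p F ζ)

/-- The standing assumptions on the group extension, the potential and the weight, with the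
constants `C` of bounded distortion and `M ≥ ‖L_φ 1‖_∞` made explicit. -/
structure IsRegular (ψ : W → G) (φ : Chain A → ℝ) (ξ : Chain A) (b : ℕ → ℝ) (r C : ℝ)
    (M : ℝ≥0) : Prop where
  pos : ∀ x, 0 < φ x
  r_pos : 0 < r
  r_lt_one : r < 1
  dist : HasDistortion φ r C
  tsum_le : ∀ x : Chain A,
    ∑' y : {y : Chain A // shift y = x}, ENNReal.ofReal (φ y.1) ≤ (M : ℝ≥0∞)
  bip : BigImagesPreimages A
  trans : TopTransitiveExt A ψ
  weight : IsWeight ψ φ ξ b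

namespace IsRegular

lemma specRad_pos (hreg : IsRegular ψ φ ξ b r C M) : 0 < specRad ψ φ ξ :=
  hreg.dist.specRad_pos hreg.pos hreg.tsum_le hreg.trans ξ

lemma exists_sum_range_le (hreg : IsRegular ψ φ ξ b r C M) (N : ℕ) :
    ∃ R : ℝ≥0∞, R ≠ ⊤ ∧ ∀ t : ℝ, specRad ψ φ ξ ≤ t → ∀ (F : Ext A G → ℝ≥0∞) (ζ : Ext A G),
      (∀ y, F y ≤ 1) → ∑ n ∈ Finset.range N,
        ENNReal.ofReal (b (n + 1) * t⁻¹ ^ (n + 1)) * ruelle ψ φ (n + 1) F ζ ≤ R := by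
  have hρ := hreg.specRad_pos
  refine ⟨∑ n ∈ Finset.range N, ENNReal.ofReal (b (n + 1) * (specRad ψ φ ξ)⁻¹ ^ (n + 1)) *
    (M : ℝ≥0∞) ^ (n + 1), ?_, fun t ht F ζ hF => Finset.sum_le_sum fun n _ => ?_⟩
  · exact ENNReal.sum_ne_top.2 fun n _ => ENNReal.mul_ne_top ENNReal.ofReal_ne_top
      (ENNReal.pow_ne_top ENNReal.coe_ne_top)
  · have hb : 0 ≤ b (n + 1) := zero_le_one.trans (hreg.weight.one_le _)
    have ht₀ : 0 < t := hρ.trans_le ht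
    gcongr
    exact (ruelle_mono _ hF _).trans (ruelle_one_le hreg.pos hreg.tsum_le _ _)

/- The first terms of the series are immaterial: `𝓟(t)⁻¹ R → 0` as `t ↘ ρ`. -/
lemma exists_avg_le_add (hreg : IsRegular ψ φ ξ b r C M) (N : ℕ) :
    ∃ R : ℝ≥0∞, R ≠ ⊤ ∧ ∀ t : ℝ, specRad ψ φ ξ ≤ t →
      ∀ (F F' : Ext A G → ℝ≥0∞) (z z' : Ext A G) (c : ℝ≥0∞), (∀ y, F y ≤ 1) →
        (∀ n, N ≤ n → ruelle ψ φ (n + 1) F z ≤ c * ruelle ψ φ (n + 1) F' z') →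
        avg ψ φ ξ b t F z ≤ (poincareSeries ψ φ ξ b t)⁻¹ * R + c * avg ψ φ ξ b t F' z' := by
  obtain ⟨R, hR, hbound⟩ := hreg.exists_sum_range_le N
  refine ⟨R, hR, fun t ht F F' z z' c hF h => ?_⟩
  rw [avg, avg, mul_left_comm, ← mul_add]
  refine mul_le_mul' le_rfl ?_
  rw [← ENNReal.tsum_mul_left]
  refine (tsum_le_sum_range_add_tsum (Y := fun n => c *
    (ENNReal.ofReal (b (n + 1) * t⁻¹ ^ (n + 1)) * ruelle ψ φ (n + 1) F' z')) N 0
    fun n hn => ?_).trans ?_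
  · rw [mul_left_comm, add_zero]
    gcongr
    exact h n hn
  · gcongr
    exact hbound t ht F z hF

/- Together with `ruelle_avg_le`, this shows that the averages are asymptotically harmonic. -/
lemma exists_mul_avg_le (hreg : IsRegular ψ φ ξ b r C M) (t₀ : ℝ) {c : ℝ} (hc : 1 < c) :
    ∃ R : ℝ≥0∞, R ≠ ⊤ ∧ ∀ t : ℝ, specRad ψ φ ξ ≤ t → t ≤ t₀ →
      ∀ (F : Ext A G → ℝ≥0∞) (ζ : Ext A G), (∀ y, F y ≤ 1) →
        ENNReal.ofReal t * avg ψ φ ξ b t F ζ ≤ (poincareSeries ψ φ ξ b t)⁻¹ * R +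
          ENNReal.ofReal c * ruelle ψ φ 1 (avg ψ φ ξ b t F) ζ := by
  have hc₀ : 0 < c := zero_lt_one.trans hc
  obtain ⟨N, hN⟩ := eventually_atTop.1
    (hreg.weight.ratio.eventually (lt_mem_nhds (inv_lt_one_of_one_lt₀ hc)))
  obtain ⟨R, hR, hbound⟩ := hreg.exists_sum_range_le (N + 1)
  refine ⟨ENNReal.ofReal t₀ * R, ENNReal.mul_ne_top ENNReal.ofReal_ne_top hR,
    fun t ht ht₀ F ζ hF => ?_⟩
  have hcoeff (n : ℕ) (hn : N ≤ n) := mul_coeff_succ_le hc₀ (hreg.specRad_pos.trans_le ht)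
    (zero_lt_one.trans_le (hreg.weight.one_le (n + 1 + 1))) (hN (n + 1) (hn.trans n.le_succ)).le
  rw [ruelle_avg hreg.pos, avg, mul_left_comm, mul_left_comm (ENNReal.ofReal c), ← mul_add]
  refine mul_le_mul' le_rfl ?_
  rw [← ENNReal.tsum_mul_left, ← ENNReal.tsum_mul_left]
  refine (tsum_le_sum_range_add_tsum (Y := fun n => ENNReal.ofReal c *
    (ENNReal.ofReal (b (n + 1) * t⁻¹ ^ (n + 1)) * ruelle ψ φ (n + 1 + 1) F ζ)) N 1
    fun n hn => ?_).trans ?_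
  · rw [← mul_assoc, ← mul_assoc]
    exact mul_le_mul_left (hcoeff n hn) _
  · rw [← Finset.mul_sum]
    gcongr
    exact hbound t ht F ζ hF

lemma exists_avg_le_of_agree (hreg : IsRegular ψ φ ξ b r C M) (N : ℕ) :
    ∃ R : ℝ≥0∞, R ≠ ⊤ ∧ ∀ t : ℝ, specRad ψ φ ξ ≤ t → ∀ E : Set (Ext A G), IsCyl N E →
      ∀ (k : ℕ) (x x' : Chain A) (e : G), 1 ≤ k → (∀ i < k, x.1 i = x'.1 i) →
        avg ψ φ ξ b t (E.indicator 1) (x, e) ≤ (poincareSeries ψ φ ξ b t)⁻¹ * R +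
          ENNReal.ofReal (Real.exp (C * r ^ k)) * avg ψ φ ξ b t (E.indicator 1) (x', e) := by
  obtain ⟨R, hR, h⟩ := hreg.exists_avg_le_add N
  refine ⟨R, hR, fun t ht E hE k x x' e hk hag =>
    h t ht _ _ _ _ _ (indicator_one_le_one E) fun n hn => ?_⟩
  exact hreg.dist.ruelle_le n hk hag e fun y y' h₂ hy =>
    hE.indicator_le h₂ fun i hi => hy i (by omega)

lemma exists_avg_le_mul (hreg : IsRegular ψ φ ξ b r C M) (t₀ : ℝ) (z z' : Ext A G) :
    ∃ K : ℝ≥0∞, K ≠ ⊤ ∧ ∀ N : ℕ, ∃ R : ℝ≥0∞, R ≠ ⊤ ∧ ∀ t : ℝ, specRad ψ φ ξ ≤ t → t ≤ t₀ →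
      ∀ E : Set (Ext A G), IsCyl N E →
        avg ψ φ ξ b t (E.indicator 1) z ≤ (poincareSeries ψ φ ξ b t)⁻¹ * R +
          K * avg ψ φ ξ b t (E.indicator 1) z' := by
  obtain ⟨x, e⟩ := z
  obtain ⟨p, q, hq₀, hq⟩ := hreg.trans.exists_iterate_eq (x.1 0) e z'.2 z'.1
  have hpos : ENNReal.ofReal (birkhoffProd φ (p + 1) q) ≠ 0 := by
    simpa using birkhoffProd_pos hreg.pos _ _
  refine ⟨ENNReal.ofReal (Real.exp (C * r ^ 1)) *
    ((ENNReal.ofReal (birkhoffProd φ (p + 1) q))⁻¹ * ENNReal.ofReal (t₀ ^ (p + 1))), ?_,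
    fun N => ?_⟩
  · exact ENNReal.mul_ne_top ENNReal.ofReal_ne_top
      (ENNReal.mul_ne_top (ENNReal.inv_ne_top.2 hpos) ENNReal.ofReal_ne_top)
  obtain ⟨R, hR, h⟩ := hreg.exists_avg_le_of_agree N
  refine ⟨R, hR, fun t ht ht₀ E hE => (h t ht E hE 1 x q e le_rfl fun i hi => ?_).trans ?_⟩
  · rw [Nat.lt_one_iff.1 hi, hq₀]
  · have htpos : 0 < t := hreg.specRad_pos.trans_le ht
    rw [mul_assoc, mul_assoc]
    gcongr
    rw [← ENNReal.mul_le_iff_le_inv hpos ENNReal.ofReal_ne_top]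
    refine (mul_avg_le_avg hreg.pos hreg.weight.mono htpos (p + 1) _ hq).trans ?_
    gcongr

lemma exists_avg_le_base (hreg : IsRegular ψ φ ξ b r C M) (t₀ : ℝ) :
    ∃ K : ℝ≥0∞, K ≠ ⊤ ∧ ∀ t : ℝ, 0 < t → t ≤ t₀ → ∀ F : Ext A G → ℝ≥0∞,
      (∀ y y' : Ext A G, y.2 = y'.2 → F y = F y') → ∀ (x : Chain A) (e : G),
        avg ψ φ ξ b t F (x, e) ≤ K * avg ψ φ ξ b t F (ξ, e) := by
  obtain ⟨I, p, K, hK, h⟩ := hreg.dist.exists_ruelle_le_sum_base hreg.pos hreg.bip hreg.trans ξ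
  refine ⟨∑ β ∈ I, K β * ENNReal.ofReal (t₀ ^ p β),
    ENNReal.sum_ne_top.2 fun β _ => ENNReal.mul_ne_top (hK β) ENNReal.ofReal_ne_top,
    fun t ht ht₀ F hF x e => ?_⟩
  calc avg ψ φ ξ b t F (x, e)
      ≤ (poincareSeries ψ φ ξ b t)⁻¹ * ∑' n : ℕ, ENNReal.ofReal (b (n + 1) * t⁻¹ ^ (n + 1)) *
          ∑ β ∈ I, K β * ruelle ψ φ (n + 1 + p β) F (ξ, e) := by
        unfold avg
        gcongr with n
        exact h n x e _ hF
    _ = ∑ β ∈ I, K β * ((poincareSeries ψ φ ξ b t)⁻¹ * ∑' n : ℕ,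
          ENNReal.ofReal (b (n + 1) * t⁻¹ ^ (n + 1)) * ruelle ψ φ (n + 1 + p β) F (ξ, e)) := by
        simp only [Finset.mul_sum]
        rw [Summable.tsum_finsetSum fun _ _ => ENNReal.summable, Finset.mul_sum]
        simp only [mul_left_comm _ (K _), ENNReal.tsum_mul_left]
    _ ≤ ∑ β ∈ I, K β * (ENNReal.ofReal (t₀ ^ p β) * avg ψ φ ξ b t F (ξ, e)) := by
        refine Finset.sum_le_sum fun β _ => mul_le_mul' le_rfl ?_
        refine (tsum_coeff_mul_ruelle_add_le hreg.weight.mono ht (p β) _ _).trans ?_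
        gcongr
    _ = _ := by simp only [Finset.sum_mul, mul_assoc]

lemma exists_avg_last_le_first (hreg : IsRegular ψ φ ξ b r C M) (t₀ : ℝ) (ζ : Ext A G) (g : G) :
    ∃ K : ℝ≥0∞, K ≠ ⊤ ∧ ∀ t : ℝ, 0 < t → t ≤ t₀ → ∀ S : Set W,
      avg ψ φ ξ b t (fun y =>
        ruelle ψ φ 1 ({u : Ext A G | u.1.1 0 ∈ S ∧ u.2 * y.2 = g}.indicator 1) ζ) (ξ, 1) ≤
      K * avg ψ φ ξ b t ({u : Ext A G | u.1.1 0 ∈ S ∧ u.2 = 1}.indicator 1) (ξ, 1) := by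
  obtain ⟨I, p, K, hK, h⟩ :=
    hreg.dist.exists_last_le_first hreg.pos hreg.bip hreg.trans ζ g
  refine ⟨∑ β ∈ I, K β * ENNReal.ofReal (t₀ ^ p β),
    ENNReal.sum_ne_top.2 fun β _ => ENNReal.mul_ne_top (hK β) ENNReal.ofReal_ne_top,
    fun t ht ht₀ S => ?_⟩
  refine (avg_mono (h S) _).trans ?_
  simp only [avg_finset_sum, avg_const_mul, Finset.sum_mul, mul_assoc]
  refine Finset.sum_le_sum fun β _ => mul_le_mul' le_rfl ?_
  refine (avg_ruelle_le hreg.pos hreg.weight.mono ht (p β) _ _).trans ?_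
  gcongr

/- The mass carried by preimages with first letter in `S` is controlled, uniformly in `t`, by the
mass of a single fibre at the base point; this is what makes the Ruelle operator commute with the
limit of the averages. -/
lemma exists_ruelle_avg_le (hreg : IsRegular ψ φ ξ b r C M) (t₀ : ℝ) (ζ : Ext A G) (g : G) :
    ∃ K : ℝ≥0∞, K ≠ ⊤ ∧ ∀ t : ℝ, 0 < t → t ≤ t₀ → ∀ S : Set W,
      ruelle ψ φ 1 ({u : Ext A G | u.1.1 0 ∈ S}.indicator
        (avg ψ φ ξ b t ((fibre A g).indicator 1))) ζ ≤
      K * avg ψ φ ξ b t ({u : Ext A G | u.1.1 0 ∈ S ∧ u.2 = 1}.indicator 1) (ξ, 1) := by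
  classical
  obtain ⟨K, hK, hbase⟩ := hreg.exists_avg_le_base t₀
  obtain ⟨K', hK', hlast⟩ := hreg.exists_avg_last_le_first t₀ ζ g
  refine ⟨K * K', ENNReal.mul_ne_top hK hK', fun t ht ht₀ S => ?_⟩
  have htranslate (u : Ext A G) : avg ψ φ ξ b t ((fibre A g).indicator 1) (ξ, u.2) =
      avg ψ φ ξ b t ({y : Ext A G | u.2 * y.2 = g}.indicator 1) (ξ, 1) := by
    have hu : ((ξ, u.2) : Ext A G) = translate u.2 (ξ, 1) := by simp
    rw [hu, avg_translate]
    rfl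
  calc _ ≤ ruelle ψ φ 1 (fun u => K * avg ψ φ ξ b t (fun y =>
        {u : Ext A G | u.1.1 0 ∈ S ∧ u.2 * y.2 = g}.indicator 1 u) (ξ, 1)) ζ := by
        refine ruelle_mono 1 (Set.indicator_le fun u hu => ?_) ζ
        refine (hbase t ht ht₀ _ (fun y y' h => ?_) u.1 u.2).trans ?_
        · simp [Set.indicator_apply, fibre, h]
        · rw [htranslate u]
          refine mul_le_mul' le_rfl (avg_mono (fun y => le_of_eq ?_) _)
          have hu' : u.1.1 0 ∈ S := hu
          simp [Set.indicator_apply, hu']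
    _ = K * avg ψ φ ξ b t (fun y =>
        ruelle ψ φ 1 ({u : Ext A G | u.1.1 0 ∈ S ∧ u.2 * y.2 = g}.indicator 1) ζ) (ξ, 1) := by
        rw [ruelle_const_mul, ruelle_avg_comm]
    _ ≤ _ := by
        rw [mul_assoc]
        gcongr
        exact hlast t ht ht₀ S

/- The preimages with first letter outside `S` contribute a finite sum once `Sᶜ` is finite, and for
these the limit may be taken term by term. -/
lemma exists_mul_avg_le_ruelle_indicator (hreg : IsRegular ψ φ ξ b r C M) (t₀ : ℝ) (ζ : Ext A G)
    (g : G) :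
    ∃ K : ℝ≥0∞, K ≠ ⊤ ∧ ∀ c : ℝ, 1 < c → ∃ R : ℝ≥0∞, R ≠ ⊤ ∧
      ∀ t : ℝ, specRad ψ φ ξ ≤ t → t ≤ t₀ → ∀ E ⊆ fibre A g, ∀ S : Set W,
        ENNReal.ofReal t * avg ψ φ ξ b t (E.indicator 1) ζ ≤
          (poincareSeries ψ φ ξ b t)⁻¹ * R + ENNReal.ofReal c *
            (ruelle ψ φ 1 ({u : Ext A G | u.1.1 0 ∉ S}.indicator
              (avg ψ φ ξ b t (E.indicator 1))) ζ +
            K * avg ψ φ ξ b t ({u : Ext A G | u.1.1 0 ∈ S ∧ u.2 = 1}.indicator 1) (ξ, 1)) := by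
  obtain ⟨K, hK, hS⟩ := hreg.exists_ruelle_avg_le t₀ ζ g
  refine ⟨K, hK, fun c hc => ?_⟩
  obtain ⟨R, hR, h⟩ := hreg.exists_mul_avg_le t₀ hc
  refine ⟨R, hR, fun t ht ht₀ E hE S => (h t ht ht₀ _ ζ (indicator_one_le_one E)).trans ?_⟩
  gcongr
  refine le_trans ?_ (add_le_add le_rfl (hS t (hreg.specRad_pos.trans_le ht) ht₀ S))
  rw [← ruelle_fun_add]
  refine ruelle_mono 1 (fun u => ?_) ζ
  by_cases hu : u.1.1 0 ∈ S
  · rw [Set.indicator_of_mem (s := {u : Ext A G | u.1.1 0 ∈ S}) hu]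
    refine le_add_left (avg_mono (fun y => ?_) u)
    exact Set.indicator_le_indicator_of_subset hE (fun _ => zero_le) y
  · rw [Set.indicator_of_mem (s := {u : Ext A G | u.1.1 0 ∉ S}) hu]
    exact le_self_add

lemma poincareSeries_ne_zero (hreg : IsRegular ψ φ ξ b r C M) (ht : 0 < t) :
    poincareSeries ψ φ ξ b t ≠ 0 := by
  obtain ⟨p, q, -, hq⟩ := hreg.trans.exists_iterate_eq (ξ.1 0) 1 1 ξ
  have hb := zero_lt_one.trans_le (hreg.weight.one_le (p + 1))
  have hΦ := birkhoffProd_pos hreg.pos (p + 1) q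
  intro h
  rw [poincareSeries, ENNReal.tsum_eq_zero] at h
  have hret : returnSum ψ φ ξ (p + 1) = 0 :=
    (mul_eq_zero.1 (h p)).resolve_left (ENNReal.ofReal_pos.2 (by positivity)).ne'
  rw [returnSum, ENNReal.tsum_eq_zero] at hret
  exact (ENNReal.ofReal_pos.2 hΦ).ne' (hret ⟨q, hq⟩)

lemma tendsto_poincareSeries (hreg : IsRegular ψ φ ξ b r C M) {s : ℕ → ℝ}
    (hs : DecreasesTo s (specRad ψ φ ξ)) :
    Tendsto (fun k => poincareSeries ψ φ ξ b (s k)) atTop (𝓝 ⊤) := by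
  have hρ := hreg.specRad_pos
  have hret (n : ℕ) : returnSum ψ φ ξ n ≠ ⊤ :=
    ne_top_of_le_ne_top (ENNReal.pow_ne_top ENNReal.coe_ne_top)
      (returnSum_le hreg.pos hreg.tsum_le ξ n)
  rw [ENNReal.tendsto_nhds_top_iff_nnreal]
  intro x
  have hx : (x : ℝ≥0∞) < poincareSeries ψ φ ξ b (specRad ψ φ ξ) := by
    rw [hreg.weight.diverges _ hρ le_rfl]
    exact ENNReal.coe_lt_top
  rw [poincareSeries, ENNReal.tsum_eq_iSup_nat] at hx
  obtain ⟨N, hN⟩ := lt_iSup_iff.1 hx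
  have hlim : Tendsto (fun k => ∑ n ∈ Finset.range N,
      ENNReal.ofReal (b (n + 1) * (s k)⁻¹ ^ (n + 1)) * returnSum ψ φ ξ (n + 1)) atTop
      (𝓝 (∑ n ∈ Finset.range N, ENNReal.ofReal (b (n + 1) * (specRad ψ φ ξ)⁻¹ ^ (n + 1)) *
        returnSum ψ φ ξ (n + 1))) :=
    tendsto_finsetSum _ fun n _ => ENNReal.Tendsto.mul_const
      (ENNReal.tendsto_ofReal (((hs.lim.inv₀ hρ.ne').pow _).const_mul _)) (Or.inr (hret _))
  filter_upwards [hlim.eventually (lt_mem_nhds hN)] with k hk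
  exact hk.trans_le (ENNReal.sum_le_tsum _)

lemma tendsto_inv_poincareSeries_mul (hreg : IsRegular ψ φ ξ b r C M) {s : ℕ → ℝ}
    (hs : DecreasesTo s (specRad ψ φ ξ)) {R : ℝ≥0∞} (hR : R ≠ ⊤) :
    Tendsto (fun k => (poincareSeries ψ φ ξ b (s k))⁻¹ * R) atTop (𝓝 0) := by
  have hinv := (hreg.tendsto_poincareSeries hs).inv
  rw [ENNReal.inv_top] at hinv
  simpa using ENNReal.Tendsto.mul_const hinv (Or.inr hR)

lemma avg_fibre_base (hreg : IsRegular ψ φ ξ b r C M) (ht : specRad ψ φ ξ < t) :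
    avg ψ φ ξ b t ((fibre A (1 : G)).indicator 1) (ξ, 1) = 1 := by
  simp only [avg, ← returnSum_eq_ruelle]
  exact ENNReal.inv_mul_cancel (hreg.poincareSeries_ne_zero (hreg.specRad_pos.trans ht))
    (hreg.weight.converges t ht).ne

end IsRegular

end Average

/-! ### Measures on the phase space -/

section Topology

variable {W : Type*} {A : W → W → Prop} [TopologicalSpace W] [DiscreteTopology W]

instance instSecondCountableChain [Countable W] : SecondCountableTopology (Chain A) :=
  inferInstanceAs (SecondCountableTopology {x : ℕ → W | ∀ i, A (x i) (x (i + 1))})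

instance instMetrizableChain : TopologicalSpace.MetrizableSpace (Chain A) :=
  inferInstanceAs (TopologicalSpace.MetrizableSpace {x : ℕ → W | ∀ i, A (x i) (x (i + 1))})

end Topology

section CylinderTopology

variable {W G : Type*} {A : W → W → Prop} {N N' : ℕ} {E F : Set (Ext A G)}

lemma IsCyl.compl (hE : IsCyl N E) : IsCyl N Eᶜ :=
  fun z z' h₂ h hz hz' => hz (hE z' z h₂.symm (fun i hi => (h i hi).symm) hz')

lemma IsCyl.mono (hN : N ≤ N') (hE : IsCyl N E) : IsCyl N' E :=
  fun z z' h₂ h hz => hE z z' h₂ (fun i hi => h i (hi.trans_le hN)) hz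

lemma IsCyl.inter (hE : IsCyl N E) (hF : IsCyl N F) : IsCyl N (E ∩ F) :=
  fun z z' h₂ h hz => ⟨hE z z' h₂ h hz.1, hF z z' h₂ h hz.2⟩

lemma IsCyl.union (hE : IsCyl N E) (hF : IsCyl N F) : IsCyl N (E ∪ F) :=
  fun z z' h₂ h hz => hz.imp (hE z z' h₂ h) (hF z z' h₂ h)

lemma isCyl_fibre (N : ℕ) (g : G) : IsCyl N (fibre A g) :=
  fun _ _ h₂ _ hz => h₂.symm.trans hz

/-- The largest set contained in `U` which depends only on the fibre and on the first `N`
letters. -/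
def cylInterior (N : ℕ) (U : Set (Ext A G)) : Set (Ext A G) :=
  {z | ∀ z' : Ext A G, z.2 = z'.2 → (∀ i < N, z.1.1 i = z'.1.1 i) → z' ∈ U}

lemma isCyl_cylInterior (N : ℕ) (U : Set (Ext A G)) : IsCyl N (cylInterior N U) :=
  fun _ _ h₂ h hz z'' h₂' h' => hz z'' (h₂.trans h₂') fun i hi => (h i hi).trans (h' i hi)

lemma cylInterior_subset (N : ℕ) (U : Set (Ext A G)) : cylInterior N U ⊆ U :=
  fun z hz => hz z rfl fun _ _ => rfl

lemma monotone_cylInterior (U : Set (Ext A G)) : Monotone fun N => cylInterior N U :=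
  fun _ _ hN _ hz z' h₂ h => hz z' h₂ fun i hi => h i (hi.trans_le hN)

variable [TopologicalSpace W] [TopologicalSpace G]

lemma eventually_nhds_agree [DiscreteTopology W] [DiscreteTopology G] (N : ℕ) (z : Ext A G) :
    ∀ᶠ z' in 𝓝 z, z.2 = z'.2 ∧ ∀ i < N, z.1.1 i = z'.1.1 i := by
  have hletter (i : ℕ) : ∀ᶠ z' in 𝓝 z, z.1.1 i = z'.1.1 i := by
    have hcont : Continuous fun z' : Ext A G => z'.1.1 i :=
      (continuous_apply i).comp (continuous_subtype_val.comp continuous_fst)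
    filter_upwards [((isOpen_discrete {z.1.1 i}).preimage hcont).mem_nhds rfl] with z' hz'
      using Eq.symm hz'
  have hfibre : ∀ᶠ z' in 𝓝 z, z.2 = z'.2 := by
    filter_upwards [((isOpen_discrete {z.2}).preimage continuous_snd).mem_nhds rfl] with z' hz'
      using Eq.symm hz'
  refine hfibre.and ?_
  simpa using (Filter.eventually_all_finset (Finset.range N)).2 fun i _ => hletter i

lemma IsCyl.isOpen [DiscreteTopology W] [DiscreteTopology G] (hE : IsCyl N E) : IsOpen E := by
  refine isOpen_iff_mem_nhds.2 fun z hz => ?_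
  filter_upwards [eventually_nhds_agree N z] with z' hz' using hE z z' hz'.1 hz'.2 hz

lemma IsCyl.isClopen [DiscreteTopology W] [DiscreteTopology G] (hE : IsCyl N E) : IsClopen E :=
  ⟨⟨hE.compl.isOpen⟩, hE.isOpen⟩

lemma exists_mem_cylInterior {z : Ext A G} {U : Set (Ext A G)} (hU : U ∈ 𝓝 z) :
    ∃ N, z ∈ cylInterior N U := by
  rw [nhds_prod_eq, Filter.mem_prod_iff] at hU
  obtain ⟨V, hV, V', hV', hVU⟩ := hU
  rw [nhds_subtype_eq_comap, Filter.mem_comap] at hV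
  obtain ⟨V₁, hV₁, hV₁V⟩ := hV
  rw [nhds_pi, Filter.mem_pi] at hV₁
  obtain ⟨I, hI, t, ht, htV₁⟩ := hV₁
  obtain ⟨N, hN⟩ := hI.bddAbove
  refine ⟨N + 1, fun z' h₂ h => hVU ⟨hV₁V (htV₁ fun i hi => ?_), ?_⟩⟩
  · rw [← h i (Nat.lt_succ_of_le (hN hi))]
    exact mem_of_mem_nhds (ht i)
  · rw [← h₂]
    exact mem_of_mem_nhds hV'

lemma iUnion_cylInterior {U : Set (Ext A G)} (hU : IsOpen U) : ⋃ N, cylInterior N U = U :=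
  subset_antisymm (Set.iUnion_subset fun N => cylInterior_subset N U) fun _ hz =>
    Set.mem_iUnion.2 (exists_mem_cylInterior (hU.mem_nhds hz))

end CylinderTopology

section CylinderMeasure

variable {W G : Type*} {A : W → W → Prop} [MeasurableSpace W] [MeasurableSpace G]
  {μ μ' : Measure (Ext A G)} {c : ℝ≥0∞} {g : G}

lemma measurableSet_fibre [MeasurableSingletonClass G] (g : G) : MeasurableSet (fibre A g) :=
  measurable_snd (measurableSet_singleton g)

lemma measure_eq_tsum_fibre [Countable G] [MeasurableSingletonClass G] (μ : Measure (Ext A G))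
    {B : Set (Ext A G)} (hB : MeasurableSet B) : μ B = ∑' g : G, μ (B ∩ fibre A g) := by
  rw [← measure_iUnion ?_ fun g => hB.inter (measurableSet_fibre g)]
  · congr 1
    ext z
    simp [fibre]
  · intro g g' hne
    refine Set.disjoint_left.2 fun z hz hz' => hne ?_
    exact (hz.2 : z.2 = g).symm.trans hz'.2

lemma sigmaFinite_of_fibre_lt_top [Countable G] (h : ∀ g, μ (fibre A g) < ⊤) :
    SigmaFinite μ := by
  refine Measure.sigmaFinite_of_countable (Set.countable_range (fibre A (G := G)))
    (Set.forall_mem_range.2 h) ?_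
  ext z
  simp [fibre]

variable [TopologicalSpace W] [DiscreteTopology W] [TopologicalSpace G] [DiscreteTopology G]

lemma measure_open_inter_fibre_le_of_isCyl {U : Set (Ext A G)} (hU : IsOpen U)
    (h : ∀ (N : ℕ) (E : Set (Ext A G)), IsCyl N E → E ⊆ fibre A g → μ E ≤ c * μ' E) :
    μ (U ∩ fibre A g) ≤ c * μ' (U ∩ fibre A g) := by
  rw [← iUnion_cylInterior (hU.inter (isCyl_fibre 0 g).isOpen),
    (monotone_cylInterior _).measure_iUnion, (monotone_cylInterior _).measure_iUnion,
    ENNReal.mul_iSup]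
  exact iSup_mono fun N => h N _ (isCyl_cylInterior N _)
    ((cylInterior_subset N _).trans Set.inter_subset_right)

variable [Countable W] [DiscreteMeasurableSpace W] [Countable G] [DiscreteMeasurableSpace G]

lemma IsCyl.measurableSet {N : ℕ} {E : Set (Ext A G)} (hE : IsCyl N E) : MeasurableSet E :=
  hE.isOpen.measurableSet

lemma measure_inter_fibre_le_of_isCyl (hc : c ≠ ⊤) (hμ' : μ' (fibre A g) < ⊤)
    (h : ∀ (N : ℕ) (E : Set (Ext A G)), IsCyl N E → E ⊆ fibre A g → μ E ≤ c * μ' E)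
    {B : Set (Ext A G)} (hB : MeasurableSet B) :
    μ (B ∩ fibre A g) ≤ c * μ' (B ∩ fibre A g) := by
  have : IsFiniteMeasure (μ'.restrict (fibre A g)) :=
    ⟨by rwa [Measure.restrict_apply_univ]⟩
  rcases eq_or_ne c 0 with rfl | hc₀
  · calc μ (B ∩ fibre A g) ≤ μ (Set.univ ∩ fibre A g) := by gcongr; exact B.subset_univ
      _ ≤ 0 * μ' (Set.univ ∩ fibre A g) := measure_open_inter_fibre_le_of_isCyl isOpen_univ h
      _ = 0 * μ' (B ∩ fibre A g) := by simp
  · rw [← Measure.restrict_apply hB (μ := μ'),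
      Set.measure_eq_iInf_isOpen B (μ'.restrict (fibre A g))]
    simp only [ENNReal.mul_iInf_of_ne hc₀ hc]
    refine le_iInf₂ fun U hBU => le_iInf fun hU => ?_
    rw [Measure.restrict_apply hU.measurableSet]
    exact (measure_mono (Set.inter_subset_inter_left _ hBU)).trans
      (measure_open_inter_fibre_le_of_isCyl hU h)

lemma measure_le_smul_of_isCyl (hc : c ≠ ⊤) (hμ' : ∀ g, μ' (fibre A g) < ⊤)
    (h : ∀ (g : G) (N : ℕ) (E : Set (Ext A G)), IsCyl N E → E ⊆ fibre A g → μ E ≤ c * μ' E) :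
    μ ≤ c • μ' := by
  refine Measure.le_iff.2 fun B hB => ?_
  rw [measure_eq_tsum_fibre μ hB, measure_eq_tsum_fibre (c • μ') hB]
  exact ENNReal.tsum_le_tsum fun g => measure_inter_fibre_le_of_isCyl hc (hμ' g) (h g) hB

end CylinderMeasure

section Integrals

variable {X : Type*} [MeasurableSpace X] {μ μ' : Measure X} {f : X → ℝ}

lemma integral_le_mul_of_le_smul {c : ℝ} (hc : 0 ≤ c) (h : μ ≤ ENNReal.ofReal c • μ')
    (hf : 0 ≤ f) (hfi : Integrable f μ') : ∫ y, f y ∂μ ≤ c * ∫ y, f y ∂μ' := by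
  have hle := integral_mono_measure h (ae_of_all _ hf) (hfi.smul_measure ENNReal.ofReal_ne_top)
  rwa [integral_smul_measure, ENNReal.toReal_ofReal hc, smul_eq_mul] at hle

lemma abs_integral_sub_integral_le_of_nonneg {κ : ℝ} (hκ : 0 ≤ κ)
    (h : μ ≤ ENNReal.ofReal (1 + κ) • μ') (h' : μ' ≤ ENNReal.ofReal (1 + κ) • μ)
    (hf₀ : 0 ≤ f) (hf : Integrable f μ) (hf' : Integrable f μ') :
    |∫ y, f y ∂μ - ∫ y, f y ∂μ'| ≤ κ * ∫ y, f y ∂μ := by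
  rw [abs_sub_comm]
  exact abs_sub_le_mul_of_le hκ (integral_le_mul_of_le_smul (by positivity) h' hf₀ hf)
    (integral_le_mul_of_le_smul (by positivity) h hf₀ hf')

lemma abs_integral_sub_integral_le {κ : ℝ} (hκ : 0 ≤ κ)
    (h : μ ≤ ENNReal.ofReal (1 + κ) • μ') (h' : μ' ≤ ENNReal.ofReal (1 + κ) • μ)
    (hf : Integrable f μ) (hf' : Integrable f μ') :
    |∫ y, f y ∂μ - ∫ y, f y ∂μ'| ≤ κ * ∫ y, |f y| ∂μ := by
  have hpos := abs_integral_sub_integral_le_of_nonneg hκ h h'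
    (fun y => le_max_right (f y) 0) hf.pos_part hf'.pos_part
  have hneg := abs_integral_sub_integral_le_of_nonneg hκ h h'
    (fun y => le_max_right (-f y) 0) hf.neg_part hf'.neg_part
  have habs : ∫ y, |f y| ∂μ = ∫ y, max (f y) 0 ∂μ + ∫ y, max (-f y) 0 ∂μ := by
    rw [← integral_add hf.pos_part hf.neg_part]
    exact integral_congr_ae (ae_of_all _ fun y => by
      simpa only [max_comm (0 : ℝ)] using (max_zero_add_max_neg_zero_eq_abs_self (f y)).symm)
  rw [integral_eq_integral_pos_part_sub_integral_neg_part hf,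
    integral_eq_integral_pos_part_sub_integral_neg_part hf', habs, mul_add, sub_sub_sub_comm]
  exact (abs_sub _ _).trans (add_le_add hpos hneg)

end Integrals

/-! ### Families of limit measures -/

section ApproxMeasure

variable {W G : Type*} [MeasurableSpace W] [MeasurableSingletonClass W]
  [Group G] [MeasurableSpace G] [MeasurableSingletonClass G]
  {A : W → W → Prop} {ψ : W → G} {φ : Chain A → ℝ} {ξ : Chain A} {b : ℕ → ℝ}

lemma lintegral_approxMeasure (t : ℝ) (ζ : Ext A G) (F : Ext A G → ℝ≥0∞) :
    ∫⁻ y, F y ∂(approxMeasure ψ φ ξ b t ζ) = avg ψ φ ξ b t F ζ := by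
  simp only [approxMeasure, lintegral_smul_measure, lintegral_sum_measure, lintegral_dirac,
    smul_eq_mul]
  rfl

lemma setLIntegral_approxMeasure (t : ℝ) (ζ : Ext A G) (g : G) (F : Ext A G → ℝ≥0∞) :
    ∫⁻ y in fibre A g, F y ∂(approxMeasure ψ φ ξ b t ζ) =
      avg ψ φ ξ b t ((fibre A g).indicator F) ζ := by
  rw [← lintegral_indicator (measurableSet_fibre g), lintegral_approxMeasure]

end ApproxMeasure

section ClopenIndicator

variable {X : Type*} [TopologicalSpace X] {E : Set X}

/-- The indicator function of a clopen set, as a bounded continuous test function for weak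
convergence. -/
def clopenIndicator (hE : IsClopen E) : X →ᵇ ℝ≥0 :=
  BoundedContinuousFunction.mkOfBound
    ⟨E.indicator 1, continuous_indicator (by simp [hE]) continuous_const.continuousOn⟩ 1
    fun x y => by
      by_cases hx : x ∈ E <;> by_cases hy : y ∈ E <;> simp [hx, hy, NNReal.dist_eq]

lemma coe_clopenIndicator (hE : IsClopen E) (y : X) :
    ((clopenIndicator hE y : ℝ≥0) : ℝ≥0∞) = E.indicator 1 y := by
  change ((E.indicator 1 y : ℝ≥0) : ℝ≥0∞) = _
  by_cases hy : y ∈ E <;> simp [hy]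

end ClopenIndicator

lemma DecreasesTo.le_zero {s : ℕ → ℝ} {t : ℝ} (hs : DecreasesTo s t) (k : ℕ) : s k ≤ s 0 :=
  hs.anti (Nat.zero_le k)

section FirstLetter

variable {W G : Type*} {A : W → W → Prop}

lemma isCyl_first_letter_mem (S : Set W) (g : G) :
    IsCyl 1 {u : Ext A G | u.1.1 0 ∈ S ∧ u.2 = g} :=
  fun z z' h₂ h hz => ⟨by simpa only [← h 0 one_pos] using hz.1, h₂.symm.trans hz.2⟩

variable [Group G]

lemma finite_preimage_first_letter_mem (ψ : W → G) (ζ : Ext A G) (F : Finset W) :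
    {y : {y : Ext A G // (extMap ψ)^[1] y = ζ} | y.1.1.1 0 ∈ F}.Finite := by
  refine Set.Finite.of_finite_image (f := fun y => y.1.1.1 0)
    (F.finite_toSet.subset (by rintro _ ⟨y, hy, rfl⟩; exact hy)) fun y _ y' _ h => ?_
  have hletter : y.1.1.1 0 = y'.1.1.1 0 := h
  have hfst : y.1.1 = y'.1.1 := by
    refine eq_of_shift_iterate_eq (n := 1) (fun i hi => ?_) ?_
    · obtain rfl : i = 0 := by omega
      exact hletter
    · rw [← extMap_iterate_fst (ψ := ψ), ← extMap_iterate_fst (ψ := ψ), y.2, y'.2]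
  have hsnd : y.1.2 * ψ (y.1.1.1 0) = ζ.2 := congrArg Prod.snd y.2
  have hsnd' : y'.1.2 * ψ (y'.1.1.1 0) = ζ.2 := congrArg Prod.snd y'.2
  rw [← hletter, ← hsnd] at hsnd'
  exact Subtype.ext (Prod.ext hfst (mul_right_cancel hsnd').symm)

lemma exists_ruelle_indicator_first_letter_eq_sum (ψ : W → G) (φ : Chain A → ℝ) (ζ : Ext A G)
    (F : Finset W) :
    ∃ Y : Finset {y : Ext A G // (extMap ψ)^[1] y = ζ}, ∀ H : Ext A G → ℝ≥0∞,
      ruelle ψ φ 1 ({u : Ext A G | u.1.1 0 ∈ F}.indicator H) ζ =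
        ∑ y ∈ Y, ENNReal.ofReal (birkhoffProd φ 1 y.1.1) * H y.1 := by
  have hfin := finite_preimage_first_letter_mem ψ ζ F
  refine ⟨hfin.toFinset, fun H => ?_⟩
  rw [ruelle, tsum_eq_sum (s := hfin.toFinset)]
  · refine Finset.sum_congr rfl fun y hy => ?_
    have hyF : y.1 ∈ {u : Ext A G | u.1.1 0 ∈ F} := hfin.mem_toFinset.1 hy
    rw [Set.indicator_of_mem hyF]
  · intro y hy
    have hyF : y.1 ∉ {u : Ext A G | u.1.1 0 ∈ F} := fun h => hy (hfin.mem_toFinset.2 h)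
    rw [Set.indicator_of_notMem hyF, mul_zero]

end FirstLetter

section Limits

variable {W G : Type*} [Group G] {A : W → W → Prop} {ψ : W → G} {φ : Chain A → ℝ} {ξ : Chain A}
  {b s : ℕ → ℝ} {r C : ℝ} {M : ℝ≥0}

lemma IsRegular.le_mul_of_tendsto (hreg : IsRegular ψ φ ξ b r C M)
    (hs : DecreasesTo s (specRad ψ φ ξ)) {l : Filter ℕ} [l.NeBot] (hl : l ≤ atTop)
    {u v : ℕ → ℝ≥0∞} {p q R K : ℝ≥0∞} (hR : R ≠ ⊤) (hK : K ≠ ⊤)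
    (hu : Tendsto u l (𝓝 p)) (hv : Tendsto v l (𝓝 q))
    (h : ∀ k, u k ≤ (poincareSeries ψ φ ξ b (s k))⁻¹ * R + K * v k) : p ≤ K * q := by
  have hlim := ((hreg.tendsto_inv_poincareSeries_mul hs hR).mono_left hl).add
    (ENNReal.Tendsto.const_mul hv (Or.inr hK))
  rw [zero_add] at hlim
  exact le_of_tendsto_of_tendsto' hu hlim h

lemma IsRegular.avg_fibre_self (hreg : IsRegular ψ φ ξ b r C M) {t : ℝ}
    (ht : specRad ψ φ ξ < t) (g : G) :
    avg ψ φ ξ b t ((fibre A g).indicator 1) (ξ, g) = 1 := by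
  have hpt : ((ξ, g) : Ext A G) = translate g (ξ, 1) := by simp
  have hind : (fun y => ((fibre A g).indicator 1 (translate g y) : ℝ≥0∞)) =
      (fibre A (1 : G)).indicator 1 := by
    classical
    funext y
    simp [Set.indicator_apply, fibre]
  rw [hpt, avg_translate, hind, hreg.avg_fibre_base ht]

end Limits

namespace IsLimitFamily

variable {W G : Type*} [Countable W] [TopologicalSpace W] [DiscreteTopology W]
  [MeasurableSpace W] [DiscreteMeasurableSpace W]
  [Group G] [Countable G] [TopologicalSpace G] [DiscreteTopology G]
  [MeasurableSpace G] [DiscreteMeasurableSpace G]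
  {A : W → W → Prop} {ψ : W → G} {φ : Chain A → ℝ} {ξ : Chain A}
  {b s : ℕ → ℝ} {r C : ℝ} {M : ℝ≥0} {ν : Ext A G → Measure (Ext A G)}
  {N : ℕ} {g : G} {E : Set (Ext A G)}

lemma tendsto_avg (hν : IsLimitFamily ψ φ ξ b s ν) (hE : IsCyl N E) (hEg : E ⊆ fibre A g)
    (ζ : Ext A G) :
    Tendsto (fun k => avg ψ φ ξ b (s k) (E.indicator 1) ζ) atTop (𝓝 (ν ζ E)) := by
  have hconv := hν.conv ζ g (clopenIndicator hE.isClopen)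
  simp only [setLIntegral_approxMeasure, coe_clopenIndicator] at hconv
  rw [lintegral_indicator_one hE.measurableSet, Measure.restrict_apply hE.measurableSet,
    Set.inter_eq_left.2 hEg] at hconv
  have hind : (fibre A g).indicator (fun y => (E.indicator 1 y : ℝ≥0∞)) = E.indicator 1 := by
    rw [show (fun y => (E.indicator 1 y : ℝ≥0∞)) = E.indicator 1 from rfl,
      Set.indicator_indicator, Set.inter_eq_right.2 hEg]
  rwa [hind] at hconv

lemma fibre_lt_top (hν : IsLimitFamily ψ φ ξ b s ν) (hreg : IsRegular ψ φ ξ b r C M)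
    (z : Ext A G) (g : G) : ν z (fibre A g) < ⊤ := by
  obtain ⟨K, hK, h⟩ := hreg.exists_avg_le_mul (s 0) z (ξ, g)
  obtain ⟨R, hR, h⟩ := h 0
  have hbase : Tendsto (fun k => avg ψ φ ξ b (s k) ((fibre A g).indicator 1) (ξ, g)) atTop
      (𝓝 1) := by
    simp only [fun k => hreg.avg_fibre_self (hν.decreases.gt k) g, tendsto_const_nhds]
  have hle := hreg.le_mul_of_tendsto hν.decreases le_rfl hR hK
    (hν.tendsto_avg (isCyl_fibre 0 g) subset_rfl z) hbase fun k =>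
    h (s k) (hν.decreases.gt k).le (hν.decreases.le_zero k) _ (isCyl_fibre 0 g)
  rw [mul_one] at hle
  exact hle.trans_lt hK.lt_top

lemma le_smul_of_avg_le (hν : IsLimitFamily ψ φ ξ b s ν) (hreg : IsRegular ψ φ ξ b r C M)
    {z z' : Ext A G} {K : ℝ≥0∞} (hK : K ≠ ⊤)
    (h : ∀ N, ∃ R : ℝ≥0∞, R ≠ ⊤ ∧ ∀ (k : ℕ) (E : Set (Ext A G)), IsCyl N E →
      avg ψ φ ξ b (s k) (E.indicator 1) z ≤ (poincareSeries ψ φ ξ b (s k))⁻¹ * R +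
        K * avg ψ φ ξ b (s k) (E.indicator 1) z') :
    ν z ≤ K • ν z' := by
  refine measure_le_smul_of_isCyl hK (hν.fibre_lt_top hreg z') fun g N E hE hEg => ?_
  obtain ⟨R, hR, h⟩ := h N
  exact hreg.le_mul_of_tendsto hν.decreases le_rfl hR hK (hν.tendsto_avg hE hEg z)
    (hν.tendsto_avg hE hEg z') fun k => h k E hE

lemma exists_le_smul (hν : IsLimitFamily ψ φ ξ b s ν) (hreg : IsRegular ψ φ ξ b r C M)
    (z z' : Ext A G) : ∃ K : ℝ≥0∞, K ≠ ⊤ ∧ ν z ≤ K • ν z' := by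
  obtain ⟨K, hK, h⟩ := hreg.exists_avg_le_mul (s 0) z z'
  refine ⟨K, hK, hν.le_smul_of_avg_le hreg hK fun N => ?_⟩
  obtain ⟨R, hR, h⟩ := h N
  exact ⟨R, hR, fun k E hE => h (s k) (hν.decreases.gt k).le (hν.decreases.le_zero k) _ hE⟩

lemma le_smul_of_agree (hν : IsLimitFamily ψ φ ξ b s ν) (hreg : IsRegular ψ φ ξ b r C M)
    {k : ℕ} (hk : 1 ≤ k) {x x' : Chain A} (hag : ∀ i < k, x.1 i = x'.1 i) (e : G) :
    ν (x, e) ≤ ENNReal.ofReal (Real.exp (C * r ^ k)) • ν (x', e) := by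
  refine hν.le_smul_of_avg_le hreg ENNReal.ofReal_ne_top fun N => ?_
  obtain ⟨R, hR, h⟩ := hreg.exists_avg_le_of_agree N
  exact ⟨R, hR, fun j E hE => h (s j) (hν.decreases.gt j).le E hE k x x' e hk hag⟩

/-! ### Invariance under the dual Ruelle operator -/

lemma tendsto_finset_sum (hν : IsLimitFamily ψ φ ξ b s ν) (hE : IsCyl N E)
    (hEg : E ⊆ fibre A g) {ζ : Ext A G} (Y : Finset {y : Ext A G // (extMap ψ)^[1] y = ζ}) :
    Tendsto (fun k => ∑ y ∈ Y, ENNReal.ofReal (birkhoffProd φ 1 y.1.1) *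
      avg ψ φ ξ b (s k) (E.indicator 1) y.1) atTop
      (𝓝 (∑ y ∈ Y, ENNReal.ofReal (birkhoffProd φ 1 y.1.1) * ν y.1 E)) :=
  tendsto_finsetSum _ fun y _ => ENNReal.Tendsto.const_mul (hν.tendsto_avg hE hEg y.1)
    (Or.inr ENNReal.ofReal_ne_top)

lemma tendsto_ofReal_mul_avg (hν : IsLimitFamily ψ φ ξ b s ν) (hρ : 0 < specRad ψ φ ξ)
    (hE : IsCyl N E) (hEg : E ⊆ fibre A g) (ζ : Ext A G) :
    Tendsto (fun k => ENNReal.ofReal (s k) * avg ψ φ ξ b (s k) (E.indicator 1) ζ) atTop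
      (𝓝 (ENNReal.ofReal (specRad ψ φ ξ) * ν ζ E)) :=
  ENNReal.Tendsto.mul (ENNReal.tendsto_ofReal hν.decreases.lim)
    (Or.inl (ENNReal.ofReal_pos.2 hρ).ne') (hν.tendsto_avg hE hEg ζ)
    (Or.inr ENNReal.ofReal_ne_top)

lemma ruelle_measure_le (hν : IsLimitFamily ψ φ ξ b s ν) (hreg : IsRegular ψ φ ξ b r C M)
    (hE : IsCyl N E) (hEg : E ⊆ fibre A g) (ζ : Ext A G) :
    ruelle ψ φ 1 (fun y => ν y E) ζ ≤ ENNReal.ofReal (specRad ψ φ ξ) * ν ζ E := by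
  rw [ruelle, ENNReal.tsum_eq_iSup_sum]
  refine iSup_le fun Y => le_of_tendsto_of_tendsto' (hν.tendsto_finset_sum hE hEg Y)
    (hν.tendsto_ofReal_mul_avg hreg.specRad_pos hE hEg ζ) fun k => ?_
  have hs := hreg.specRad_pos.trans (hν.decreases.gt k)
  refine (ENNReal.sum_le_tsum Y).trans ?_
  simpa only [ruelle, pow_one] using ruelle_avg_le hreg.pos hreg.weight.mono hs 1 (E.indicator 1) ζ

lemma tendsto_measure_first_letter_notMem (hν : IsLimitFamily ψ φ ξ b s ν)
    (hreg : IsRegular ψ φ ξ b r C M) (z : Ext A G) (g : G) :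
    Tendsto (fun F : Finset W => ν z {u : Ext A G | u.1.1 0 ∈ (F : Set W)ᶜ ∧ u.2 = g})
      atTop (𝓝 0) := by
  let B (w : W) : Set (Ext A G) := {u | u.1.1 0 ∈ ({w} : Set W) ∧ u.2 = g}
  have hfin : ∑' w, ν z (B w) ≠ ⊤ := by
    rw [← measure_iUnion _ fun w => (isCyl_first_letter_mem {w} g).measurableSet]
    · refine ((measure_mono ?_).trans_lt (hν.fibre_lt_top hreg z g)).ne
      exact Set.iUnion_subset fun w u hu => hu.2
    · intro w w' hne
      exact Set.disjoint_left.2 fun u hu hu' => hne (hu.1.symm.trans hu'.1)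
  refine tendsto_of_tendsto_of_tendsto_of_le_of_le tendsto_const_nhds
    (ENNReal.tendsto_tsum_compl_atTop_zero hfin) (fun _ => zero_le) fun F => ?_
  refine (measure_mono ?_).trans (measure_iUnion_le fun w : {w // w ∉ F} => B w.1)
  exact fun u hu => Set.mem_iUnion.2 ⟨⟨u.1.1 0, by simpa using hu.1⟩, rfl, hu.2⟩

lemma exists_mul_measure_le_mul_ruelle_add (hν : IsLimitFamily ψ φ ξ b s ν)
    (hreg : IsRegular ψ φ ξ b r C M) (hE : IsCyl N E) (hEg : E ⊆ fibre A g) (ζ : Ext A G) :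
    ∃ K : ℝ≥0∞, K ≠ ⊤ ∧ ∀ c : ℝ, 1 < c → ∀ F : Finset W,
      ENNReal.ofReal (specRad ψ φ ξ) * ν ζ E ≤ ENNReal.ofReal c *
        (ruelle ψ φ 1 (fun y => ν y E) ζ +
          K * ν (ξ, 1) {u : Ext A G | u.1.1 0 ∈ (F : Set W)ᶜ ∧ u.2 = 1}) := by
  obtain ⟨K, hK, h⟩ := hreg.exists_mul_avg_le_ruelle_indicator (s 0) ζ g
  refine ⟨K, hK, fun c hc F => ?_⟩
  obtain ⟨R, hR, h⟩ := h c hc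
  obtain ⟨Y, hY⟩ := exists_ruelle_indicator_first_letter_eq_sum ψ φ ζ F
  have hk := fun k => h (s k) (hν.decreases.gt k).le (hν.decreases.le_zero k) E hEg (F : Set W)ᶜ
  simp only [Set.notMem_compl_iff, Finset.mem_coe, hY] at hk
  have htail := hν.tendsto_avg (isCyl_first_letter_mem (F : Set W)ᶜ 1) (fun u hu => hu.2) (ξ, 1)
  have hlim := (hν.tendsto_finset_sum hE hEg Y).add (ENNReal.Tendsto.const_mul htail (Or.inr hK))
  refine (hreg.le_mul_of_tendsto hν.decreases le_rfl hR ENNReal.ofReal_ne_top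
    (hν.tendsto_ofReal_mul_avg hreg.specRad_pos hE hEg ζ) hlim hk).trans ?_
  gcongr
  exact ENNReal.sum_le_tsum Y

lemma le_ruelle_measure (hν : IsLimitFamily ψ φ ξ b s ν) (hreg : IsRegular ψ φ ξ b r C M)
    (hE : IsCyl N E) (hEg : E ⊆ fibre A g) (ζ : Ext A G) :
    ENNReal.ofReal (specRad ψ φ ξ) * ν ζ E ≤ ruelle ψ φ 1 (fun y => ν y E) ζ := by
  obtain ⟨K, hK, h⟩ := hν.exists_mul_measure_le_mul_ruelle_add hreg hE hEg ζ
  have hle (c : ℝ) (hc : 1 < c) : ENNReal.ofReal (specRad ψ φ ξ) * ν ζ E ≤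
      ENNReal.ofReal c * ruelle ψ φ 1 (fun y => ν y E) ζ := by
    have htail := ENNReal.Tendsto.const_mul (hν.tendsto_measure_first_letter_notMem hreg (ξ, 1) 1)
      (Or.inr hK)
    have hlim := ENNReal.Tendsto.const_mul
      (htail.const_add (ruelle ψ φ 1 (fun y => ν y E) ζ))
      (Or.inr (ENNReal.ofReal_ne_top (r := c)))
    rw [mul_zero, add_zero] at hlim
    exact ge_of_tendsto' hlim (h c hc)
  have hlim : Tendsto (fun c : ℝ => ENNReal.ofReal c * ruelle ψ φ 1 (fun y => ν y E) ζ)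
      (𝓝[>] 1) (𝓝 (ENNReal.ofReal 1 * ruelle ψ φ 1 (fun y => ν y E) ζ)) :=
    ENNReal.Tendsto.mul_const (ENNReal.tendsto_ofReal (tendsto_id.mono_left nhdsWithin_le_nhds))
      (Or.inl (by simp))
  rw [ENNReal.ofReal_one, one_mul] at hlim
  exact ge_of_tendsto hlim (eventually_nhdsWithin_of_forall hle)

lemma sum_smul_eq_smul (hν : IsLimitFamily ψ φ ξ b s ν) (hreg : IsRegular ψ φ ξ b r C M)
    (ζ : Ext A G) :
    Measure.sum (fun y : {y : Ext A G // extMap ψ y = ζ} => ENNReal.ofReal (φ y.1.1) • ν y.1) =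
      ENNReal.ofReal (specRad ψ φ ξ) • ν ζ := by
  have happly (B : Set (Ext A G)) (hB : MeasurableSet B) :
      Measure.sum (fun y : {y : Ext A G // extMap ψ y = ζ} =>
        ENNReal.ofReal (φ y.1.1) • ν y.1) B = ruelle ψ φ 1 (fun y => ν y B) ζ := by
    rw [Measure.sum_apply _ hB]
    simp only [ruelle, birkhoffProd_one, Measure.smul_apply, smul_eq_mul]
    rfl
  have hfin (g : G) : (ENNReal.ofReal (specRad ψ φ ξ) • ν ζ) (fibre A g) < ⊤ := by
    rw [Measure.smul_apply, smul_eq_mul]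
    exact ENNReal.mul_lt_top ENNReal.ofReal_lt_top (hν.fibre_lt_top hreg ζ g)
  refine le_antisymm ?_ ?_
  · rw [← one_smul ℝ≥0∞ (ENNReal.ofReal (specRad ψ φ ξ) • ν ζ)]
    refine measure_le_smul_of_isCyl ENNReal.one_ne_top hfin fun g N E hE hEg => ?_
    rw [happly E hE.measurableSet, one_mul, Measure.smul_apply, smul_eq_mul]
    exact hν.ruelle_measure_le hreg hE hEg ζ
  · rw [← one_smul ℝ≥0∞ (Measure.sum _)]
    refine measure_le_smul_of_isCyl ENNReal.one_ne_top (fun g => ?_) fun g N E hE hEg => ?_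
    · rw [happly _ (measurableSet_fibre g)]
      exact (hν.ruelle_measure_le hreg (isCyl_fibre 0 g) subset_rfl ζ).trans_lt (hfin g)
    · rw [happly E hE.measurableSet, one_mul, Measure.smul_apply, smul_eq_mul]
      exact hν.le_ruelle_measure hreg hE hEg ζ

lemma isHarmonic_integral (hν : IsLimitFamily ψ φ ξ b s ν) (hreg : IsRegular ψ φ ξ b r C M)
    {f : Ext A G → ℝ} (hf : ∀ z, Integrable f (ν z)) :
    IsHarmonic ψ φ (specRad ψ φ ξ) fun z => ∫ y, f y ∂(ν z) := by
  intro ζ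
  have hint : Integrable f (Measure.sum (fun y : {y : Ext A G // extMap ψ y = ζ} =>
      ENNReal.ofReal (φ y.1.1) • ν y.1)) := by
    rw [hν.sum_smul_eq_smul hreg ζ]
    exact (hf ζ).smul_measure ENNReal.ofReal_ne_top
  have hsum := hasSum_integral_measure hint
  rw [hν.sum_smul_eq_smul hreg ζ] at hsum
  simpa only [integral_smul_measure, ENNReal.toReal_ofReal (hreg.pos _).le,
    ENNReal.toReal_ofReal hreg.specRad_pos.le, smul_eq_mul] using hsum

/-! ### Regularity of the integrals -/

lemma le_smul_of_dShift_lt_one (hν : IsLimitFamily ψ φ ξ b s ν)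
    (hreg : IsRegular ψ φ ξ b r C M) {x x' : Chain A} (e : G) (hne : x ≠ x')
    (hd : dShift r x x' < 1) :
    ν (x, e) ≤ ENNReal.ofReal (1 + C * Real.exp C * dShift r x x') • ν (x', e) := by
  obtain ⟨k, hk, hag, hdk⟩ := exists_agree_of_dShift_lt_one hne hd
  have hexp : Real.exp (C * r ^ k) ≤ 1 + C * Real.exp C * r ^ k :=
    exp_mul_le_one_add_mul (pow_nonneg hreg.r_pos.le k)
      (pow_le_one₀ hreg.r_pos.le hreg.r_lt_one.le) hreg.dist.nonneg
  rw [hdk]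
  refine (hν.le_smul_of_agree hreg hk hag e).trans (Measure.le_iff.2 fun B _ => ?_)
  exact mul_le_mul' (ENNReal.ofReal_le_ofReal hexp) le_rfl

lemma integral_mem_harmonicPos (hν : IsLimitFamily ψ φ ξ b s ν) (hreg : IsRegular ψ φ ξ b r C M)
    {f : Ext A G → ℝ} (hf₀ : 0 ≤ f) (hf : ∀ z, Integrable f (ν z)) :
    (fun z => ∫ y, f y ∂(ν z)) ∈ harmonicPos ψ φ r ξ := by
  have hC := hreg.dist.nonneg
  refine ⟨fun z => integral_nonneg hf₀, hν.isHarmonic_integral hreg hf, ?_⟩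
  refine (logLip_le_of_le_mul hreg.r_pos (C := C * Real.exp C) (fun z => integral_nonneg hf₀)
    (by positivity) fun x x' e hne hd => ?_).trans_lt ENNReal.ofReal_lt_top
  have hd₀ := dShift_pos hreg.r_pos hne
  exact integral_le_mul_of_le_smul (by positivity) (hν.le_smul_of_dShift_lt_one hreg e hne hd)
    hf₀ (hf _)

lemma locLip_integral_le (hν : IsLimitFamily ψ φ ξ b s ν) (hreg : IsRegular ψ φ ξ b r C M)
    {f : Ext A G → ℝ} (hf : ∀ z, Integrable f (ν z)) (z : Ext A G) :
    locLip r (fun z => ∫ y, f y ∂(ν z)) z ≤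
      ENNReal.ofReal (C * Real.exp C * ∫ y, |f y| ∂(ν z)) := by
  obtain ⟨x, e⟩ := z
  have hC := hreg.dist.nonneg
  have : 0 ≤ ∫ y, |f y| ∂(ν (x, e)) := integral_nonneg fun _ => abs_nonneg _
  simp only [locLip, iSup_le_iff]
  rintro ⟨x', e'⟩ hd
  obtain rfl : e = e' := snd_eq_of_dExt_lt_one hd
  rw [dExt_of_snd_eq (z₁ := (x, e)) (z₂ := (x', e)) rfl] at hd ⊢
  rcases eq_or_ne x x' with rfl | hne
  · simp
  have hd₀ := dShift_pos hreg.r_pos hne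
  have hle' := hν.le_smul_of_dShift_lt_one hreg e hne.symm (by rwa [dShift_comm])
  rw [dShift_comm] at hle'
  refine ENNReal.div_le_of_le_mul ?_
  rw [← ENNReal.ofReal_mul (by positivity), mul_right_comm]
  exact ENNReal.ofReal_le_ofReal (abs_integral_sub_integral_le (by positivity)
    (hν.le_smul_of_dShift_lt_one hreg e hne hd) hle' (hf _) (hf _))

lemma integral_mem_harmonicLip (hν : IsLimitFamily ψ φ ξ b s ν) (hreg : IsRegular ψ φ ξ b r C M)
    {f : Ext A G → ℝ} (hf : ∀ z, Integrable f (ν z)) :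
    (fun z => ∫ y, f y ∂(ν z)) ∈ harmonicLip ψ φ r ξ := by
  have hC := hreg.dist.nonneg
  refine ⟨hν.isHarmonic_integral hreg hf, fun z => ∫ y, C * Real.exp C * |f y| ∂(ν z),
    hν.integral_mem_harmonicPos hreg (fun y => by positivity) fun z => (hf z).abs.const_mul _, ?_⟩
  simpa only [integral_const_mul] using hν.locLip_integral_le hreg hf

end IsLimitFamily

/-! ### The operator `Θ` -/

lemma continuous_of_mem_logUnifCont {W G : Type*} [TopologicalSpace W] [DiscreteTopology W]
    [MeasurableSpace W] [TopologicalSpace G] [DiscreteTopology G] [MeasurableSpace G]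
    {A : W → W → Prop} {μ : Measure (Ext A G)} {f : Ext A G → ℝ} (hf : f ∈ logUnifCont μ) :
    Continuous f := by
  refine continuous_iff_continuousAt.2 fun z => Metric.tendsto_nhds.2 fun ε hε => ?_
  have hδ : 0 < ENNReal.ofReal (ε / (|f z| + 1)) := ENNReal.ofReal_pos.2 (by positivity)
  obtain ⟨n, hn⟩ := (hf.2.eventually (gt_mem_nhds hδ)).exists
  rw [oscConst, sInf_lt_iff] at hn
  obtain ⟨c, hc, hcδ⟩ := hn
  filter_upwards [eventually_nhds_agree n z] with z' ⟨hfibre, hag⟩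
  have hosc : ENNReal.ofReal |f z - f z'| ≤ ENNReal.ofReal (ε / (|f z| + 1) * |f z|) := by
    rw [ENNReal.ofReal_mul (by positivity)]
    exact (hc z z' hfibre hag).trans (mul_le_mul' hcδ.le le_rfl)
  rw [ENNReal.ofReal_le_ofReal_iff (by positivity)] at hosc
  rw [Real.dist_eq, abs_sub_comm]
  refine hosc.trans_lt ?_
  rw [div_mul_eq_mul_div, div_lt_iff₀ (by positivity)]
  nlinarith [abs_nonneg (f z)]

namespace IsLimitFamily

variable {W G : Type*} [Countable W] [TopologicalSpace W] [DiscreteTopology W]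
  [MeasurableSpace W] [DiscreteMeasurableSpace W]
  [Group G] [Countable G] [TopologicalSpace G] [DiscreteTopology G]
  [MeasurableSpace G] [DiscreteMeasurableSpace G]
  {A : W → W → Prop} {ψ : W → G} {φ : Chain A → ℝ} {ξ : Chain A}
  {b s : ℕ → ℝ} {r C : ℝ} {M : ℝ≥0} {ν : Ext A G → Measure (Ext A G)} {f : Ext A G → ℝ}

lemma integrable_of_mem_logUnifCont (hν : IsLimitFamily ψ φ ξ b s ν)
    (hreg : IsRegular ψ φ ξ b r C M) {o : Ext A G} (hf : f ∈ logUnifCont (ν o)) (z : Ext A G) :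
    Integrable f (ν z) := by
  have ho : Integrable f (ν o) :=
    ⟨(continuous_of_mem_logUnifCont hf).aestronglyMeasurable,
      (hasFiniteIntegral_iff_norm f).2 hf.1⟩
  obtain ⟨K, hK, hle⟩ := hν.exists_le_smul hreg z o
  exact (ho.smul_measure hK).mono_measure hle

lemma absolutelyContinuous (hν : IsLimitFamily ψ φ ξ b s ν) (hreg : IsRegular ψ φ ξ b r C M)
    (z o : Ext A G) : ν z ≪ ν o := by
  obtain ⟨K, -, hle⟩ := hν.exists_le_smul hreg z o
  exact (Measure.absolutelyContinuous_of_le hle).trans Measure.smul_absolutelyContinuous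

lemma integrable_martinKernel_mul (hν : IsLimitFamily ψ φ ξ b s ν)
    (hreg : IsRegular ψ φ ξ b r C M) (o : Ext A G) {z : Ext A G} (hf : Integrable f (ν z)) :
    Integrable (fun y => martinKernel ν o z y * f y) (ν o) := by
  have := sigmaFinite_of_fibre_lt_top (hν.fibre_lt_top hreg z)
  have := sigmaFinite_of_fibre_lt_top (hν.fibre_lt_top hreg o)
  exact (integrable_toReal_rnDeriv_mul_iff (hν.absolutelyContinuous hreg z o)).2 hf

lemma theta_eq_integral (hν : IsLimitFamily ψ φ ξ b s ν) (hreg : IsRegular ψ φ ξ b r C M)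
    (o z : Ext A G) (f : Ext A G → ℝ) : Theta ν o f z = ∫ y, f y ∂(ν z) := by
  have := sigmaFinite_of_fibre_lt_top (hν.fibre_lt_top hreg z)
  have := sigmaFinite_of_fibre_lt_top (hν.fibre_lt_top hreg o)
  exact integral_toReal_rnDeriv_mul (hν.absolutelyContinuous hreg z o)

end IsLimitFamily

/-! ### Weak convergence from convergence on cylinders -/

section WeakConvergence

lemma tendsto_of_tendsto_add_of_le_liminf {u v : ℕ → ℝ≥0∞} {a c : ℝ≥0∞} (hac : a + c ≠ ⊤)
    (huv : Tendsto (fun k => u k + v k) atTop (𝓝 (a + c)))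
    (hu : a ≤ liminf u atTop) (hv : c ≤ liminf v atTop) : Tendsto u atTop (𝓝 a) := by
  refine tendsto_iff_ultrafilter _ _ _ |>.2 fun 𝒰 h𝒰 => ?_
  obtain ⟨a', ha'⟩ : ∃ a', Tendsto u 𝒰 (𝓝 a') := ⟨_, (𝒰.map u).le_nhds_lim⟩
  obtain ⟨c', hc'⟩ : ∃ c', Tendsto v 𝒰 (𝓝 c') := ⟨_, (𝒰.map v).le_nhds_lim⟩
  have hle : a ≤ a' := ha'.liminf_eq ▸ hu.trans (liminf_le_liminf_of_le h𝒰)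
  have hle' : c ≤ c' := hc'.liminf_eq ▸ hv.trans (liminf_le_liminf_of_le h𝒰)
  have hsum : a' + c' = a + c := tendsto_nhds_unique (ha'.add hc') (huv.mono_left h𝒰)
  have hge : a' + c ≤ a + c := hsum ▸ add_le_add le_rfl hle'
  rwa [le_antisymm ((ENNReal.add_le_add_iff_right (ENNReal.add_ne_top.1 hac).2).1 hge) hle]
    at ha'

variable {X : Type*} [TopologicalSpace X] [MeasurableSpace X] [OpensMeasurableSpace X]
  {m : ℕ → Measure X} {μ : Measure X}

lemma lintegral_le_liminf_of_forall_isOpen_le_liminf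
    (h : ∀ U, IsOpen U → μ U ≤ liminf (fun k => m k U) atTop) {u : X → ℝ≥0}
    (hu : Continuous u) : ∫⁻ y, u y ∂μ ≤ liminf (fun k => ∫⁻ y, u y ∂(m k)) atTop := by
  simpa only [Function.comp_apply, ENNReal.ofReal_coe_nnreal] using
    lintegral_le_liminf_lintegral_of_forall_isOpen_measure_le_liminf_measure
      (NNReal.continuous_coe.comp hu) (fun y => (u y).2) h

/- The lower bound of the portmanteau theorem, applied to `f` and to `‖f‖ - f`. -/
lemma tendsto_lintegral_of_forall_isOpen_le_liminf [IsFiniteMeasure μ]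
    (huniv : Tendsto (fun k => m k Set.univ) atTop (𝓝 (μ Set.univ)))
    (h : ∀ U, IsOpen U → μ U ≤ liminf (fun k => m k U) atTop) (f : X →ᵇ ℝ≥0) :
    Tendsto (fun k => ∫⁻ y, f y ∂(m k)) atTop (𝓝 (∫⁻ y, f y ∂μ)) := by
  set B : ℝ≥0 := nndist f 0
  have hadd (μ' : Measure X) :
      ∫⁻ y, f y ∂μ' + ∫⁻ y, ((B - f y : ℝ≥0) : ℝ≥0∞) ∂μ' = B * μ' Set.univ := by
    rw [← lintegral_add_left f.continuous.measurable.coe_nnreal_ennreal, ← lintegral_const]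
    congr with y
    rw [← ENNReal.coe_add,
      add_tsub_cancel_of_le (BoundedContinuousFunction.NNReal.upper_bound f y)]
  refine tendsto_of_tendsto_add_of_le_liminf (c := ∫⁻ y, ((B - f y : ℝ≥0) : ℝ≥0∞) ∂μ) ?_ ?_
    (lintegral_le_liminf_of_forall_isOpen_le_liminf h f.continuous)
    (lintegral_le_liminf_of_forall_isOpen_le_liminf h (continuous_const.sub f.continuous))
  · rw [hadd]
    exact ENNReal.mul_ne_top ENNReal.coe_ne_top (measure_ne_top μ _)
  · simp only [hadd]
    exact ENNReal.Tendsto.const_mul huniv (Or.inr ENNReal.coe_ne_top)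

end WeakConvergence

section WordCylinders

variable {W G : Type*} {A : W → W → Prop} {g : G}

/-- The cylinder of the points of `X_g` whose first letters are those of the word `w`, as a set
in the disjoint union over all lengths `N` of the words of length `N`. -/
def wordCyl (A : W → W → Prop) (g : G) (w : Σ N : ℕ, Fin N → W) : Set (Ext A G) :=
  {z | z.2 = g ∧ ∀ i : Fin w.1, z.1.1 i = w.2 i}

lemma isCyl_wordCyl (g : G) (w : Σ N : ℕ, Fin N → W) : IsCyl w.1 (wordCyl A g w) :=
  fun _ _ h₂ h hz => ⟨h₂.symm.trans hz.1, fun i => (h i i.2).symm.trans (hz.2 i)⟩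

lemma wordCyl_subset_fibre (g : G) (w : Σ N : ℕ, Fin N → W) : wordCyl A g w ⊆ fibre A g :=
  fun _ hz => hz.1

lemma wordCyl_zero (g : G) (w : Fin 0 → W) : wordCyl A g ⟨0, w⟩ = fibre A g :=
  subset_antisymm (wordCyl_subset_fibre g _) fun _ hz => ⟨hz, fun i => i.elim0⟩

lemma IsCyl.inter_wordCyl_eq_or_eq_empty {N : ℕ} {E : Set (Ext A G)} (hE : IsCyl N E)
    (g : G) (w : Fin N → W) :
    E ∩ wordCyl A g ⟨N, w⟩ = wordCyl A g ⟨N, w⟩ ∨ E ∩ wordCyl A g ⟨N, w⟩ = ∅ := by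
  rcases (E ∩ wordCyl A g ⟨N, w⟩).eq_empty_or_nonempty with hempty | ⟨z, hzE, hz⟩
  · exact Or.inr hempty
  · refine Or.inl (Set.inter_eq_right.2 fun z' hz' => hE z z' (hz.1.trans hz'.1.symm) ?_ hzE)
    exact fun i hi => (hz.2 ⟨i, hi⟩).trans (hz'.2 ⟨i, hi⟩).symm

variable [Countable W] [TopologicalSpace W] [DiscreteTopology W]
  [MeasurableSpace W] [DiscreteMeasurableSpace W]
  [Countable G] [TopologicalSpace G] [DiscreteTopology G]
  [MeasurableSpace G] [DiscreteMeasurableSpace G]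
  {m : ℕ → Measure (Ext A G)} {μ : Measure (Ext A G)} {N : ℕ} {E : Set (Ext A G)}

lemma IsCyl.measure_eq_tsum_wordCyl (hE : IsCyl N E) (hEg : E ⊆ fibre A g)
    (μ : Measure (Ext A G)) : μ E = ∑' w : Fin N → W, μ (E ∩ wordCyl A g ⟨N, w⟩) := by
  rw [← measure_iUnion _ fun w => hE.measurableSet.inter (isCyl_wordCyl g _).measurableSet]
  · congr 1
    refine subset_antisymm (fun z hz => ?_) (Set.iUnion_subset fun _ => Set.inter_subset_left)
    exact Set.mem_iUnion.2 ⟨fun i => z.1.1 i, hz, hEg hz, fun _ => rfl⟩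
  · refine fun w w' hne => Set.disjoint_left.2 fun z hz hz' => hne (funext fun i => ?_)
    exact (hz.2.2 i).symm.trans (hz'.2.2 i)

lemma IsCyl.measure_le_liminf
    (h : ∀ w, Tendsto (fun k => m k (wordCyl A g w)) atTop (𝓝 (μ (wordCyl A g w))))
    (hE : IsCyl N E) (hEg : E ⊆ fibre A g) : μ E ≤ liminf (fun k => m k E) atTop := by
  have hlim (w : Fin N → W) : Tendsto (fun k => m k (E ∩ wordCyl A g ⟨N, w⟩)) atTop
      (𝓝 (μ (E ∩ wordCyl A g ⟨N, w⟩))) := by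
    rcases hE.inter_wordCyl_eq_or_eq_empty g w with heq | heq
    · simpa only [heq] using h ⟨N, w⟩
    · simp only [heq, measure_empty, tendsto_const_nhds]
  rw [hE.measure_eq_tsum_wordCyl hEg μ, ENNReal.tsum_eq_iSup_sum]
  refine iSup_le fun Y => ?_
  rw [← (tendsto_finsetSum Y fun w _ => hlim w).liminf_eq]
  refine liminf_le_liminf (Eventually.of_forall fun k => ?_)
  rw [hE.measure_eq_tsum_wordCyl hEg (m k)]
  exact ENNReal.sum_le_tsum Y

lemma restrict_fibre_le_liminf_of_isOpen
    (h : ∀ w, Tendsto (fun k => m k (wordCyl A g w)) atTop (𝓝 (μ (wordCyl A g w))))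
    {U : Set (Ext A G)} (hU : IsOpen U) :
    μ.restrict (fibre A g) U ≤ liminf (fun k => (m k).restrict (fibre A g) U) atTop := by
  simp only [Measure.restrict_apply hU.measurableSet]
  conv_lhs => rw [← iUnion_cylInterior (hU.inter (isCyl_fibre 0 g).isOpen)]
  rw [(monotone_cylInterior _).measure_iUnion]
  refine iSup_le fun N => ((isCyl_cylInterior N _).measure_le_liminf h
    ((cylInterior_subset N _).trans Set.inter_subset_right)).trans ?_
  exact liminf_le_liminf (Eventually.of_forall fun k => measure_mono (cylInterior_subset N _))

lemma tendsto_setLIntegral_fibre_of_wordCyl (hμ : μ (fibre A g) ≠ ⊤)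
    (h : ∀ w, Tendsto (fun k => m k (wordCyl A g w)) atTop (𝓝 (μ (wordCyl A g w))))
    (f : Ext A G →ᵇ ℝ≥0) :
    Tendsto (fun k => ∫⁻ y in fibre A g, f y ∂(m k)) atTop
      (𝓝 (∫⁻ y in fibre A g, f y ∂μ)) := by
  have : IsFiniteMeasure (μ.restrict (fibre A g)) :=
    ⟨by rwa [Measure.restrict_apply_univ, lt_top_iff_ne_top]⟩
  refine tendsto_lintegral_of_forall_isOpen_le_liminf ?_
    (fun U hU => restrict_fibre_le_liminf_of_isOpen h hU) f
  simpa only [Measure.restrict_apply_univ, wordCyl_zero] using h ⟨0, Fin.elim0⟩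

end WordCylinders

/-! ### Extension of contents on cylinders -/

section Content

variable {W G : Type*} {A : W → W → Prop}

lemma isSetRing_isCyl : IsSetRing {E : Set (Ext A G) | ∃ N, IsCyl N E} where
  empty_mem := ⟨0, fun _ _ _ _ hz => hz⟩
  union_mem := by
    rintro E F ⟨N, hE⟩ ⟨N', hF⟩
    exact ⟨max N N', (hE.mono (le_max_left _ _)).union (hF.mono (le_max_right _ _))⟩
  sdiff_mem := by
    rintro E F ⟨N, hE⟩ ⟨N', hF⟩
    exact ⟨max N N', (hE.mono (le_max_left _ _)).inter (hF.mono (le_max_right _ _)).compl⟩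

variable [Countable W] [TopologicalSpace W] [DiscreteTopology W]
  [MeasurableSpace W] [DiscreteMeasurableSpace W]
  [Countable G] [TopologicalSpace G] [DiscreteTopology G]
  [MeasurableSpace G] [DiscreteMeasurableSpace G]

lemma generateFrom_isCyl :
    (inferInstance : MeasurableSpace (Ext A G)) =
      MeasurableSpace.generateFrom {E : Set (Ext A G) | ∃ N, IsCyl N E} := by
  refine le_antisymm ?_ (MeasurableSpace.generateFrom_le fun F ⟨_, hF⟩ => hF.measurableSet)
  rw [BorelSpace.measurable_eq (α := Ext A G)]
  refine MeasurableSpace.generateFrom_le fun U hU => ?_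
  rw [← iUnion_cylInterior hU]
  exact MeasurableSet.iUnion fun N =>
    MeasurableSpace.measurableSet_generateFrom ⟨N, isCyl_cylInterior N U⟩

/- Domination by a finite measure makes the content continuous at `∅`, hence `σ`-additive. -/
lemma isSigmaSubadditive_of_le_mul_measure {μ : Measure (Ext A G)} [IsFiniteMeasure μ]
    {K : ℝ≥0∞} (hK : K ≠ ⊤) {m : AddContent ℝ≥0∞ {E : Set (Ext A G) | ∃ N, IsCyl N E}}
    (hle : ∀ N E, IsCyl N E → m E ≤ K * μ E) : m.IsSigmaSubadditive := by
  refine isSigmaSubadditive_of_addContent_iUnion_eq_tsum isSetRing_isCyl fun f hf hUf hd =>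
    addContent_iUnion_eq_sum_of_tendsto_zero isSetRing_isCyl m ?_ ?_ hf hUf hd
  · rintro E ⟨N, hE⟩
    exact ne_top_of_le_ne_top (ENNReal.mul_ne_top hK (measure_ne_top μ E)) (hle N E hE)
  · intro E hE hanti hempty
    have hμ : Tendsto (fun n => μ (E n)) atTop (𝓝 0) := by
      have := tendsto_measure_iInter_atTop (μ := μ) (s := E)
        (fun n => (hE n).choose_spec.measurableSet.nullMeasurableSet) hanti
        ⟨0, measure_ne_top μ _⟩
      rwa [hempty, measure_empty] at this
    have hKμ := ENNReal.Tendsto.const_mul hμ (Or.inr hK)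
    rw [mul_zero] at hKμ
    exact tendsto_of_tendsto_of_tendsto_of_le_of_le tendsto_const_nhds hKμ (fun _ => zero_le)
      fun n => hle _ _ (hE n).choose_spec

lemma exists_measure_of_le_mul_measure {μ : Measure (Ext A G)} [IsFiniteMeasure μ] {K : ℝ≥0∞}
    (hK : K ≠ ⊤) {L : Set (Ext A G) → ℝ≥0∞} (hempty : L ∅ = 0)
    (hadd : ∀ E F, Disjoint E F → L (E ∪ F) = L E + L F)
    (hle : ∀ N E, IsCyl N E → L E ≤ K * μ E) :
    ∃ ν : Measure (Ext A G), ∀ N E, IsCyl N E → ν E = L E := by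
  let m : AddContent ℝ≥0∞ {E : Set (Ext A G) | ∃ N, IsCyl N E} :=
    isSetRing_isCyl.addContent_of_union L hempty fun _ _ hd => hadd _ _ hd
  have hm : m.IsSigmaSubadditive := isSigmaSubadditive_of_le_mul_measure hK hle
  exact ⟨m.measure isSetRing_isCyl.isSetSemiring generateFrom_isCyl.le hm, fun N E hE =>
    AddContent.measure_eq m isSetRing_isCyl.isSetSemiring generateFrom_isCyl hm ⟨N, hE⟩⟩

end Content

/-! ### Existence of the limit measures -/

section Translate

variable {W G : Type*} [Group G] {A : W → W → Prop}

lemma measurable_translate [MeasurableSpace W] [Countable G] [MeasurableSpace G]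
    [DiscreteMeasurableSpace G] (g : G) : Measurable (translate g : Ext A G → Ext A G) :=
  measurable_fst.prodMk ((measurable_of_countable fun h : G => g * h).comp measurable_snd)

lemma IsCyl.preimage_translate {N : ℕ} {E : Set (Ext A G)} (hE : IsCyl N E) (g : G) :
    IsCyl N (translate g ⁻¹' E) :=
  fun z z' h₂ h hz => hE (translate g z) (translate g z') (congrArg (g * ·) h₂) h hz

lemma indicator_inter_fibre_translate (E : Set (Ext A G)) (g : G) (y : Ext A G) :
    ((E ∩ fibre A g).indicator 1 (translate g y) : ℝ≥0∞) =
      (fibre A (1 : G)).indicator ((translate g ⁻¹' E).indicator 1) y := by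
  classical
  have hmem : translate g y ∈ fibre A g ↔ y ∈ fibre A (1 : G) := by simp [fibre]
  simp only [Set.indicator_apply, Set.mem_inter_iff, hmem, Set.mem_preimage, and_comm, ite_and,
    Pi.one_apply]

end Translate

section Limits

variable {W G : Type*} [Group G] {A : W → W → Prop} {ψ : W → G} {φ : Chain A → ℝ} {ξ : Chain A}
  {b s : ℕ → ℝ} {r C : ℝ} {M : ℝ≥0}

lemma avg_add (t : ℝ) (F F' : Ext A G → ℝ≥0∞) (ζ : Ext A G) :
    avg ψ φ ξ b t (fun y => F y + F' y) ζ = avg ψ φ ξ b t F ζ + avg ψ φ ξ b t F' ζ := by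
  simp only [avg, ruelle_fun_add, mul_add, ENNReal.tsum_add]

lemma avg_indicator_union {E F : Set (Ext A G)} (hd : Disjoint E F) (t : ℝ) (ζ : Ext A G) :
    avg ψ φ ξ b t ((E ∪ F).indicator 1) ζ =
      avg ψ φ ξ b t (E.indicator 1) ζ + avg ψ φ ξ b t (F.indicator 1) ζ := by
  rw [← avg_add, Set.indicator_union_of_disjoint hd]

lemma tendsto_ofReal_exp_mul_pow (C : ℝ) (hr₀ : 0 ≤ r) (hr₁ : r < 1) :
    Tendsto (fun j : ℕ => ENNReal.ofReal (Real.exp (C * r ^ j))) atTop (𝓝 1) := by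
  have hexp := (Real.continuous_exp.tendsto _).comp
    ((tendsto_pow_atTop_nhds_zero_of_lt_one hr₀ hr₁).const_mul C)
  simpa using ENNReal.tendsto_ofReal hexp

namespace IsRegular

variable [TopologicalSpace W] [DiscreteTopology W] [TopologicalSpace G] [DiscreteTopology G]
  {D : ℕ → Ext A G} {N : ℕ} {E : Set (Ext A G)} {z : Ext A G}

lemma le_of_tendsto_of_denseRange (hreg : IsRegular ψ φ ξ b r C M)
    (hs : DecreasesTo s (specRad ψ φ ξ)) (hD : DenseRange D) (hE : IsCyl N E)
    (hconv : ∀ i, ∃ a, Tendsto (fun k => avg ψ φ ξ b (s k) (E.indicator 1) (D i)) atTop (𝓝 a))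
    {l l' : Filter ℕ} [l.NeBot] [l'.NeBot] (hl : l ≤ atTop) (hl' : l' ≤ atTop) {p q : ℝ≥0∞}
    (hp : Tendsto (fun k => avg ψ φ ξ b (s k) (E.indicator 1) z) l (𝓝 p))
    (hq : Tendsto (fun k => avg ψ φ ξ b (s k) (E.indicator 1) z) l' (𝓝 q)) : p ≤ q := by
  obtain ⟨x, e⟩ := z
  obtain ⟨R, hR, hbound⟩ := hreg.exists_avg_le_of_agree N
  let κ (j : ℕ) : ℝ≥0∞ := ENNReal.ofReal (Real.exp (C * r ^ j))
  have hle (j : ℕ) (hj : 1 ≤ j) : p ≤ κ j * (κ j * q) := by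
    obtain ⟨i, hi₂, hi⟩ := hD.mem_nhds (eventually_nhds_agree j (x, e))
    obtain ⟨a, ha⟩ := hconv i
    generalize D i = y at ha hi hi₂
    obtain ⟨x', e'⟩ := y
    obtain rfl : e = e' := hi₂
    have hpa : p ≤ κ j * a :=
      hreg.le_mul_of_tendsto hs hl hR ENNReal.ofReal_ne_top hp (ha.mono_left hl) fun k =>
        hbound (s k) (hs.gt k).le E hE j x x' e hj hi
    have haq : a ≤ κ j * q :=
      hreg.le_mul_of_tendsto hs hl' hR ENNReal.ofReal_ne_top (ha.mono_left hl') hq fun k =>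
        hbound (s k) (hs.gt k).le E hE j x' x e hj fun i' hi' => (hi i' hi').symm
    exact hpa.trans (mul_le_mul' le_rfl haq)
  have hκ : Tendsto κ atTop (𝓝 1) := tendsto_ofReal_exp_mul_pow C hreg.r_pos.le hreg.r_lt_one
  have hlim := ENNReal.Tendsto.mul hκ (Or.inl one_ne_zero)
    (ENNReal.Tendsto.mul_const (b := q) hκ (Or.inl one_ne_zero)) (Or.inr ENNReal.one_ne_top)
  rw [one_mul, one_mul] at hlim
  exact ge_of_tendsto hlim ((eventually_ge_atTop 1).mono hle)

/- Convergence at the points of a dense sequence propagates because the averages are almost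
equicontinuous: any two cluster points agree. -/
lemma exists_tendsto_avg_of_denseRange (hreg : IsRegular ψ φ ξ b r C M)
    (hs : DecreasesTo s (specRad ψ φ ξ)) (hD : DenseRange D) (hE : IsCyl N E)
    (hconv : ∀ i, ∃ a, Tendsto (fun k => avg ψ φ ξ b (s k) (E.indicator 1) (D i)) atTop (𝓝 a))
    (z : Ext A G) :
    ∃ a, Tendsto (fun k => avg ψ φ ξ b (s k) (E.indicator 1) z) atTop (𝓝 a) := by
  let u (k : ℕ) : ℝ≥0∞ := avg ψ φ ξ b (s k) (E.indicator 1) z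
  have hcluster (𝒰 : Ultrafilter ℕ) : ∃ a, Tendsto u 𝒰 (𝓝 a) := ⟨_, (𝒰.map u).le_nhds_lim⟩
  obtain ⟨a, ha⟩ := hcluster (hyperfilter ℕ)
  refine ⟨a, (tendsto_iff_ultrafilter _ _ _).2 fun 𝒰 h𝒰 => ?_⟩
  obtain ⟨a', ha'⟩ := hcluster 𝒰
  have hle := hreg.le_of_tendsto_of_denseRange hs hD hE hconv Nat.hyperfilter_le_atTop h𝒰 ha ha'
  have hge := hreg.le_of_tendsto_of_denseRange hs hD hE hconv h𝒰 Nat.hyperfilter_le_atTop ha' ha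
  rwa [le_antisymm hle hge]

end IsRegular

end Limits

section Fibres

variable {W G : Type*} {A : W → W → Prop} [MeasurableSpace W] [MeasurableSpace G]
  [MeasurableSingletonClass G]

lemma restrict_fibre_sum_restrict_fibre (μ : G → Measure (Ext A G)) (g : G) :
    (Measure.sum fun g' => (μ g').restrict (fibre A g')).restrict (fibre A g) =
      (μ g).restrict (fibre A g) := by
  rw [Measure.restrict_sum _ (measurableSet_fibre g)]
  ext B hB
  rw [Measure.sum_apply _ hB, tsum_eq_single g fun g' hg' => ?_]
  · rw [Measure.restrict_restrict (measurableSet_fibre g), Set.inter_self]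
  · have hdisj : fibre A g ∩ fibre A g' = ∅ :=
      Set.disjoint_iff_inter_eq_empty.1 <| Set.disjoint_left.2 fun u hu hu' =>
        hg' ((hu' : u.2 = g').symm.trans hu)
    rw [Measure.restrict_restrict (measurableSet_fibre g), hdisj, Measure.restrict_empty]
    rfl

end Fibres

section Subsequences

variable {W G : Type*} [Group G] {A : W → W → Prop} {ψ : W → G} {φ : Chain A → ℝ} {ξ : Chain A}
  {b s : ℕ → ℝ}

lemma exists_strictMono_tendsto_avg_wordCyl [Countable W] [Countable G] (ψ : W → G)
    (φ : Chain A → ℝ) (ξ : Chain A) (b s : ℕ → ℝ) (D : ℕ → Ext A G) :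
    ∃ θ : ℕ → ℕ, StrictMono θ ∧ ∀ (g : G) (w : Σ N : ℕ, Fin N → W) (i : ℕ), ∃ a, Tendsto
      (fun k => avg ψ φ ξ b ((s ∘ θ) k) ((wordCyl A g w).indicator 1) (D i)) atTop (𝓝 a) := by
  obtain ⟨a, θ, hθ, ha⟩ := CompactSpace.tendsto_subseq
    fun (k : ℕ) (p : G × (Σ N : ℕ, Fin N → W) × ℕ) =>
      avg ψ φ ξ b (s k) ((wordCyl A p.1 p.2.1).indicator 1) (D p.2.2)
  exact ⟨θ, hθ, fun g w i => ⟨_, tendsto_pi_nhds.1 ha (g, w, i)⟩⟩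

variable [MeasurableSpace W] [TopologicalSpace W] [MeasurableSpace G] [TopologicalSpace G]

/-- Property (C) for a given choice of the weight `b` and of the sequence `s`, with limit `m`. -/
structure HasBaseLimit (ψ : W → G) (φ : Chain A → ℝ) (ξ : Chain A) (b s : ℕ → ℝ)
    (m : Measure (Ext A G)) : Prop where
  decreases : DecreasesTo s (specRad ψ φ ξ)
  prob : IsProbabilityMeasure m
  conv : ∀ f : Ext A G →ᵇ ℝ≥0,
    Tendsto (fun k => ∫⁻ y in fibre A (1 : G), f y ∂(approxMeasure ψ φ ξ b (s k) (ξ, 1)))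
      atTop (𝓝 (∫⁻ y, f y ∂m))

lemma HasBaseLimit.comp (hm : HasBaseLimit ψ φ ξ b s m) {θ : ℕ → ℕ} (hθ : StrictMono θ) :
    HasBaseLimit ψ φ ξ b (s ∘ θ) m where
  decreases :=
    { anti := hm.decreases.anti.comp_monotone hθ.monotone
      gt := fun k => hm.decreases.gt (θ k)
      lim := hm.decreases.lim.comp hθ.tendsto_atTop }
  prob := hm.prob
  conv := fun f => (hm.conv f).comp hθ.tendsto_atTop

end Subsequences

section Existence

variable {W G : Type*} [Countable W] [TopologicalSpace W] [DiscreteTopology W]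
  [MeasurableSpace W] [DiscreteMeasurableSpace W]
  [Group G] [Countable G] [TopologicalSpace G] [DiscreteTopology G]
  [MeasurableSpace G] [DiscreteMeasurableSpace G]
  {A : W → W → Prop} {ψ : W → G} {φ : Chain A → ℝ} {ξ : Chain A}
  {b s : ℕ → ℝ} {r C : ℝ} {M : ℝ≥0}

namespace HasBaseLimit

variable {m : Measure (Ext A G)}

lemma tendsto_avg (hm : HasBaseLimit ψ φ ξ b s m) (g : G) {N : ℕ} {E : Set (Ext A G)}
    (hE : IsCyl N E) :
    Tendsto (fun k => avg ψ φ ξ b (s k) ((E ∩ fibre A g).indicator 1) (ξ, g)) atTop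
      (𝓝 (m.map (translate g) E)) := by
  have hE' := hE.preimage_translate g
  have hconv := hm.conv (clopenIndicator hE'.isClopen)
  simp only [setLIntegral_approxMeasure, coe_clopenIndicator] at hconv
  rw [lintegral_indicator_one hE'.measurableSet,
    ← Measure.map_apply (measurable_translate g) hE.measurableSet] at hconv
  have hpt : ((ξ, g) : Ext A G) = translate g (ξ, 1) := by simp
  simpa only [hpt, avg_translate, indicator_inter_fibre_translate] using hconv

lemma exists_le_mul_map_translate (hm : HasBaseLimit ψ φ ξ b s m)
    (hreg : IsRegular ψ φ ξ b r C M) (z : Ext A G) (g : G) :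
    ∃ K : ℝ≥0∞, K ≠ ⊤ ∧ ∀ (l : Filter ℕ) [l.NeBot], l ≤ atTop →
      ∀ (N : ℕ) (E : Set (Ext A G)), IsCyl N E → ∀ a : ℝ≥0∞,
        Tendsto (fun k => avg ψ φ ξ b (s k) ((E ∩ fibre A g).indicator 1) z) l (𝓝 a) →
          a ≤ K * m.map (translate g) E := by
  obtain ⟨K, hK, hbound⟩ := hreg.exists_avg_le_mul (s 0) z (ξ, g)
  refine ⟨K, hK, fun l _ hl N E hE a ha => ?_⟩
  obtain ⟨R, hR, hR'⟩ := hbound N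
  exact hreg.le_mul_of_tendsto hm.decreases hl hR hK ha ((hm.tendsto_avg g hE).mono_left hl)
    fun k => hR' (s k) (hm.decreases.gt k).le (hm.decreases.le_zero k) _
      (hE.inter (isCyl_fibre N g))

/- The ultrafilter limits of the approximating measures of cylinders form a content, which is
dominated by a translate of the measure given by property (C). -/
lemma exists_measure (hm : HasBaseLimit ψ φ ξ b s m) (hreg : IsRegular ψ φ ξ b r C M)
    (𝒰 : Ultrafilter ℕ) (h𝒰 : (𝒰 : Filter ℕ) ≤ atTop) (z : Ext A G) (g : G) :
    ∃ ν : Measure (Ext A G), ν (fibre A g) ≠ ⊤ ∧ ∀ N E, IsCyl N E →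
      Tendsto (fun k => avg ψ φ ξ b (s k) ((E ∩ fibre A g).indicator 1) z) 𝒰 (𝓝 (ν E)) := by
  have := hm.prob
  have : IsProbabilityMeasure (m.map (translate g)) :=
    Measure.isProbabilityMeasure_map (measurable_translate g).aemeasurable
  let u (E : Set (Ext A G)) (k : ℕ) : ℝ≥0∞ :=
    avg ψ φ ξ b (s k) ((E ∩ fibre A g).indicator 1) z
  have hlim (E : Set (Ext A G)) : ∃ l, Tendsto (u E) 𝒰 (𝓝 l) := ⟨_, (𝒰.map (u E)).le_nhds_lim⟩
  choose L hL using hlim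
  obtain ⟨K, hK, hdom⟩ := hm.exists_le_mul_map_translate hreg z g
  have hle (N : ℕ) (E : Set (Ext A G)) (hE : IsCyl N E) : L E ≤ K * m.map (translate g) E :=
    hdom 𝒰 h𝒰 N E hE (L E) (hL E)
  have hempty : L ∅ = 0 := by
    simpa only [measure_empty, mul_zero, nonpos_iff_eq_zero] using
      hle 0 ∅ fun _ _ _ _ hz => hz
  have hadd (E F : Set (Ext A G)) (hd : Disjoint E F) : L (E ∪ F) = L E + L F := by
    refine tendsto_nhds_unique (hL (E ∪ F)) (((hL E).add (hL F)).congr fun k => ?_)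
    simp only [u, Set.union_inter_distrib_right]
    exact (avg_indicator_union (hd.mono Set.inter_subset_left Set.inter_subset_left) _ _).symm
  obtain ⟨ν, hν⟩ := exists_measure_of_le_mul_measure hK hempty hadd hle
  refine ⟨ν, ?_, fun N E hE => hν N E hE ▸ hL E⟩
  rw [hν 0 _ (isCyl_fibre 0 g)]
  exact ne_top_of_le_ne_top (ENNReal.mul_ne_top hK (measure_ne_top _ _))
    (hle 0 _ (isCyl_fibre 0 g))

lemma exists_measure_tendsto_wordCyl (hm : HasBaseLimit ψ φ ξ b s m)
    (hreg : IsRegular ψ φ ξ b r C M) {D : ℕ → Ext A G} (hD : DenseRange D)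
    (hconv : ∀ (g : G) (w : Σ N : ℕ, Fin N → W) (i : ℕ), ∃ a, Tendsto
      (fun k => avg ψ φ ξ b (s k) ((wordCyl A g w).indicator 1) (D i)) atTop (𝓝 a))
    (z : Ext A G) (g : G) :
    ∃ ν : Measure (Ext A G), ν (fibre A g) ≠ ⊤ ∧ ∀ w, Tendsto
      (fun k => approxMeasure ψ φ ξ b (s k) z (wordCyl A g w)) atTop (𝓝 (ν (wordCyl A g w))) := by
  obtain ⟨ν, hfin, hν⟩ := hm.exists_measure hreg (hyperfilter ℕ) Nat.hyperfilter_le_atTop z g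
  refine ⟨ν, hfin, fun w => ?_⟩
  simp only [← lintegral_indicator_one (isCyl_wordCyl g w).measurableSet,
    lintegral_approxMeasure]
  rw [lintegral_indicator_one (isCyl_wordCyl g w).measurableSet]
  obtain ⟨a, ha⟩ := hreg.exists_tendsto_avg_of_denseRange hm.decreases hD (isCyl_wordCyl g w)
    (hconv g w) z
  have hνw := hν _ _ (isCyl_wordCyl g w)
  rw [Set.inter_eq_left.2 (wordCyl_subset_fibre g w)] at hνw
  rwa [tendsto_nhds_unique hνw (ha.mono_left Nat.hyperfilter_le_atTop)]

lemma exists_isLimitFamily (hm : HasBaseLimit ψ φ ξ b s m) (hreg : IsRegular ψ φ ξ b r C M) :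
    ∃ (s' : ℕ → ℝ) (ν : Ext A G → Measure (Ext A G)), IsLimitFamily ψ φ ξ b s' ν := by
  have : Nonempty (Ext A G) := ⟨(ξ, 1)⟩
  obtain ⟨θ, hθ, hconv⟩ := exists_strictMono_tendsto_avg_wordCyl ψ φ ξ b s
    (TopologicalSpace.denseSeq (Ext A G))
  choose μ hfin hμ using (hm.comp hθ).exists_measure_tendsto_wordCyl hreg
    (TopologicalSpace.denseRange_denseSeq (Ext A G)) hconv
  refine ⟨s ∘ θ, fun z => Measure.sum fun g => (μ z g).restrict (fibre A g), hreg.weight,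
    (hm.comp hθ).decreases, fun z g f => ?_⟩
  rw [restrict_fibre_sum_restrict_fibre]
  exact tendsto_setLIntegral_fibre_of_wordCyl (hfin z g) (hμ z g) f

end HasBaseLimit

end Existence

end GroupExt

end

open GroupExt in
theorem mainTheorem4_general {W G : Type*}
    [Countable W] [TopologicalSpace W] [DiscreteTopology W]
    [MeasurableSpace W] [DiscreteMeasurableSpace W]
    [Group G] [Countable G] [TopologicalSpace G] [DiscreteTopology G]
    [MeasurableSpace G] [DiscreteMeasurableSpace G]
    (A : W → W → Prop) (hbip : BigImagesPreimages A)
    (ψ : W → G) (htrans : TopTransitiveExt A ψ)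
    (φ : Chain A → ℝ) (hφ : ∀ x, 0 < φ x)
    (r : ℝ) (hr₀ : 0 < r) (hr₁ : r < 1) (hHol : LogLocallyHolder r φ)
    (hL : BoundedRuelleOne φ)
    (ξ : Chain A) :
    (PropertyC ψ φ ξ →
      ∃ (b s : ℕ → ℝ) (ν : Ext A G → Measure (Ext A G)),
        IsLimitFamily ψ φ ξ b s ν) ∧
    (∀ (b s : ℕ → ℝ) (ν : Ext A G → Measure (Ext A G)),
      IsLimitFamily ψ φ ξ b s ν →
      ∀ ξ₀ : Chain A,
        (∀ z : Ext A G,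
          (∀ g : G, ν z (fibre A g) < ⊤) ∧ ν z ≪ ν (ξ₀, 1)) ∧
        ∀ f ∈ logUnifCont (ν (ξ₀, 1)),
          (∀ z : Ext A G,
            Integrable f (ν z) ∧
            Integrable (fun y => martinKernel ν (ξ₀, 1) z y * f y) (ν (ξ₀, 1)) ∧
            Theta ν (ξ₀, 1) f z = ∫ y, f y ∂(ν z)) ∧
          Theta ν (ξ₀, 1) f ∈ harmonicLip ψ φ r ξ) ∧
    distortionConst r φ < ⊤ ∧
    (∀ f ∈ harmonicLip ψ φ r ξ, (∀ z, 0 ≤ f z) →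
      logLip r f ≤ distortionConst r φ ∧
      f ∈ harmonicPos ψ φ r ξ) := by
  obtain ⟨C, hD⟩ := hHol.exists_hasDistortion hφ hr₀.le hr₁
  obtain ⟨M, hM⟩ := hL
  have hreg {b : ℕ → ℝ} (hb : IsWeight ψ φ ξ b) : IsRegular ψ φ ξ b r C M :=
    ⟨hφ, hr₀, hr₁, hD, hM, hbip, htrans, hb⟩
  have hCφ := hD.distortionConst_lt_top hφ hr₀.le hr₁.le
  refine ⟨?_, fun b s ν hν ξ₀ => ?_, hCφ, fun f hf hf₀ => ?_⟩
  · rintro ⟨b, s, m, hb, hs, hm, hconv⟩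
    exact ⟨b, HasBaseLimit.exists_isLimitFamily ⟨hs, hm, hconv⟩ (hreg hb)⟩
  · have hreg := hreg hν.weight
    refine ⟨fun z => ⟨hν.fibre_lt_top hreg z, hν.absolutelyContinuous hreg z (ξ₀, 1)⟩,
      fun f hf => ?_⟩
    have hint := hν.integrable_of_mem_logUnifCont hreg hf
    have hΘ := fun z => hν.theta_eq_integral hreg (ξ₀, 1) z f
    refine ⟨fun z => ⟨hint z, hν.integrable_martinKernel_mul hreg (ξ₀, 1) (hint z), hΘ z⟩, ?_⟩
    rw [funext hΘ]
    exact hν.integral_mem_harmonicLip hreg hint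
  · have hLD := logLip_le_distortionConst hφ hr₀ hr₁ (hD.specRad_pos hφ hM htrans ξ) hCφ.ne hf hf₀
    exact ⟨hLD, hf₀, hf.1, hLD.trans_lt hCφ⟩

theorem mainTheorem4 {W G : Type*}
    [Countable W] [TopologicalSpace W] [DiscreteTopology W]
    [MeasurableSpace W] [DiscreteMeasurableSpace W]
    [Group G] [Countable G] [TopologicalSpace G] [DiscreteTopology G]
    [MeasurableSpace G] [DiscreteMeasurableSpace G]
    (A : W → W → Prop) (hA : GroupExt.NoZeroLines A)
    (hmix : GroupExt.TopMixing A) (hbip : GroupExt.BigImagesPreimages A)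
    (ψ : W → G) (htrans : GroupExt.TopTransitiveExt A ψ)
    (φ : GroupExt.Chain A → ℝ) (hφ : ∀ x, 0 < φ x)
    (r : ℝ) (hr₀ : 0 < r) (hr₁ : r < 1) (hHol : GroupExt.LogLocallyHolder r φ)
    (hL : GroupExt.BoundedRuelleOne φ)
    (ξ : GroupExt.Chain A) (hC : GroupExt.PropertyC ψ φ ξ) :
    -- the measures `ν_z` exist
    (∃ (b s : ℕ → ℝ) (ν : GroupExt.Ext A G → Measure (GroupExt.Ext A G)),
      GroupExt.IsLimitFamily ψ φ ξ b s ν) ∧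
    -- for every such family and every base point `o ∈ X_id`, `Θ : 𝓒 → 𝓗` is well defined
    (∀ (b s : ℕ → ℝ) (ν : GroupExt.Ext A G → Measure (GroupExt.Ext A G)),
      GroupExt.IsLimitFamily ψ φ ξ b s ν →
      ∀ ξ₀ : GroupExt.Chain A,
        (∀ z : GroupExt.Ext A G,
          (∀ g : G, ν z (GroupExt.fibre A g) < ⊤) ∧ ν z ≪ ν (ξ₀, 1)) ∧
        ∀ f ∈ GroupExt.logUnifCont (ν (ξ₀, 1)),
          (∀ z : GroupExt.Ext A G,
            Integrable f (ν z) ∧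
            Integrable (fun y => GroupExt.martinKernel ν (ξ₀, 1) z y * f y) (ν (ξ₀, 1)) ∧
            GroupExt.Theta ν (ξ₀, 1) f z = ∫ y, f y ∂(ν z)) ∧
          GroupExt.Theta ν (ξ₀, 1) f ∈ GroupExt.harmonicLip ψ φ r ξ) ∧
    -- the bound on `LD` for nonnegative elements of `𝓗`
    GroupExt.distortionConst r φ < ⊤ ∧
    (∀ f ∈ GroupExt.harmonicLip ψ φ r ξ, (∀ z, 0 ≤ f z) →
      GroupExt.logLip r f ≤ GroupExt.distortionConst r φ ∧
      f ∈ GroupExt.harmonicPos ψ φ r ξ) := by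
  obtain ⟨hexists, hrest⟩ :=
    mainTheorem4_general A hbip ψ htrans φ hφ r hr₀ hr₁ hHol hL ξ
  exact ⟨hexists hC, hrest⟩
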